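/- **Setting.** Fix an integer $p\ge 1$ and constants $c,C,\delta,C_\delta>0$. For $N=2pW$, let $H=(H_{ij})_{1\le i,j\le N}$ be a real symmetric random matrix with centered entries, independent up to the symmetry $H_{ij}=H_{ji}$. Write $|i-j|$ for the distance on $\{1,\dots,N\}$ with periodic boundary condition mod $N$ and $s_{ij}=\mathbb E(H_{ij}^2)$. Assume that $H_{ij}=0$ almost surely if $|i-j|>2W$; that $\sum_j s_{ij}=1$ for every $i$; that $s_{ij}\le C/W$ for all $i,j$ and $s_{ij}\ge c/W$ if $|i-j|<2W$; and that $\mathbb E\, e^{\delta W H_{ij}^2}\le C_\delta$ for all $i,j$. For $\mathbf g\in\mathbb R^N$ put $$H^{\mathbf g}=H-\sum_{j=1}^N g_j\mathbf e_j\mathbf e_j^*=\begin{pmatrix}A^{\mathbf g}&B^*\\ B&D^{\mathbf g}\end{pmatrix},\qquad Q_e^{\mathbf g}=A^{\mathbf g}-B^*(D^{\mathbf g}-e)^{-1}B\quad(e\in\mathbb R\setminus\sigma(D^{\mathbf g})),$$ where $A^{\mathbf g}$ is of size $W\times W$. Let $\xi_1^{\mathbf g}(e)\le\dots\le\xi_W^{\mathbf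 g}(e)$ be the eigenvalues of $Q_e^{\mathbf g}$ and $\mathcal N_{D^{\mathbf g}}(e)$ the number of eigenvalues of $D^{\mathbf g}$ smaller than $e$, counted with multiplicity. For $1\le k\le N$ and $e\notin\sigma(D^{\mathbf g})$, the curve $\mathcal C_k^{\mathbf g}$ is defined at $e$ if $k'=k-\mathcal N_{D^{\mathbf g}}(e)\in\{1,\dots,W\}$, and then $\mathcal C_k^{\mathbf g}(e)=\xi^{\mathbf g}_{k'}(e)$. Its absolute slope at such $e$ is $$\Big|\frac{\mathrm d\,\mathcal C_k^{\mathbf g}}{\mathrm d e}(e)\Big|:=\limsup_{x\to e,\ x\ne e}\frac{|\mathcal C_k^{\mathbf g}(x)-\mathcal C_k^{\mathbf g}(e)|}{|x-e|},$$ which is the absolute value of the derivative wherever the derivative exists. **Lemma 4.3.** For every $K>0$ there is a constant $C_K>0$, depending only on $K,p,c,C,\delta,C_\delta$, such that for every $\zeta>0$ and $D>0$ there is $N_0$, depending only on $\zeta,D,K,p,c,C,\delta,C_\delta$, such that for all $N=2pW\ge N_0$ and all $H$ as above, $$\mathbb P\Big(\exists\,\mathbf g\in\mathbb R^N,\ \|\mathbf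 g\|_\infty\le N^{-\zeta},\ \exists\, k\in\{1,\dots,N\},\ \exists\, e\notin\sigma(D^{\mathbf g}):\ \mathcal C_k^{\mathbf g}\text{ is defined at }e,\ |\mathcal C_k^{\mathbf g}(e)|\le K,\ \Big|\frac{\mathrm d\,\mathcal C_k^{\mathbf g}}{\mathrm d e}(e)\Big|>C_K\Big)\le N^{-D},$$ where $\mathbb P$ denotes the outer probability in case the event is not measurable. -/

import Mathlib

open MeasureTheory ProbabilityTheory Filter Topology
open scoped ENNReal

namespace BandMatrix

/-- Distance on `{1, …, N}` with periodic boundary condition mod `N`. -/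
def periodicDist {N : ℕ} (i j : Fin N) : ℕ :=
  min ((i : ℤ) - (j : ℤ)).natAbs (N - ((i : ℤ) - (j : ℤ)).natAbs)

/-- Real symmetric random band matrices of size `N = 2 p W`: centered entries that are independent
up to symmetry and vanish at periodic distance larger than `2 W`, variances `s_ij = 𝔼 H_ij²` with
unit row sums which are at most `C / W` and, for indices at distance less than `2 W`
(band of width `4 W - 1`), at least `c / W`; and `𝔼 exp (δ W H_ij²) ≤ Cδ`. -/
structure IsBandEnsemble (p W : ℕ) (c C δ Cδ : ℝ) {Ω : Type*} [MeasurableSpace Ω]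
    (P : Measure Ω) (H : Ω → Matrix (Fin (2 * p * W)) (Fin (2 * p * W)) ℝ) : Prop where
  measurable : ∀ i j, Measurable fun ω => H ω i j
  symm : ∀ ω, (H ω).IsSymm
  indep : iIndepFun
    (fun (q : {q : Fin (2 * p * W) × Fin (2 * p * W) // q.1 ≤ q.2}) (ω : Ω) =>
      H ω q.1.1 q.1.2) P
  centered : ∀ i j, ∫ ω, H ω i j ∂P = 0
  band : ∀ i j, 2 * W < periodicDist i j → ∀ᵐ ω ∂P, H ω i j = 0
  row_sum : ∀ i, ∑ j, ∫ ω, (H ω i j) ^ 2 ∂P = 1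
  var_le : ∀ i j, ∫ ω, (H ω i j) ^ 2 ∂P ≤ C / W
  le_var : ∀ i j, periodicDist i j < 2 * W → c / W ≤ ∫ ω, (H ω i j) ^ 2 ∂P
  subgaussian : ∀ i j,
    ∫⁻ ω, ENNReal.ofReal (Real.exp (δ * W * (H ω i j) ^ 2)) ∂P ≤ ENNReal.ofReal Cδ

section Blocks

variable {N : ℕ}

/-- The diagonal perturbation `H^g = H - ∑ j, g_j e_j e_j*`. -/
def perturb (H : Matrix (Fin N) (Fin N) ℝ) (g : Fin N → ℝ) : Matrix (Fin N) (Fin N) ℝ :=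
  H - Matrix.diagonal g

/-- The upper left `W × W` block `A^g` of `H^g`. -/
def blockA (W : ℕ) (H : Matrix (Fin N) (Fin N) ℝ) (g : Fin N → ℝ) :
    Matrix {i : Fin N // (i : ℕ) < W} {i : Fin N // (i : ℕ) < W} ℝ :=
  (perturb H g).toBlock (fun i => (i : ℕ) < W) (fun i => (i : ℕ) < W)

/-- The lower left `(N - W) × W` block `B` of `H` (and of `H^g`). -/
def blockB (W : ℕ) (H : Matrix (Fin N) (Fin N) ℝ) :
    Matrix {i : Fin N // ¬ (i : ℕ) < W} {i : Fin N // (i : ℕ) < W} ℝ :=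
  H.toBlock (fun i => ¬ (i : ℕ) < W) (fun i => (i : ℕ) < W)

/-- The lower right `(N - W) × (N - W)` block `D^g` of `H^g`. -/
def blockD (W : ℕ) (H : Matrix (Fin N) (Fin N) ℝ) (g : Fin N → ℝ) :
    Matrix {i : Fin N // ¬ (i : ℕ) < W} {i : Fin N // ¬ (i : ℕ) < W} ℝ :=
  (perturb H g).toBlock (fun i => ¬ (i : ℕ) < W) (fun i => ¬ (i : ℕ) < W)

/-- `Q_e^g = A^g - B* (D^g - e)⁻¹ B`, meaningful for `e` outside the spectrum of `D^g`. -/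
noncomputable def schurQ (W : ℕ) (H : Matrix (Fin N) (Fin N) ℝ) (g : Fin N → ℝ) (e : ℝ) :
    Matrix {i : Fin N // (i : ℕ) < W} {i : Fin N // (i : ℕ) < W} ℝ :=
  blockA W H g
    - (blockB W H).transpose * (blockD W H g - e • (1 : Matrix _ _ ℝ))⁻¹ * blockB W H

theorem perturb_isSymm {H : Matrix (Fin N) (Fin N) ℝ} (hH : H.IsSymm) (g : Fin N → ℝ) :
    (perturb H g).IsSymm :=
  hH.sub (Matrix.isSymm_diagonal g)

theorem blockA_isSymm (W : ℕ) {H : Matrix (Fin N) (Fin N) ℝ} (hH : H.IsSymm) (g : Fin N → ℝ) :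
    (blockA W H g).IsSymm :=
  (perturb_isSymm hH g).submatrix _

theorem blockD_isSymm (W : ℕ) {H : Matrix (Fin N) (Fin N) ℝ} (hH : H.IsSymm) (g : Fin N → ℝ) :
    (blockD W H g).IsSymm :=
  (perturb_isSymm hH g).submatrix _

theorem isHermitian_of_isSymm {n : Type*} {M : Matrix n n ℝ} (hM : M.IsSymm) :
    M.IsHermitian := by
  rw [Matrix.IsHermitian, Matrix.conjTranspose_eq_transpose_of_trivial]
  exact hM

theorem schurQ_isSymm (W : ℕ) {H : Matrix (Fin N) (Fin N) ℝ} (hH : H.IsSymm)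
    (g : Fin N → ℝ) (e : ℝ) : (schurQ W H g e).IsSymm := by
  refine (blockA_isSymm W hH g).sub ?_
  have hD : (blockD W H g - e • (1 : Matrix _ _ ℝ)).transpose
      = blockD W H g - e • (1 : Matrix _ _ ℝ) :=
    (blockD_isSymm W hH g).sub (Matrix.isSymm_one.smul e)
  rw [Matrix.IsSymm, Matrix.transpose_mul, Matrix.transpose_mul, Matrix.transpose_transpose,
    Matrix.transpose_nonsing_inv, hD, Matrix.mul_assoc]

end Blocks

/-- The eigenvalues of a real symmetric matrix in increasing order, counted with multiplicity;
the index `0` gives the smallest one. (Mathlib's `eigenvalues₀` is decreasing.) -/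
noncomputable def orderedEigenvalue {n : Type*} [Fintype n] [DecidableEq n]
    {M : Matrix n n ℝ} (hM : M.IsSymm) (k : Fin (Fintype.card n)) : ℝ :=
  (isHermitian_of_isSymm hM).eigenvalues₀ k.rev

/-- The number of eigenvalues of a real symmetric matrix smaller than `e`, counted with
multiplicity. -/
noncomputable def countBelow {n : Type*} [Fintype n] [DecidableEq n]
    {M : Matrix n n ℝ} (hM : M.IsSymm) (e : ℝ) : ℕ :=
  Fintype.card {k : Fin (Fintype.card n) // orderedEigenvalue hM k < e}

section Curves

variable {N : ℕ}

/-- The points outside the spectrum of `D^g` at which the curve with label `k` exists: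
those `e` for which `k' = k - 𝒩(e)` lies in `{1, …, W}`, where `𝒩(e)` is the number of
eigenvalues of `D^g` smaller than `e`. -/
def curveDom (W : ℕ) {H : Matrix (Fin N) (Fin N) ℝ} (hH : H.IsSymm) (g : Fin N → ℝ) (k : ℕ) :
    Set ℝ :=
  {e | e ∉ spectrum ℝ (blockD W H g) ∧ countBelow (blockD_isSymm W hH g) e + 1 ≤ k ∧
    k ≤ countBelow (blockD_isSymm W hH g) e + Fintype.card {i : Fin N // (i : ℕ) < W}}

open Classical in
/-- The curve `𝒞_k^g (e) = ξ_{k'}^g (e)`, where `k' = k - 𝒩(e)` and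
`ξ_1^g (e) ≤ … ≤ ξ_W^g (e)` are the eigenvalues of `Q_e^g`; here `k ∈ {1, …, N}`.
Outside `curveDom` the value is irrelevant. -/
noncomputable def curve (W : ℕ) {H : Matrix (Fin N) (Fin N) ℝ} (hH : H.IsSymm) (g : Fin N → ℝ)
    (k : ℕ) (e : ℝ) : ℝ :=
  if h : e ∈ curveDom W hH g k then
    orderedEigenvalue (schurQ_isSymm W hH g e)
      ⟨k - countBelow (blockD_isSymm W hH g) e - 1, by
        obtain ⟨-, h₁, h₂⟩ := h
        omega⟩
  else 0

end Curves

/-- The absolute slope `limsup_{x → e, x ≠ e} |f x - f e| / |x - e|` of `f` at `e`. It is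
`|f' e|` where `f` is differentiable, and also controls the one-sided slopes where `f` has a
corner, as the ordered eigenvalues may have at a crossing. -/
noncomputable def absSlope (f : ℝ → ℝ) (e : ℝ) : ℝ≥0∞ :=
  limsup (fun x => ‖slope f e x‖ₑ) (𝓝[≠] e)

theorem absSlope_eq_of_hasDerivAt {f : ℝ → ℝ} {f' e : ℝ} (h : HasDerivAt f f' e) :
    absSlope f e = ENNReal.ofReal |f'| := by
  rw [← Real.enorm_eq_ofReal_abs]
  exact ((hasDerivAt_iff_tendsto_slope.1 h).enorm).limsup_eq

end BandMatrix

/-! The curve `𝒞_k^g` has slope `- ‖v‖² / ‖u‖²` at `e`, where `u` is an eigenvector of `Q_e^g` with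
eigenvalue `ξ = 𝒞_k^g (e)` and `v = - (D^g - e)⁻¹ B u`, that is, `H^g (u, v) = (ξ u, e v)`. At a
crossing the ordered eigenvalues are only Lipschitz, and the Courant–Fischer principle still bounds
the absolute slope by the maximum of `‖v‖² / ‖u‖²` over the eigenspace (`absSlope_curve_le`).
From `(H^g - e) (0, v) = (ξ u, 0) - H^g (u, 0)` it follows that `‖v‖ ≤ const * ‖u‖` as soon as the
norm of `H` is bounded and `‖(H - e) w‖ ≥ κ ‖w‖` for all `e` and all `w` vanishing on the first `W`
coordinates (`absSlope_curve_le_of_bounded_below`): a small perturbation `g` is absorbed by `κ`, so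
that all `g` are treated at once.

It remains to prove this lower bound with probability `1 - exp (-a W)`
(`exists_expRare_not_bounded_below`), by a net argument. For a fixed vector `y`, the small ball
probability of `(H - e) y` is estimated by Gaussian smoothing (`IsBandEnsemble.measure_l2_le`):
`𝔼 exp (- ∑ z_i² / 2)` is a Gaussian average of joint characteristic functions of the rows, in which
all entries except those with row in `I` and column in a disjoint set `S` are discarded, so that the
bound factorizes over the rows `i ∈ I` without any conditioning.

Divide the coordinates into `2 p` blocks of length `W`, and call a block of `w` rich at scale `ε` if
more than `2 W / L` of its coordinates are at least `ε / √N`. A vector without rich blocks is close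
to a very sparse one, and a small net suffices (`exists_expRare_no_rich`). If `w` has `r ≥ 1` rich
blocks, and these are the same at a scale `ε' ≪ ε`, then at scale `ε'` the vector has about `r W`
degrees of freedom, and the net has about `ε' ^ (- r W)` elements. However `(r + 1) W` rows have a
small ball probability of order `ε'` each: those of the rich blocks and those of the block preceding the
first rich block, which exists because the first block of `w` vanishes and which sees the next block
as the band is wide. The gain `ε' ^ W` wins if `ε'` is small (`exists_expRare_rich_eq`). Since
decreasing the scale can only add rich blocks, after at most `2 p` changes of scale these two cases
cover all vectors (`exists_expRare_rich`). -/

namespace BandMatrix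

universe u

/-! ### The Courant–Fischer principle and perturbation of ordered eigenvalues -/

section OrderedEigenvalues

open scoped InnerProductSpace

variable {n : Type*} [Fintype n]

theorem norm_sq_eq_sum_inner_sq {ι : Type*} [Fintype ι]
    (b : OrthonormalBasis ι ℝ (EuclideanSpace ℝ n)) (u : EuclideanSpace ℝ n) :
    ‖u‖ ^ 2 = ∑ k, ⟪b k, u⟫_ℝ ^ 2 := by
  rw [← b.sum_sq_norm_inner_right]
  simp

/-- Two orthonormal bases and an index `k`: some nonzero vector is orthogonal to the vectors of
index `< k` of the first basis and to those of index `> k` of the second. -/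
theorem exists_ne_zero_inner_eq_zero
    (b b' : OrthonormalBasis (Fin (Fintype.card n)) ℝ (EuclideanSpace ℝ n))
    (k : Fin (Fintype.card n)) :
    ∃ u : EuclideanSpace ℝ n, u ≠ 0 ∧ (∀ j < k, ⟪b j, u⟫_ℝ = 0) ∧ ∀ j, k < j → ⟪b' j, u⟫_ℝ = 0 := by
  let f : EuclideanSpace ℝ n →ₗ[ℝ] ({j : Fin (Fintype.card n) // j ≠ k} → ℝ) :=
    LinearMap.pi fun j => if j.1 < k then (innerₛₗ ℝ (b j)) else (innerₛₗ ℝ (b' j))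
  have hf : LinearMap.ker f ≠ ⊥ := by
    apply LinearMap.ker_ne_bot_of_finrank_lt
    rw [Module.finrank_fintype_fun_eq_card, finrank_euclideanSpace, Fintype.card_subtype_compl]
    simp only [Fintype.card_fin, Fintype.card_unique]
    have := k.2
    omega
  obtain ⟨u, hu, hu0⟩ := (Submodule.ne_bot_iff _).1 hf
  have hu' : ∀ j : {j : Fin (Fintype.card n) // j ≠ k}, f u j = 0 := fun j => by
    rw [LinearMap.mem_ker.1 hu]; rfl
  refine ⟨u, hu0, fun j hj => ?_, fun j hj => ?_⟩
  · simpa [f, hj] using hu' ⟨j, hj.ne⟩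
  · simpa [f, not_lt.2 hj.le] using hu' ⟨j, hj.ne'⟩

variable [DecidableEq n] {M : Matrix n n ℝ}

theorem orderedEigenvalue_monotone (hM : M.IsSymm) : Monotone (orderedEigenvalue hM) :=
  fun _ _ h => (isHermitian_of_isSymm hM).eigenvalues₀_antitone (Fin.rev_le_rev.2 h)

/-- An orthonormal basis of eigenvectors, numbered as the increasing eigenvalues are. -/
noncomputable def orderedEigenbasis (hM : M.IsSymm) :
    OrthonormalBasis (Fin (Fintype.card n)) ℝ (EuclideanSpace ℝ n) :=
  (isHermitian_of_isSymm hM).eigenvectorBasis.reindex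
    ((Fintype.equivOfCardEq (Fintype.card_fin _)).symm.trans Fin.revPerm)

theorem toEuclideanLin_orderedEigenbasis (hM : M.IsSymm) (k : Fin (Fintype.card n)) :
    M.toEuclideanLin (orderedEigenbasis hM k)
      = orderedEigenvalue hM k • orderedEigenbasis hM k := by
  have h := (isHermitian_of_isSymm hM).mulVec_eigenvectorBasis
    (Fintype.equivOfCardEq (Fintype.card_fin _) k.rev)
  have h2 : (isHermitian_of_isSymm hM).eigenvalues
    (Fintype.equivOfCardEq (Fintype.card_fin _) k.rev) = orderedEigenvalue hM k := by
    simp [Matrix.IsHermitian.eigenvalues, orderedEigenvalue]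
  rw [h2] at h
  have h3 : orderedEigenbasis hM k = (isHermitian_of_isSymm hM).eigenvectorBasis
    (Fintype.equivOfCardEq (Fintype.card_fin _) k.rev) := by
    simp [orderedEigenbasis]
  rw [h3]
  apply (WithLp.ofLp_injective 2)
  simpa [Matrix.toLpLin_apply] using h

theorem inner_toEuclideanLin_comm (hM : M.IsSymm) (u v : EuclideanSpace ℝ n) :
    ⟪M.toEuclideanLin u, v⟫_ℝ = ⟪u, M.toEuclideanLin v⟫_ℝ :=
  (Matrix.isSymmetric_toEuclideanLin_iff.2 (isHermitian_of_isSymm hM)) u v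

theorem inner_orderedEigenbasis_toEuclideanLin (hM : M.IsSymm) (k : Fin (Fintype.card n))
    (u : EuclideanSpace ℝ n) :
    ⟪orderedEigenbasis hM k, M.toEuclideanLin u⟫_ℝ
      = orderedEigenvalue hM k * ⟪orderedEigenbasis hM k, u⟫_ℝ := by
  rw [← inner_toEuclideanLin_comm hM, toEuclideanLin_orderedEigenbasis, real_inner_smul_left]

theorem inner_toEuclideanLin_eq_sum (hM : M.IsSymm) (u : EuclideanSpace ℝ n) :
    ⟪u, M.toEuclideanLin u⟫_ℝ
      = ∑ k, orderedEigenvalue hM k * ⟪orderedEigenbasis hM k, u⟫_ℝ ^ 2 := by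
  rw [← (orderedEigenbasis hM).sum_inner_mul_inner]
  refine Finset.sum_congr rfl fun k _ => ?_
  rw [inner_orderedEigenbasis_toEuclideanLin, real_inner_comm]
  ring

/-- One half of the Courant–Fischer principle. -/
theorem le_orderedEigenvalue (hM : M.IsSymm) (k : Fin (Fintype.card n))
    (b : OrthonormalBasis (Fin (Fintype.card n)) ℝ (EuclideanSpace ℝ n)) {μ : ℝ}
    (h : ∀ u, (∀ j < k, ⟪b j, u⟫_ℝ = 0) → μ * ‖u‖ ^ 2 ≤ ⟪u, M.toEuclideanLin u⟫_ℝ) :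
    μ ≤ orderedEigenvalue hM k := by
  obtain ⟨u, hu0, hu1, hu2⟩ := exists_ne_zero_inner_eq_zero b (orderedEigenbasis hM) k
  have h1 := h u hu1
  have h2 : ⟪u, M.toEuclideanLin u⟫_ℝ ≤ orderedEigenvalue hM k * ‖u‖ ^ 2 := by
    rw [inner_toEuclideanLin_eq_sum hM, norm_sq_eq_sum_inner_sq (orderedEigenbasis hM),
      Finset.mul_sum]
    refine Finset.sum_le_sum fun j _ => ?_
    rcases le_or_gt j k with hj | hj
    · exact mul_le_mul_of_nonneg_right (orderedEigenvalue_monotone hM hj) (sq_nonneg _)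
    · simp [hu2 j hj]
  exact le_of_mul_le_mul_right (h1.trans h2) (by positivity)

/-- The other half of the Courant–Fischer principle. -/
theorem orderedEigenvalue_le (hM : M.IsSymm) (k : Fin (Fintype.card n))
    (b : OrthonormalBasis (Fin (Fintype.card n)) ℝ (EuclideanSpace ℝ n)) {μ : ℝ}
    (h : ∀ u, (∀ j, k < j → ⟪b j, u⟫_ℝ = 0) → ⟪u, M.toEuclideanLin u⟫_ℝ ≤ μ * ‖u‖ ^ 2) :
    orderedEigenvalue hM k ≤ μ := by
  obtain ⟨u, hu0, hu1, hu2⟩ := exists_ne_zero_inner_eq_zero (orderedEigenbasis hM) b k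
  have h1 := h u hu2
  have h2 : orderedEigenvalue hM k * ‖u‖ ^ 2 ≤ ⟪u, M.toEuclideanLin u⟫_ℝ := by
    rw [inner_toEuclideanLin_eq_sum hM, norm_sq_eq_sum_inner_sq (orderedEigenbasis hM),
      Finset.mul_sum]
    refine Finset.sum_le_sum fun j _ => ?_
    rcases le_or_gt k j with hj | hj
    · exact mul_le_mul_of_nonneg_right (orderedEigenvalue_monotone hM hj) (sq_nonneg _)
    · simp [hu1 j hj]
  exact le_of_mul_le_mul_right (h2.trans h1) (by positivity)

variable {F : Type*} [NormedAddCommGroup F] [NormedSpace ℝ F]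

/-- A bound `‖T u‖² ≤ C ‖u‖²` on the eigenspace of `k` extends to all of space at the cost of an
arbitrarily small increase of `C` and of a term measuring the distance to the eigenspace. -/
theorem exists_norm_sq_le_add (hM : M.IsSymm) (k : Fin (Fintype.card n))
    (T : EuclideanSpace ℝ n →L[ℝ] F) {C ε : ℝ} (hC0 : 0 ≤ C) (hε : 0 < ε)
    (hC : ∀ u, M.toEuclideanLin u = orderedEigenvalue hM k • u → ‖T u‖ ^ 2 ≤ C * ‖u‖ ^ 2) :
    ∃ A : ℝ, 0 ≤ A ∧ ∀ u, ‖T u‖ ^ 2 ≤ (C + ε) * ‖u‖ ^ 2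
      + A * ∑ j, |orderedEigenvalue hM j - orderedEigenvalue hM k|
          * ⟪orderedEigenbasis hM j, u⟫_ℝ ^ 2 := by
  set b := orderedEigenbasis hM with hb
  set l := orderedEigenvalue hM with hl
  obtain ⟨γ, hγ, hγ'⟩ : ∃ γ > 0, ∀ j, l j ≠ l k → γ ≤ |l j - l k| := by
    have hfin := Set.toFinite {j | l j ≠ l k}
    rcases Set.eq_empty_or_nonempty {j | l j ≠ l k} with h | h
    · exact ⟨1, one_pos, fun j hj => absurd hj (by
        have := Set.eq_empty_iff_forall_notMem.1 h j; simpa using this)⟩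
    · obtain ⟨j0, hj0, hmin⟩ := Set.exists_min_image _ (fun j => |l j - l k|) hfin h
      exact ⟨_, abs_pos.2 (sub_ne_zero.2 hj0), hmin⟩
  obtain ⟨θ, hθ, hθC⟩ : ∃ θ > 0, (1 + θ) * C ≤ C + ε := by
    -- `C + 1` in place of `C`, which may vanish.
    refine ⟨ε / (C + 1), by positivity, ?_⟩
    have : ε / (C + 1) * C ≤ ε := by
      rw [div_mul_eq_mul_div, div_le_iff₀ (by positivity)]; nlinarith
    linarith
  refine ⟨(1 + 1 / θ) * ‖T‖ ^ 2 / γ, by positivity, fun u => ?_⟩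
  set u0 : EuclideanSpace ℝ n := ∑ j, (if l j = l k then ⟪b j, u⟫_ℝ else 0) • b j with hu0
  set u1 : EuclideanSpace ℝ n := ∑ j, (if l j = l k then 0 else ⟪b j, u⟫_ℝ) • b j with hu1
  have hsum : u0 + u1 = u := by
    rw [hu0, hu1, ← Finset.sum_add_distrib]
    conv_rhs => rw [← b.sum_repr' u]
    refine Finset.sum_congr rfl fun j _ => ?_
    split_ifs <;> simp
  have hi0 : ∀ j, ⟪b j, u0⟫_ℝ = if l j = l k then ⟪b j, u⟫_ℝ else 0 := fun j => by
    rw [hu0, b.orthonormal.inner_right_fintype]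
  have hi1 : ∀ j, ⟪b j, u1⟫_ℝ = if l j = l k then 0 else ⟪b j, u⟫_ℝ := fun j => by
    rw [hu1, b.orthonormal.inner_right_fintype]
  have hT0 : ‖T u0‖ ^ 2 ≤ C * ‖u0‖ ^ 2 := by
    apply hC
    rw [hu0, map_sum, Finset.smul_sum]
    refine Finset.sum_congr rfl fun j _ => ?_
    rw [map_smul, hb, toEuclideanLin_orderedEigenbasis, smul_comm]
    split_ifs with h
    · rw [← h]
    · simp
  have hn0 : ‖u0‖ ^ 2 ≤ ‖u‖ ^ 2 := by
    rw [norm_sq_eq_sum_inner_sq b, norm_sq_eq_sum_inner_sq b u]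
    refine Finset.sum_le_sum fun j _ => ?_
    rw [hi0]
    split_ifs
    · exact le_rfl
    · simp [sq_nonneg]
  have hn1 : ‖u1‖ ^ 2 ≤ 1 / γ * ∑ j, |l j - l k| * ⟪b j, u⟫_ℝ ^ 2 := by
    rw [norm_sq_eq_sum_inner_sq b, Finset.mul_sum]
    refine Finset.sum_le_sum fun j _ => ?_
    rw [hi1]
    split_ifs with h
    · simp [h]
    · rw [← mul_assoc]
      refine le_mul_of_one_le_left (sq_nonneg _) ?_
      rw [one_div, inv_mul_eq_div, one_le_div hγ]
      exact hγ' j h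
  have hT1 : ‖T u1‖ ^ 2 ≤ ‖T‖ ^ 2 * ‖u1‖ ^ 2 := by
    rw [← mul_pow]
    exact pow_le_pow_left₀ (norm_nonneg _) (T.le_opNorm u1) 2
  have hTu : ‖T u‖ ≤ ‖T u0‖ + ‖T u1‖ := by
    rw [← hsum, map_add]; exact norm_add_le _ _
  have hsq : ‖T u‖ ^ 2 ≤ (1 + θ) * ‖T u0‖ ^ 2 + (1 + 1 / θ) * ‖T u1‖ ^ 2 := by
    have h1 : ‖T u‖ ^ 2 ≤ (‖T u0‖ + ‖T u1‖) ^ 2 := pow_le_pow_left₀ (norm_nonneg _) hTu 2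
    have h2 : 0 ≤ (θ * ‖T u0‖ - ‖T u1‖) ^ 2 / θ := by positivity
    have h3 : (θ * ‖T u0‖ - ‖T u1‖) ^ 2 / θ
        = θ * ‖T u0‖ ^ 2 - 2 * ‖T u0‖ * ‖T u1‖ + 1 / θ * ‖T u1‖ ^ 2 := by
      field_simp; ring
    nlinarith
  calc ‖T u‖ ^ 2 ≤ (1 + θ) * ‖T u0‖ ^ 2 + (1 + 1 / θ) * ‖T u1‖ ^ 2 := hsq
    _ ≤ (1 + θ) * (C * ‖u‖ ^ 2) + (1 + 1 / θ) * (‖T‖ ^ 2 * (1 / γ *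
          ∑ j, |l j - l k| * ⟪b j, u⟫_ℝ ^ 2)) := by
        gcongr
        · exact hT0.trans (by gcongr)
        · exact hT1.trans (by gcongr)
    _ = ((1 + θ) * C) * ‖u‖ ^ 2 + (1 + 1 / θ) * ‖T‖ ^ 2 / γ *
          ∑ j, |l j - l k| * ⟪b j, u⟫_ℝ ^ 2 := by ring
    _ ≤ _ := by gcongr

/-- First order perturbation theory for an ordered eigenvalue, possibly at a crossing: its slope is
controlled by the perturbation on the eigenspace alone. -/
theorem eventually_abs_orderedEigenvalue_sub_le {Q : ℝ → Matrix n n ℝ} (hQ : ∀ x, (Q x).IsSymm)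
    (e : ℝ) (k : Fin (Fintype.card n)) (T : EuclideanSpace ℝ n →L[ℝ] F) {C ε : ℝ} (hC0 : 0 ≤ C)
    (hε : 0 < ε)
    (hC : ∀ u, (Q e).toEuclideanLin u = orderedEigenvalue (hQ e) k • u →
      ‖T u‖ ^ 2 ≤ C * ‖u‖ ^ 2)
    (hQT : ∀ η > 0, ∀ᶠ x in 𝓝 e, ∀ u,
      |⟪u, (Q x).toEuclideanLin u⟫_ℝ - ⟪u, (Q e).toEuclideanLin u⟫_ℝ|
      ≤ |x - e| * (‖T u‖ ^ 2 + η * ‖u‖ ^ 2)) :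
    ∀ᶠ x in 𝓝 e, |orderedEigenvalue (hQ x) k - orderedEigenvalue (hQ e) k| ≤ (C + ε) * |x - e| := by
  obtain ⟨A, hA, hA'⟩ := exists_norm_sq_le_add (hQ e) k T hC0 (half_pos hε) hC
  have hsmall : ∀ᶠ x in 𝓝 e, |x - e| * A ≤ 1 := by
    have : Tendsto (fun x => |x - e| * A) (𝓝 e) (𝓝 (|e - e| * A)) := by
      apply Continuous.tendsto; fun_prop
    rw [sub_self, abs_zero, zero_mul] at this
    exact (this.eventually (gt_mem_nhds one_pos)).mono fun x hx => le_of_lt hx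
  filter_upwards [hQT (ε / 2) (half_pos hε), hsmall] with x hx hxA
  set b := orderedEigenbasis (hQ e) with hb
  set l := orderedEigenvalue (hQ e) with hl
  have key : ∀ u, |⟪u, (Q x).toEuclideanLin u⟫_ℝ - ⟪u, (Q e).toEuclideanLin u⟫_ℝ|
      ≤ (C + ε) * |x - e| * ‖u‖ ^ 2 + ∑ j, |l j - l k| * ⟪b j, u⟫_ℝ ^ 2 := fun u => by
    have hS : 0 ≤ ∑ j, |l j - l k| * ⟪b j, u⟫_ℝ ^ 2 :=
      Finset.sum_nonneg fun j _ => by positivity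
    calc _ ≤ |x - e| * (‖T u‖ ^ 2 + ε / 2 * ‖u‖ ^ 2) := hx u
      _ ≤ |x - e| * (((C + ε / 2) * ‖u‖ ^ 2 + A * ∑ j, |l j - l k| * ⟪b j, u⟫_ℝ ^ 2)
            + ε / 2 * ‖u‖ ^ 2) := by gcongr; exact hA' u
      _ = (C + ε) * |x - e| * ‖u‖ ^ 2
            + (|x - e| * A) * ∑ j, |l j - l k| * ⟪b j, u⟫_ℝ ^ 2 := by ring
      _ ≤ _ := by
        gcongr
        exact mul_le_of_le_one_left hS hxA
  rw [abs_le]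
  constructor
  · have : l k - (C + ε) * |x - e| ≤ orderedEigenvalue (hQ x) k := by
      refine le_orderedEigenvalue (hQ x) k b fun u hu => ?_
      have h1 := (abs_le.1 (key u)).1
      have h2 : ∑ j, |l j - l k| * ⟪b j, u⟫_ℝ ^ 2
          = ⟪u, (Q e).toEuclideanLin u⟫_ℝ - l k * ‖u‖ ^ 2 := by
        rw [inner_toEuclideanLin_eq_sum (hQ e), norm_sq_eq_sum_inner_sq b, Finset.mul_sum,
          ← Finset.sum_sub_distrib]
        refine Finset.sum_congr rfl fun j _ => ?_
        rcases lt_or_ge j k with hj | hj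
        · simp [← hb, hu j hj]
        · rw [abs_of_nonneg (sub_nonneg.2 (orderedEigenvalue_monotone (hQ e) hj)), sub_mul]
      rw [h2] at h1
      linarith
    linarith
  · have : orderedEigenvalue (hQ x) k ≤ l k + (C + ε) * |x - e| := by
      refine orderedEigenvalue_le (hQ x) k b fun u hu => ?_
      have h1 := (abs_le.1 (key u)).2
      have h2 : ∑ j, |l j - l k| * ⟪b j, u⟫_ℝ ^ 2
          = l k * ‖u‖ ^ 2 - ⟪u, (Q e).toEuclideanLin u⟫_ℝ := by
        rw [inner_toEuclideanLin_eq_sum (hQ e), norm_sq_eq_sum_inner_sq b, Finset.mul_sum,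
          ← Finset.sum_sub_distrib]
        refine Finset.sum_congr rfl fun j _ => ?_
        rcases lt_or_ge k j with hj | hj
        · simp [← hb, hu j hj]
        · rw [abs_of_nonpos (sub_nonpos.2 (orderedEigenvalue_monotone (hQ e) hj)), neg_sub, sub_mul]
      rw [h2] at h1
      linarith
    linarith

end OrderedEigenvalues

/-! ### The resolvent near a point outside the spectrum -/

section Resolvent

variable {m : Type*} [Fintype m] [DecidableEq m] {D : Matrix m m ℝ}

theorem isUnit_det_sub_smul_one {e : ℝ} (he : e ∉ spectrum ℝ D) :
    IsUnit (D - e • (1 : Matrix m m ℝ)).det := by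
  rw [spectrum.notMem_iff, Algebra.algebraMap_eq_smul_one] at he
  rw [← Matrix.isUnit_iff_isUnit_det, ← neg_sub]
  exact he.neg

theorem continuousAt_inv_sub_smul_one {e : ℝ} (he : e ∉ spectrum ℝ D) :
    ContinuousAt (fun x : ℝ => (D - x • (1 : Matrix m m ℝ))⁻¹) e := by
  simp only [Matrix.inv_def, Ring.inverse_eq_inv]
  have hc : Continuous fun x : ℝ => D - x • (1 : Matrix m m ℝ) := by fun_prop
  exact (hc.matrix_det.continuousAt.inv₀ (isUnit_det_sub_smul_one he).ne_zero).smul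
    hc.matrix_adjugate.continuousAt

theorem inv_sub_smul_one_sub {e x : ℝ} (he : e ∉ spectrum ℝ D) (hx : x ∉ spectrum ℝ D) :
    (D - x • (1 : Matrix m m ℝ))⁻¹ - (D - e • (1 : Matrix m m ℝ))⁻¹
      = (x - e) • ((D - x • (1 : Matrix m m ℝ))⁻¹ * (D - e • (1 : Matrix m m ℝ))⁻¹) := by
  have h1 := Matrix.mul_nonsing_inv _ (isUnit_det_sub_smul_one he)
  have h2 := Matrix.nonsing_inv_mul _ (isUnit_det_sub_smul_one hx)
  set Gx := (D - x • (1 : Matrix m m ℝ))⁻¹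
  set Ge := (D - e • (1 : Matrix m m ℝ))⁻¹
  have h3 : (D - e • (1 : Matrix m m ℝ)) - (D - x • (1 : Matrix m m ℝ)) = (x - e) • 1 := by
    rw [sub_smul]; abel
  calc Gx - Ge = Gx * ((D - e • (1 : Matrix m m ℝ)) * Ge)
        - (Gx * (D - x • (1 : Matrix m m ℝ))) * Ge := by rw [h1, h2, mul_one, one_mul]
    _ = Gx * ((D - e • (1 : Matrix m m ℝ)) - (D - x • (1 : Matrix m m ℝ))) * Ge := by
        simp only [mul_sub, sub_mul, mul_assoc]
    _ = _ := by rw [h3]; simp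

theorem eventually_notMem_spectrum {e : ℝ} (he : e ∉ spectrum ℝ D) :
    ∀ᶠ x in 𝓝 e, x ∉ spectrum ℝ D :=
  (Matrix.finite_real_spectrum (A := D)).isClosed.isOpen_compl.mem_nhds he

theorem orderedEigenvalue_mem_spectrum (hD : D.IsSymm) (k : Fin (Fintype.card m)) :
    orderedEigenvalue hD k ∈ spectrum ℝ D := by
  have := (isHermitian_of_isSymm hD).eigenvalues_mem_spectrum_real
    (Fintype.equivOfCardEq (Fintype.card_fin _) k.rev)
  simpa [Matrix.IsHermitian.eigenvalues, orderedEigenvalue] using this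

theorem eventually_countBelow_eq (hD : D.IsSymm) {e : ℝ} (he : e ∉ spectrum ℝ D) :
    ∀ᶠ x in 𝓝 e, countBelow hD x = countBelow hD e := by
  have h : ∀ k, ∀ᶠ x in 𝓝 e, (orderedEigenvalue hD k < x ↔ orderedEigenvalue hD k < e) := by
    intro k
    have hne : orderedEigenvalue hD k ≠ e := fun h => he (h ▸ orderedEigenvalue_mem_spectrum hD k)
    rcases hne.lt_or_gt with h | h
    · filter_upwards [lt_mem_nhds h] with x hx using by simp [h, hx]
    · filter_upwards [gt_mem_nhds h] with x hx using iff_of_false hx.not_gt h.not_gt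
  filter_upwards [eventually_all.2 h] with x hx
  exact Fintype.card_congr (Equiv.subtypeEquivRight hx)

end Resolvent

/-! ### Slopes of the eigenvalue curves -/

section Slope

open scoped InnerProductSpace

theorem abs_inner_toEuclideanLin_le {n : Type*} [Fintype n] [DecidableEq n] (R : Matrix n n ℝ)
    (u : EuclideanSpace ℝ n) :
    |⟪u, R.toEuclideanLin u⟫_ℝ| ≤ (∑ i, ∑ j, |R i j|) * ‖u‖ ^ 2 := by
  have h : ⟪u, R.toEuclideanLin u⟫_ℝ = ∑ i, ∑ j, R i j * u j * u i := by
    simp [PiLp.inner_apply, Matrix.toLpLin_apply, Matrix.mulVec, dotProduct, Finset.sum_mul]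
  rw [h, Finset.sum_mul]
  refine (Finset.abs_sum_le_sum_abs _ _).trans (Finset.sum_le_sum fun i _ => ?_)
  rw [Finset.sum_mul]
  refine (Finset.abs_sum_le_sum_abs _ _).trans (Finset.sum_le_sum fun j _ => ?_)
  rw [abs_mul, abs_mul, mul_assoc, sq]
  have hi := PiLp.norm_apply_le u i
  have hj := PiLp.norm_apply_le u j
  rw [Real.norm_eq_abs] at hi hj
  gcongr

variable {N : ℕ} {W : ℕ} {H : Matrix (Fin N) (Fin N) ℝ}

/-- The map `u ↦ (D^g - e)⁻¹ B u`; up to sign it sends an eigenvector of `Q_e^g` to the remaining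
coordinates of the vector `(u, v)` with `H^g (u, v) = (ξ u, e v)`. -/
noncomputable def resolventB (W : ℕ) (H : Matrix (Fin N) (Fin N) ℝ) (g : Fin N → ℝ) (e : ℝ) :
    Matrix {i : Fin N // ¬ (i : ℕ) < W} {i : Fin N // (i : ℕ) < W} ℝ :=
  (blockD W H g - e • (1 : Matrix _ _ ℝ))⁻¹ * blockB W H

theorem schurQ_sub (hH : H.IsSymm) (g : Fin N → ℝ) {e x : ℝ}
    (he : e ∉ spectrum ℝ (blockD W H g)) (hx : x ∉ spectrum ℝ (blockD W H g)) :
    schurQ W H g x - schurQ W H g e = -(x - e) •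
      ((resolventB W H g e).transpose * resolventB W H g e +
        (resolventB W H g x - resolventB W H g e).transpose * resolventB W H g e) := by
  have hsymm : ∀ y : ℝ, Matrix.transpose ((blockD W H g - y • (1 : Matrix _ _ ℝ))⁻¹)
      = (blockD W H g - y • (1 : Matrix _ _ ℝ))⁻¹ := by
    intro y
    rw [Matrix.transpose_nonsing_inv]
    congr 1
    exact (blockD_isSymm W hH g).sub (Matrix.isSymm_one.smul y)
  have h := inv_sub_smul_one_sub he hx
  have h1 : schurQ W H g x - schurQ W H g e = -((blockB W H).transpose *
      ((blockD W H g - x • (1 : Matrix _ _ ℝ))⁻¹ - (blockD W H g - e • (1 : Matrix _ _ ℝ))⁻¹)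
        * blockB W H) := by
    simp only [schurQ, Matrix.sub_mul, Matrix.mul_sub]
    abel
  rw [h1, h, ← Matrix.add_mul, ← Matrix.transpose_add, add_sub_cancel, resolventB, resolventB,
    Matrix.transpose_mul, hsymm]
  simp only [Matrix.mul_smul, Matrix.smul_mul, neg_smul, Matrix.mul_assoc]

theorem inner_schurQ_sub (hH : H.IsSymm) (g : Fin N → ℝ) {e x : ℝ}
    (he : e ∉ spectrum ℝ (blockD W H g)) (hx : x ∉ spectrum ℝ (blockD W H g))
    (u : EuclideanSpace ℝ {i : Fin N // (i : ℕ) < W}) :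
    |⟪u, (schurQ W H g x).toEuclideanLin u⟫_ℝ - ⟪u, (schurQ W H g e).toEuclideanLin u⟫_ℝ|
      ≤ |x - e| * (‖(resolventB W H g e).toEuclideanLin u‖ ^ 2 +
        (∑ i, ∑ j, |((resolventB W H g x - resolventB W H g e).transpose * resolventB W H g e) i j|)
          * ‖u‖ ^ 2) := by
  set R := (resolventB W H g x - resolventB W H g e).transpose * resolventB W H g e with hR
  have h1 : ⟪u, ((resolventB W H g e).transpose * resolventB W H g e).toEuclideanLin u⟫_ℝ
      = ‖(resolventB W H g e).toEuclideanLin u‖ ^ 2 := by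
    rw [← real_inner_self_eq_norm_sq]
    simp only [EuclideanSpace.inner_eq_star_dotProduct, Matrix.toLpLin_apply, star_trivial,
      ← Matrix.mulVec_mulVec]
    rw [dotProduct_comm, Matrix.mulVec_transpose, dotProduct_comm,
      ← Matrix.dotProduct_mulVec]
  rw [← inner_sub_right, ← LinearMap.sub_apply, ← map_sub, schurQ_sub hH g he hx, map_smul, map_add,
    LinearMap.smul_apply, real_inner_smul_right, abs_mul, abs_neg, LinearMap.add_apply,
    inner_add_right, h1]
  gcongr
  refine (abs_add_le _ _).trans ?_
  rw [abs_of_nonneg (sq_nonneg ‖_‖)]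
  gcongr
  exact abs_inner_toEuclideanLin_le R u

/-- If `‖(D^g - e)⁻¹ B u‖² ≤ C ‖u‖²` for the eigenvectors `u` of `Q_e^g` with eigenvalue
`𝒞_k^g (e)`, then the absolute slope of the curve at `e` is at most `C`. -/
theorem absSlope_curve_le (hH : H.IsSymm) (g : Fin N → ℝ) {k : ℕ} {e : ℝ}
    (he : e ∈ curveDom W hH g k) {C : ℝ} (hC0 : 0 ≤ C)
    (hC : ∀ u, (schurQ W H g e).toEuclideanLin u = curve W hH g k e • u →
      ‖(resolventB W H g e).toEuclideanLin u‖ ^ 2 ≤ C * ‖u‖ ^ 2) :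
    absSlope (curve W hH g k) e ≤ ENNReal.ofReal C := by
  have heσ := he.1
  set k' : Fin (Fintype.card {i : Fin N // (i : ℕ) < W}) :=
    ⟨k - countBelow (blockD_isSymm W hH g) e - 1, by obtain ⟨-, h₁, h₂⟩ := he; omega⟩ with hk'
  have hcurve : ∀ᶠ x in 𝓝 e, curve W hH g k x = orderedEigenvalue (schurQ_isSymm W hH g x) k' := by
    filter_upwards [eventually_notMem_spectrum heσ,
      eventually_countBelow_eq (blockD_isSymm W hH g) heσ] with x hx1 hx2
    have hx : x ∈ curveDom W hH g k := ⟨hx1, by rw [hx2]; exact he.2⟩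
    rw [curve, dif_pos hx]
    congr 1
    simp only [hk', hx2]
  have hcurve_e := hcurve.self_of_nhds
  rw [hcurve_e] at hC
  have hRcont : Tendsto (fun x => ∑ i, ∑ j,
      |((resolventB W H g x - resolventB W H g e).transpose * resolventB W H g e) i j|)
      (𝓝 e) (𝓝 0) := by
    have h1 : ContinuousAt (fun x => resolventB W H g x) e :=
      (continuous_id.matrix_mul continuous_const).continuousAt.comp
        (continuousAt_inv_sub_smul_one heσ)
    have h2 : ContinuousAt (fun x =>
        ((resolventB W H g x - resolventB W H g e).transpose * resolventB W H g e)) e :=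
      (((continuous_id.sub continuous_const).matrix_transpose.matrix_mul
        continuous_const).continuousAt).comp h1
    have h3 : ContinuousAt (fun x => ∑ i, ∑ j,
      |((resolventB W H g x - resolventB W H g e).transpose * resolventB W H g e) i j|) e := by
      refine tendsto_finsetSum _ fun i _ => tendsto_finsetSum _ fun j _ => ?_
      exact ((continuous_apply_apply i j).continuousAt.comp h2).abs
    simpa [ContinuousAt] using h3
  have hQT : ∀ η > 0, ∀ᶠ x in 𝓝 e, ∀ u,
      |⟪u, (schurQ W H g x).toEuclideanLin u⟫_ℝ - ⟪u, (schurQ W H g e).toEuclideanLin u⟫_ℝ|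
        ≤ |x - e| * (‖LinearMap.toContinuousLinearMap (resolventB W H g e).toEuclideanLin u‖ ^ 2
          + η * ‖u‖ ^ 2) := by
    intro η hη
    filter_upwards [eventually_notMem_spectrum heσ, hRcont.eventually (gt_mem_nhds hη)]
      with x hx1 hx2 u
    refine (inner_schurQ_sub hH g heσ hx1 u).trans ?_
    rw [LinearMap.coe_toContinuousLinearMap']
    gcongr
  have hslope : ∀ ε > 0, absSlope (curve W hH g k) e ≤ ENNReal.ofReal (C + ε) := by
    intro ε hε
    refine limsup_le_of_le (by isBoundedDefault) (eventually_nhdsWithin_of_eventually_nhds ?_)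
    filter_upwards [hcurve, eventually_abs_orderedEigenvalue_sub_le (schurQ_isSymm W hH g) e k'
      (LinearMap.toContinuousLinearMap (resolventB W H g e).toEuclideanLin) hC0 hε hC hQT]
      with x hx1 hx2
    rw [Real.enorm_eq_ofReal_abs]
    apply ENNReal.ofReal_le_ofReal
    rw [slope_def_field, abs_div, hx1, hcurve_e]
    exact div_le_of_le_mul₀ (abs_nonneg _) (by positivity) hx2
  refine ENNReal.le_of_forall_pos_le_add fun ε hε _ => ?_
  have := hslope ε hε
  rwa [ENNReal.ofReal_add hC0 (NNReal.coe_nonneg ε), ENNReal.ofReal_coe_nnreal] at this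

end Slope

/-! ### Euclidean length -/

section EuclideanLength

variable {ι : Type*} [Fintype ι]

/-- The Euclidean length of a vector given as a plain function. -/
noncomputable def l2 (x : ι → ℝ) : ℝ := ‖WithLp.toLp 2 x‖

theorem l2_nonneg (x : ι → ℝ) : 0 ≤ l2 x := norm_nonneg _

theorem l2_sq (x : ι → ℝ) : l2 x ^ 2 = ∑ i, x i ^ 2 := by
  simp [l2, EuclideanSpace.norm_sq_eq]

theorem l2_add_le (x y : ι → ℝ) : l2 (x + y) ≤ l2 x + l2 y := by
  rw [l2, WithLp.toLp_add]; exact norm_add_le _ _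

theorem l2_sub_le (x y : ι → ℝ) : l2 (x - y) ≤ l2 x + l2 y := by
  rw [l2, WithLp.toLp_sub]; exact norm_sub_le _ _

theorem l2_smul (a : ℝ) (x : ι → ℝ) : l2 (a • x) = |a| * l2 x := by
  rw [l2, WithLp.toLp_smul, norm_smul, Real.norm_eq_abs]; rfl

theorem l2_le_iff {x : ι → ℝ} {r : ℝ} (hr : 0 ≤ r) : l2 x ≤ r ↔ ∑ i, x i ^ 2 ≤ r ^ 2 := by
  rw [← l2_sq, sq_le_sq₀ (l2_nonneg x) hr]

theorem l2_le_of_abs_le {x y : ι → ℝ} (h : ∀ i, |x i| ≤ |y i|) : l2 x ≤ l2 y := by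
  rw [l2_le_iff (l2_nonneg y), l2_sq]
  exact Finset.sum_le_sum fun i _ => sq_le_sq.2 (h i)

theorem abs_le_l2 (x : ι → ℝ) (i : ι) : |x i| ≤ l2 x := by
  have := PiLp.norm_apply_le (WithLp.toLp 2 x) i
  simpa [l2] using this

theorem l2_eq_zero {x : ι → ℝ} : l2 x = 0 ↔ x = 0 := by
  rw [l2, norm_eq_zero, WithLp.toLp_eq_zero]

/-- The operator norm of `H` on Euclidean space is at most `M`. -/
def OpNormLe (H : Matrix ι ι ℝ) (M : ℝ) : Prop := ∀ x, l2 (H.mulVec x) ≤ M * l2 x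

end EuclideanLength

/-! ### From eigenvectors of the Schur complement to vectors of full length -/

section Extension

variable {N W : ℕ}

/-- The vector `(u, v)` with `u` on the first `W` coordinates and `v` on the others. -/
def glue (u : {i : Fin N // (i : ℕ) < W} → ℝ) (v : {i : Fin N // ¬ (i : ℕ) < W} → ℝ) :
    Fin N → ℝ :=
  fun i => if h : (i : ℕ) < W then u ⟨i, h⟩ else v ⟨i, h⟩

theorem sum_eq_sum_add_sum (W : ℕ) (f : Fin N → ℝ) :
    ∑ i, f i = ∑ i : {i : Fin N // (i : ℕ) < W}, f i + ∑ i : {i : Fin N // ¬ (i : ℕ) < W}, f i :=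
  (Fintype.sum_subtype_add_sum_subtype _ f).symm

theorem glue_of_lt (u : {i : Fin N // (i : ℕ) < W} → ℝ) (v : {i : Fin N // ¬ (i : ℕ) < W} → ℝ)
    (i : {i : Fin N // (i : ℕ) < W}) : glue u v i = u i := by
  rw [glue, dif_pos i.2]

theorem glue_of_not_lt (u : {i : Fin N // (i : ℕ) < W} → ℝ)
    (v : {i : Fin N // ¬ (i : ℕ) < W} → ℝ) (i : {i : Fin N // ¬ (i : ℕ) < W}) :
    glue u v i = v i := by
  rw [glue, dif_neg i.2]

theorem l2_glue_sq (u : {i : Fin N // (i : ℕ) < W} → ℝ)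
    (v : {i : Fin N // ¬ (i : ℕ) < W} → ℝ) : l2 (glue u v) ^ 2 = l2 u ^ 2 + l2 v ^ 2 := by
  rw [l2_sq, l2_sq, l2_sq, sum_eq_sum_add_sum W]
  simp only [glue_of_lt, glue_of_not_lt]

theorem l2_glue_zero_right (u : {i : Fin N // (i : ℕ) < W} → ℝ) :
    l2 (glue u (0 : {i : Fin N // ¬ (i : ℕ) < W} → ℝ)) = l2 u := by
  have h := l2_glue_sq u 0
  rw [l2_eq_zero.2 rfl, sq (0 : ℝ), mul_zero, add_zero] at h
  exact (sq_eq_sq₀ (l2_nonneg _) (l2_nonneg _)).1 h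

theorem l2_glue_zero_left (v : {i : Fin N // ¬ (i : ℕ) < W} → ℝ) :
    l2 (glue (0 : {i : Fin N // (i : ℕ) < W} → ℝ) v) = l2 v := by
  have h := l2_glue_sq 0 v
  rw [l2_eq_zero.2 rfl, sq (0 : ℝ), mul_zero, zero_add] at h
  exact (sq_eq_sq₀ (l2_nonneg _) (l2_nonneg _)).1 h

variable {H : Matrix (Fin N) (Fin N) ℝ}

theorem perturb_mulVec (g x : Fin N → ℝ) :
    (perturb H g).mulVec x = H.mulVec x - g * x := by
  rw [perturb, Matrix.sub_mulVec]
  congr 1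
  ext i
  rw [Matrix.mulVec_diagonal]; rfl

theorem perturb_mulVec_glue_of_lt (hH : H.IsSymm) (g : Fin N → ℝ)
    (u : {i : Fin N // (i : ℕ) < W} → ℝ) (v : {i : Fin N // ¬ (i : ℕ) < W} → ℝ)
    (i : {i : Fin N // (i : ℕ) < W}) :
    (perturb H g).mulVec (glue u v) i
      = (blockA W H g).mulVec u i + (blockB W H).transpose.mulVec v i := by
  simp only [Matrix.mulVec, dotProduct]
  rw [sum_eq_sum_add_sum W]
  simp only [glue_of_lt, glue_of_not_lt]
  congr 1
  refine Finset.sum_congr rfl fun j _ => ?_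
  have hij : (i : Fin N) ≠ j := fun h => j.2 (h ▸ i.2)
  simp [perturb, blockB, Matrix.toBlock_apply, hij, hH.apply]

theorem perturb_mulVec_glue_of_not_lt (g : Fin N → ℝ)
    (u : {i : Fin N // (i : ℕ) < W} → ℝ) (v : {i : Fin N // ¬ (i : ℕ) < W} → ℝ)
    (i : {i : Fin N // ¬ (i : ℕ) < W}) :
    (perturb H g).mulVec (glue u v) i
      = (blockB W H).mulVec u i + (blockD W H g).mulVec v i := by
  simp only [Matrix.mulVec, dotProduct]
  rw [sum_eq_sum_add_sum W]
  simp only [glue_of_lt, glue_of_not_lt]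
  congr 1
  refine Finset.sum_congr rfl fun j _ => ?_
  have hij : (i : Fin N) ≠ j := fun h => i.2 (h ▸ j.2)
  simp [perturb, blockB, Matrix.toBlock_apply, hij]

/-- An eigenvector `u` of `Q_e^g` extends to a vector `(u, v)` with `H^g (u, v) = (ξ u, e v)`. -/
theorem perturb_mulVec_glue_resolventB (hH : H.IsSymm) (g : Fin N → ℝ) {e ξ : ℝ}
    (he : e ∉ spectrum ℝ (blockD W H g)) {u : {i : Fin N // (i : ℕ) < W} → ℝ}
    (hu : (schurQ W H g e).mulVec u = ξ • u) :
    (perturb H g).mulVec (glue u (-(resolventB W H g e).mulVec u))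
      = glue (ξ • u) (e • -(resolventB W H g e).mulVec u) := by
  ext i
  by_cases hi : (i : ℕ) < W
  · refine (perturb_mulVec_glue_of_lt hH g _ _ ⟨i, hi⟩).trans ?_
    refine Eq.trans ?_ (glue_of_lt _ _ ⟨i, hi⟩).symm
    rw [← hu, schurQ, Matrix.sub_mulVec, Matrix.mulVec_neg, Matrix.mulVec_mulVec, resolventB,
      Matrix.mul_assoc]
    rfl
  · refine (perturb_mulVec_glue_of_not_lt g _ _ ⟨i, hi⟩).trans ?_
    refine Eq.trans ?_ (glue_of_not_lt _ _ ⟨i, hi⟩).symm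
    have h1 : (blockD W H g - e • (1 : Matrix _ _ ℝ)).mulVec ((resolventB W H g e).mulVec u)
        = (blockB W H).mulVec u := by
      rw [Matrix.mulVec_mulVec, resolventB, ← Matrix.mul_assoc,
        Matrix.mul_nonsing_inv _ (isUnit_det_sub_smul_one he), Matrix.one_mul]
    rw [← h1, Matrix.sub_mulVec, Matrix.smul_mulVec, Matrix.one_mulVec, Matrix.mulVec_neg]
    simp only [Pi.sub_apply, Pi.neg_apply, Pi.smul_apply, smul_eq_mul]
    ring

/-- If `H - e` is bounded below by `κ` on the vectors vanishing on the first `W` coordinates, then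
no eigenvector of `Q_e^g` with moderate eigenvalue has a large companion vector. -/
theorem l2_resolventB_le (hH : H.IsSymm) {M κ K : ℝ} (hκ : 0 < κ) (hκ2 : κ ≤ 2)
    (hM : OpNormLe H M)
    (hlow : ∀ (e : ℝ) (v : Fin N → ℝ), (∀ i : Fin N, (i : ℕ) < W → v i = 0) →
      κ * l2 v ≤ l2 (H.mulVec v - e • v))
    {g : Fin N → ℝ} (hg : ‖g‖ ≤ κ / 2) {e ξ : ℝ} (hξ : |ξ| ≤ K)
    (he : e ∉ spectrum ℝ (blockD W H g)) {u : {i : Fin N // (i : ℕ) < W} → ℝ}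
    (hu : (schurQ W H g e).mulVec u = ξ • u) :
    l2 ((resolventB W H g e).mulVec u) ≤ 2 * (K + M + 1) / κ * l2 u := by
  set v := -(resolventB W H g e).mulVec u with hv
  have hvl : l2 ((resolventB W H g e).mulVec u) = l2 v := by
    have := l2_smul (-1) ((resolventB W H g e).mulVec u)
    rw [neg_one_smul] at this
    rw [hv, this]; simp
  set u' : Fin N → ℝ := glue u (0 : {i : Fin N // ¬ (i : ℕ) < W} → ℝ) with hu'
  set v' : Fin N → ℝ := glue (0 : {i : Fin N // (i : ℕ) < W} → ℝ) v with hv'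
  have hglue : glue u v = u' + v' := by
    ext i
    by_cases h : (i : ℕ) < W <;> simp [glue, hu', hv', h]
  have hglue2 : glue (ξ • u) (e • v) = ξ • u' + e • v' := by
    ext i
    by_cases h : (i : ℕ) < W <;> simp [glue, hu', hv', h]
  have key := perturb_mulVec_glue_resolventB hH g he hu
  rw [← hv, hglue, hglue2, Matrix.mulVec_add, perturb_mulVec, perturb_mulVec] at key
  have key2 : H.mulVec v' - e • v' = ξ • u' - H.mulVec u' + g * u' + g * v' := by
    have : H.mulVec v' = ξ • u' + e • v' - (H.mulVec u' - g * u') + g * v' := by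
      rw [← key]; abel
    rw [this]; abel
  have hgx : ∀ x : Fin N → ℝ, l2 (g * x) ≤ κ / 2 * l2 x := fun x => by
    have : l2 (g * x) ≤ l2 ((κ / 2) • x) := by
      refine l2_le_of_abs_le fun i => ?_
      have h1 : |g i| ≤ ‖g‖ := norm_le_pi_norm g i
      rw [Pi.mul_apply, abs_mul, Pi.smul_apply, smul_eq_mul, abs_mul, abs_of_pos (half_pos hκ)]
      exact mul_le_mul_of_nonneg_right (h1.trans hg) (abs_nonneg _)
    rwa [l2_smul, abs_of_pos (half_pos hκ)] at this
  have h1 := hlow e v' fun i hi => by simp [hv', glue, hi]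
  rw [key2] at h1
  have h2 : l2 (ξ • u' - H.mulVec u' + g * u' + g * v')
      ≤ K * l2 u' + M * l2 u' + 1 * l2 u' + κ / 2 * l2 v' := by
    refine (l2_add_le _ _).trans (add_le_add ((l2_add_le _ _).trans (add_le_add
      ((l2_sub_le _ _).trans (add_le_add ?_ (hM _))) ((hgx _).trans ?_))) (hgx _))
    · rw [l2_smul]; exact mul_le_mul_of_nonneg_right hξ (l2_nonneg _)
    · exact mul_le_mul_of_nonneg_right (by linarith) (l2_nonneg _)
  rw [l2_glue_zero_right, l2_glue_zero_left] at h2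
  rw [l2_glue_zero_left] at h1
  rw [hvl, div_mul_eq_mul_div, le_div_iff₀ hκ]
  linarith

/-- Lower bounds on `H - e` off the first `W` coordinates bound all slopes of the curves at moderate
heights. -/
theorem absSlope_curve_le_of_bounded_below (hH : H.IsSymm) {M κ K : ℝ} (hκ : 0 < κ) (hκ2 : κ ≤ 2)
    (hM : OpNormLe H M)
    (hlow : ∀ (e : ℝ) (v : Fin N → ℝ), (∀ i : Fin N, (i : ℕ) < W → v i = 0) →
      κ * l2 v ≤ l2 (H.mulVec v - e • v))
    {g : Fin N → ℝ} (hg : ‖g‖ ≤ κ / 2) {k : ℕ} {e : ℝ} (he : e ∈ curveDom W hH g k)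
    (hK : |curve W hH g k e| ≤ K) :
    absSlope (curve W hH g k) e ≤ ENNReal.ofReal ((2 * (K + M + 1) / κ) ^ 2) := by
  refine absSlope_curve_le hH g he (sq_nonneg _) fun u hu => ?_
  have hu' : (schurQ W H g e).mulVec u.ofLp = curve W hH g k e • u.ofLp := by
    have := congrArg WithLp.ofLp hu
    simpa [Matrix.toLpLin_apply] using this
  have h := l2_resolventB_le hH hκ hκ2 hM hlow hg hK he.1 hu'
  rw [← mul_pow]
  exact pow_le_pow_left₀ (norm_nonneg _) (by simpa [l2, Matrix.toLpLin_apply] using h) 2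

end Extension

/-! ### Nets of sparse vectors -/

section LatticeNet

/-- Rounding towards zero. -/
noncomputable def truncInt (x : ℝ) : ℤ := if 0 ≤ x then ⌊x⌋ else ⌈x⌉

theorem abs_truncInt_le (x : ℝ) : |(truncInt x : ℝ)| ≤ |x| := by
  unfold truncInt
  split_ifs with h
  · rw [abs_of_nonneg h, abs_of_nonneg (by exact_mod_cast Int.floor_nonneg.2 h)]
    exact Int.floor_le x
  · push Not at h
    have h2 : (⌈x⌉ : ℝ) ≤ 0 := by exact_mod_cast Int.ceil_le.2 (by simpa using h.le)
    rw [abs_of_neg h, abs_of_nonpos h2]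
    exact neg_le_neg (Int.le_ceil x)

theorem abs_sub_truncInt_le (x : ℝ) : |x - truncInt x| ≤ 1 := by
  unfold truncInt
  split_ifs with h
  · rw [abs_le]
    constructor <;> linarith [Int.floor_le x, Int.lt_floor_add_one x]
  · rw [abs_le]
    constructor <;> linarith [Int.le_ceil x, Int.ceil_lt_add_one x]

theorem sum_exp_neg_mul_le {ε : ℝ} (hε : 0 < ε) (B : ℕ) :
    ∑ j ∈ Finset.range B, Real.exp (-ε * (j + 1)) ≤ 1 / ε := by
  set r := Real.exp (-ε) with hr
  have hr0 : 0 < r := Real.exp_pos _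
  have hr1 : r < 1 := Real.exp_lt_one_iff.2 (by linarith)
  have h1 : ∀ j : ℕ, Real.exp (-ε * (j + 1)) = r * r ^ j := fun j => by
    rw [← pow_succ', hr, ← Real.exp_nat_mul]; push_cast; ring_nf
  simp only [h1, ← Finset.mul_sum]
  have h2 : ∑ j ∈ Finset.range B, r ^ j ≤ (1 - r)⁻¹ := by
    rw [← tsum_geometric_of_lt_one hr0.le hr1]
    exact (summable_geometric_of_lt_one hr0.le hr1).sum_le_tsum _ fun _ _ => by positivity
  have h3 : ε * r ≤ 1 - r := by
    have : r * Real.exp ε = 1 := by rw [hr, ← Real.exp_add]; simp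
    nlinarith [Real.add_one_le_exp ε]
  calc r * ∑ j ∈ Finset.range B, r ^ j ≤ r * (1 - r)⁻¹ := by gcongr
    _ ≤ 1 / ε := by
      rw [← div_eq_mul_inv, div_le_div_iff₀ (by linarith) hε]; linarith

/-- The number of integer vectors with at most `m` nonzero entries and `ℓ¹` norm at most `m / ε`. -/
theorem card_sparse_lattice_le {N m : ℕ} (hm : 1 ≤ m) (hmN : m ≤ N) {ε : ℝ} (hε : 0 < ε)
    (hε1 : ε ≤ 1) (B : ℕ) :
    (((Fintype.piFinset fun _ : Fin N => Finset.Icc (-B : ℤ) B).filter fun k =>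
      (∑ j, |(k j : ℝ)| ≤ m / ε) ∧ (Finset.univ.filter fun j => k j ≠ 0).card ≤ m).card : ℝ)
      ≤ (2 * Real.exp 2 * N / (m * ε)) ^ m := by
  have hm0 : (0 : ℝ) < m := by exact_mod_cast hm
  have hN0 : (m : ℝ) ≤ N := by exact_mod_cast hmN
  have hN1 : (0 : ℝ) < N := hm0.trans_le hN0
  -- Each vector is weighted by `q ^ (-support) * exp (-ε * ℓ¹ norm)`; the total weight factorizes.
  set q : ℝ := 2 * N / (m * ε) with hq
  have hq1 : 1 ≤ q := by
    rw [hq, one_le_div (by positivity)]; nlinarith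
  have hq0 : 0 < q := by linarith
  set w : ℤ → ℝ := fun k => if k = 0 then 1 else q⁻¹ * Real.exp (-ε * |(k : ℝ)|) with hw
  have hw0 : ∀ k, 0 ≤ w k := fun k => by
    simp only [hw]; split_ifs <;> positivity
  have htot : ∑ k ∈ Finset.Icc (-B : ℤ) B, w k ≤ Real.exp (m / N) := by
    have heven : w.Even := fun k => by simp [hw]
    rw [Finset.sum_Icc_of_even_eq_range heven, Finset.sum_range_succ']
    have h1 : ∀ j : ℕ, w ((j + 1 : ℕ) : ℤ) = q⁻¹ * Real.exp (-ε * (j + 1)) := fun j => by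
      have : ((j + 1 : ℕ) : ℤ) ≠ 0 := by positivity
      simp only [hw, if_neg this]
      rw [Int.cast_natCast, Nat.abs_cast]; push_cast; rfl
    have h0 : w 0 = 1 := by simp [hw]
    simp only [h1, Nat.cast_zero, h0, ← Finset.mul_sum]
    have h2 : q⁻¹ * ∑ j ∈ Finset.range B, Real.exp (-ε * (j + 1)) ≤ q⁻¹ * (1 / ε) := by
      gcongr; exact sum_exp_neg_mul_le hε B
    have h3 : 2 * (q⁻¹ * (1 / ε)) = m / N := by
      rw [hq]; field_simp
    have := Real.add_one_le_exp ((m : ℝ) / N)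
    rw [nsmul_eq_mul]; push_cast
    linarith
  have hprod : ∑ k ∈ Fintype.piFinset fun _ : Fin N => Finset.Icc (-B : ℤ) B, ∏ j, w (k j)
      ≤ Real.exp m := by
    rw [Finset.sum_prod_piFinset]
    rw [Finset.prod_const, Finset.card_univ, Fintype.card_fin]
    refine (pow_le_pow_left₀ (Finset.sum_nonneg fun k _ => hw0 k) htot N).trans ?_
    rw [← Real.exp_nat_mul]
    refine Real.exp_le_exp.2 (le_of_eq ?_)
    field_simp
  set S := (Fintype.piFinset fun _ : Fin N => Finset.Icc (-B : ℤ) B).filter fun k =>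
      (∑ j, |(k j : ℝ)| ≤ m / ε) ∧ (Finset.univ.filter fun j => k j ≠ 0).card ≤ m
  have hlow : ∀ k ∈ S, q⁻¹ ^ m * Real.exp (-m) ≤ ∏ j, w (k j) := by
    intro k hk
    obtain ⟨-, hk1, hk2⟩ := Finset.mem_filter.1 hk
    have h1 : ∏ j, w (k j) = q⁻¹ ^ (Finset.univ.filter fun j => k j ≠ 0).card
        * Real.exp (-ε * ∑ j, |(k j : ℝ)|) := by
      have : ∀ j, w (k j) = (if k j ≠ 0 then q⁻¹ else 1) * Real.exp (-ε * |(k j : ℝ)|) := by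
        intro j
        by_cases h : k j = 0 <;> simp [hw, h]
      simp only [this, Finset.prod_mul_distrib, Finset.mul_sum, Real.exp_sum]
      rw [Finset.prod_ite]; simp
    rw [h1]
    gcongr ?_ * Real.exp ?_
    · exact pow_le_pow_of_le_one (by positivity) (inv_le_one_of_one_le₀ hq1) hk2
    · have := (le_div_iff₀ hε).1 hk1
      linarith
  have hcard : (S.card : ℝ) * (q⁻¹ ^ m * Real.exp (-m)) ≤ Real.exp m := by
    rw [← nsmul_eq_mul]
    refine (Finset.card_nsmul_le_sum S _ _ hlow).trans (le_trans ?_ hprod)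
    exact Finset.sum_le_sum_of_subset_of_nonneg (Finset.filter_subset _ _)
      fun k _ _ => Finset.prod_nonneg fun j _ => hw0 _
  have h4 : 2 * Real.exp 2 * N / (m * ε) = q * Real.exp 2 := by rw [hq]; ring
  rw [h4, mul_pow]
  have h5 : Real.exp 2 ^ m = Real.exp m * Real.exp m := by
    rw [← Real.exp_nat_mul, ← Real.exp_add]; ring_nf
  have h6 : q⁻¹ ^ m * Real.exp (-m) = (q ^ m * Real.exp m)⁻¹ := by
    rw [inv_pow, Real.exp_neg, mul_inv]
  rw [h6, ← div_eq_mul_inv, div_le_iff₀ (by positivity)] at hcard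
  rw [h5]
  linarith

/-- An `ε`-net for the vectors of length at most `1` with at most `m` nonzero coordinates. The net
vectors are obtained by rounding each coordinate towards zero. -/
theorem exists_sparse_net {N m : ℕ} (hm : 1 ≤ m) (hmN : m ≤ N) {ε : ℝ} (hε : 0 < ε)
    (hε1 : ε ≤ 1) : ∃ 𝒩 : Finset (Fin N → ℝ),
      (𝒩.card : ℝ) ≤ (2 * Real.exp 2 * N / (m * ε)) ^ m ∧
      ∀ x : Fin N → ℝ, l2 x ≤ 1 → (Finset.univ.filter fun j => x j ≠ 0).card ≤ m →
        ∃ y ∈ 𝒩, (∀ j, |y j| ≤ |x j|) ∧ (∀ j, |x j - y j| ≤ ε / √m) ∧ l2 (x - y) ≤ ε := by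
  classical
  have hm0 : (0 : ℝ) < m := by exact_mod_cast hm
  set B : ℕ := ⌈(m : ℝ) / ε⌉₊ with hB
  set S := (Fintype.piFinset fun _ : Fin N => Finset.Icc (-B : ℤ) B).filter fun k =>
      (∑ j, |(k j : ℝ)| ≤ m / ε) ∧ (Finset.univ.filter fun j => k j ≠ 0).card ≤ m with hS
  set a : ℝ := ε / √m with ha
  have ha0 : 0 < a := by positivity
  refine ⟨S.image fun k j => a * k j, ?_, fun x hx hsupp => ?_⟩
  · refine le_trans ?_ (card_sparse_lattice_le hm hmN hε hε1 B)
    exact Nat.cast_le.2 Finset.card_image_le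
  set k : Fin N → ℤ := fun j => truncInt (x j / a) with hk
  have hkx : ∀ j, |a * (k j : ℝ)| ≤ |x j| := fun j => by
    have := abs_truncInt_le (x j / a)
    rw [abs_div, abs_of_pos ha0, le_div_iff₀ ha0] at this
    rw [abs_mul, abs_of_pos ha0, mul_comm]; exact this
  have hxk : ∀ j, |x j - a * (k j : ℝ)| ≤ a := fun j => by
    have h1 : x j - a * (k j : ℝ) = a * (x j / a - k j) := by field_simp
    rw [h1, abs_mul, abs_of_pos ha0]
    exact mul_le_of_le_one_right ha0.le (abs_sub_truncInt_le _)
  have hx0 : ∀ j, x j = 0 → k j = 0 := fun j hj => by simp [hk, hj, truncInt]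
  have hsum : ∑ j, |(k j : ℝ)| ≤ m / ε := by
    have h1 : ∑ j, |x j| ≤ √m := by
      have h2 : ∑ j, |x j| = ∑ j ∈ Finset.univ.filter fun j => x j ≠ 0, |x j| := by
        rw [Finset.sum_filter]
        exact Finset.sum_congr rfl fun j _ => by by_cases h : x j = 0 <;> simp [h]
      rw [h2]
      apply Real.le_sqrt_of_sq_le
      refine sq_sum_le_card_mul_sum_sq.trans ?_
      have h3 : ∑ j ∈ Finset.univ.filter fun j => x j ≠ 0, |x j| ^ 2 ≤ 1 := by
        calc _ ≤ ∑ j, |x j| ^ 2 := Finset.sum_le_sum_of_subset_of_nonneg (Finset.filter_subset _ _)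
              fun _ _ _ => sq_nonneg _
          _ = l2 x ^ 2 := by rw [l2_sq]; simp
          _ ≤ 1 := pow_le_one₀ (l2_nonneg x) hx
      have h4 : ((Finset.univ.filter fun j => x j ≠ 0).card : ℝ) ≤ m := by exact_mod_cast hsupp
      calc _ ≤ (m : ℝ) * 1 := by gcongr
        _ = m := mul_one _
    have h5 : a * ∑ j, |(k j : ℝ)| ≤ √m := by
      rw [Finset.mul_sum]
      refine (Finset.sum_le_sum fun j _ => ?_).trans h1
      have := hkx j
      rwa [abs_mul, abs_of_pos ha0] at this
    have h6 : (m : ℝ) / ε = √m / a := by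
      rw [ha, div_div_eq_mul_div, Real.mul_self_sqrt hm0.le]
    rw [h6, le_div_iff₀ ha0]; linarith
  have hkS : k ∈ S := by
    refine Finset.mem_filter.2 ⟨Fintype.mem_piFinset.2 fun j => ?_, hsum, ?_⟩
    · have h1 : |(k j : ℝ)| ≤ B :=
        ((Finset.single_le_sum (f := fun j => |(k j : ℝ)|) (fun _ _ => abs_nonneg _)
          (Finset.mem_univ j)).trans hsum).trans (Nat.le_ceil _)
      have h2 : |k j| ≤ (B : ℤ) := by exact_mod_cast h1
      exact Finset.mem_Icc.2 (abs_le.1 h2)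
    · refine (Finset.card_le_card fun j hj => ?_).trans hsupp
      simp only [Finset.mem_filter, Finset.mem_univ, true_and] at hj ⊢
      exact fun h => hj (hx0 j h)
  refine ⟨_, Finset.mem_image_of_mem _ hkS, hkx, hxk, ?_⟩
  rw [l2_le_iff hε.le]
  calc ∑ j, ((x - fun j => a * (k j : ℝ)) j) ^ 2
      ≤ ∑ j, if x j ≠ 0 then a ^ 2 else 0 := by
        refine Finset.sum_le_sum fun j _ => ?_
        by_cases h : x j = 0
        · simp [h, hx0 j h]
        · simp only [ne_eq, h, not_false_eq_true, if_true, Pi.sub_apply]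
          rw [sq_le_sq, abs_of_pos ha0]; exact hxk j
    _ = (Finset.univ.filter fun j => x j ≠ 0).card * a ^ 2 := by
        rw [← Finset.sum_filter, Finset.sum_const, nsmul_eq_mul]
    _ ≤ m * a ^ 2 := by gcongr
    _ = ε ^ 2 := by
        rw [ha, div_pow, Real.sq_sqrt hm0.le]; field_simp

end LatticeNet

/-! ### Variables with a square exponential moment -/

section SquareExponential

theorem norm_cexp_I_sub_taylor_le (x : ℝ) :
    ‖Complex.exp (x * Complex.I) - (1 + x * Complex.I - x ^ 2 / 2)‖ ≤ 4 * |x| ^ 3 := by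
  have hn : ‖(x * Complex.I : ℂ)‖ = |x| := by simp
  rcases le_or_gt |x| 1 with h | h
  · have h1 := Complex.exp_bound (x := x * Complex.I) (by rw [hn]; exact h) (n := 3) (by norm_num)
    have h2 : ∑ m ∈ Finset.range 3, (x * Complex.I : ℂ) ^ m / (m.factorial : ℂ)
        = 1 + x * Complex.I - x ^ 2 / 2 := by
      simp [Finset.sum_range_succ, mul_pow, Nat.factorial]; ring
    rw [h2, hn] at h1
    refine h1.trans ?_
    rw [mul_comm]
    gcongr
    norm_num [Nat.factorial]
  · have h1 : ‖Complex.exp (x * Complex.I)‖ = 1 := Complex.norm_exp_ofReal_mul_I x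
    have h2 : ‖(1 + x * Complex.I - x ^ 2 / 2 : ℂ)‖ ≤ 1 + |x| + |x| ^ 2 / 2 := by
      refine (norm_sub_le _ _).trans (add_le_add ((norm_add_le _ _).trans ?_) ?_)
      · simp
      · simp
    refine (norm_sub_le _ _).trans ?_
    rw [h1]
    nlinarith [mul_pos (sub_pos.2 h) (sub_pos.2 h), pow_pos (sub_pos.2 h) 3]

variable {Ω : Type*} [MeasurableSpace Ω] {P : Measure Ω} {Y : Ω → ℝ} {δ Cδ : ℝ}

theorem integrable_exp_mul_sq (hY : Measurable Y)
    (hsub : ∫⁻ ω, ENNReal.ofReal (Real.exp (δ * Y ω ^ 2)) ∂P ≤ ENNReal.ofReal Cδ) :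
    Integrable (fun ω => Real.exp (δ * Y ω ^ 2)) P := by
  refine ⟨by fun_prop, ?_⟩
  rw [hasFiniteIntegral_iff_ofReal (ae_of_all _ fun _ => (Real.exp_pos _).le)]
  exact hsub.trans_lt ENNReal.ofReal_lt_top

theorem integral_exp_mul_sq_le (hCδ : 0 < Cδ) (hY : Measurable Y)
    (hsub : ∫⁻ ω, ENNReal.ofReal (Real.exp (δ * Y ω ^ 2)) ∂P ≤ ENNReal.ofReal Cδ) :
    ∫ ω, Real.exp (δ * Y ω ^ 2) ∂P ≤ Cδ := by
  rw [integral_eq_lintegral_of_nonneg_ae (ae_of_all _ fun _ => (Real.exp_pos _).le) (by fun_prop)]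
  exact ENNReal.toReal_le_of_le_ofReal hCδ.le hsub

theorem integrable_of_le_exp_mul_sq {E : Type*} [NormedAddCommGroup E] {f : Ω → E} {a : ℝ}
    (hY : Measurable Y)
    (hsub : ∫⁻ ω, ENNReal.ofReal (Real.exp (δ * Y ω ^ 2)) ∂P ≤ ENNReal.ofReal Cδ)
    (hf : AEStronglyMeasurable f P) (hle : ∀ ω, ‖f ω‖ ≤ a * Real.exp (δ * Y ω ^ 2)) :
    Integrable f P :=
  ((integrable_exp_mul_sq hY hsub).const_mul a).mono' hf (ae_of_all _ hle)

theorem integral_le_of_le_exp_mul_sq {f : Ω → ℝ} {a : ℝ} (ha : 0 ≤ a) (hCδ : 0 < Cδ)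
    (hY : Measurable Y)
    (hsub : ∫⁻ ω, ENNReal.ofReal (Real.exp (δ * Y ω ^ 2)) ∂P ≤ ENNReal.ofReal Cδ)
    (hf : AEStronglyMeasurable f P) (hle : ∀ ω, ‖f ω‖ ≤ a * Real.exp (δ * Y ω ^ 2)) :
    ∫ ω, f ω ∂P ≤ a * Cδ := by
  have h1 : ∫ ω, f ω ∂P ≤ ∫ ω, a * Real.exp (δ * Y ω ^ 2) ∂P :=
    integral_mono (integrable_of_le_exp_mul_sq hY hsub hf hle)
      ((integrable_exp_mul_sq hY hsub).const_mul a) fun ω => (le_abs_self _).trans (hle ω)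
  rw [integral_const_mul] at h1
  exact h1.trans (mul_le_mul_of_nonneg_left (integral_exp_mul_sq_le hCδ hY hsub) ha)

theorem sq_le_exp_mul_sq (hδ : 0 < δ) (y : ℝ) : y ^ 2 ≤ 1 / δ * Real.exp (δ * y ^ 2) := by
  have := Real.add_one_le_exp (δ * y ^ 2)
  rw [one_div, inv_mul_eq_div, le_div_iff₀ hδ]; linarith

theorem abs_le_exp_mul_sq (hδ : 0 < δ) (y : ℝ) : |y| ≤ (1 + 1 / δ) * Real.exp (δ * y ^ 2) := by
  have h1 := sq_le_exp_mul_sq hδ y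
  have h2 : 1 ≤ Real.exp (δ * y ^ 2) := Real.one_le_exp (by positivity)
  have h3 : |y| ≤ 1 + y ^ 2 := by rw [← sq_abs]; nlinarith [sq_nonneg (|y| - 1)]
  linarith

theorem abs_cube_le_exp_mul_sq (hδ : 0 < δ) (y : ℝ) :
    |y| ^ 3 ≤ (1 + 2 / δ ^ 2) * Real.exp (δ * y ^ 2) := by
  have h1 := Real.quadratic_le_exp_of_nonneg (x := δ * y ^ 2) (by positivity)
  have h2 : 1 ≤ Real.exp (δ * y ^ 2) := Real.one_le_exp (by positivity)
  have h3 : |y| ^ 3 ≤ 1 + |y| ^ 4 := by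
    have := abs_nonneg y
    rcases le_total |y| 1 with h | h
    · have : |y| ^ 3 ≤ 1 := pow_le_one₀ this h
      have : 0 ≤ |y| ^ 4 := by positivity
      linarith
    · have : |y| ^ 3 ≤ |y| ^ 4 := pow_le_pow_right₀ h (by norm_num)
      linarith
  have h4 : |y| ^ 4 = y ^ 4 := by
    rw [← abs_pow, abs_of_nonneg (by positivity)]
  have h5 : y ^ 4 ≤ 2 / δ ^ 2 * Real.exp (δ * y ^ 2) := by
    rw [div_mul_eq_mul_div, le_div_iff₀ (by positivity)]
    have : 0 ≤ δ * y ^ 2 := by positivity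
    nlinarith
  linarith

/-- The characteristic function of a centered variable of variance at least `c` decays like a
Gaussian in a neighbourhood of `0` that depends only on `c`, `δ` and `Cδ`. -/
theorem exists_norm_integral_cexp_le {c δ Cδ : ℝ} (hc : 0 < c) (hδ : 0 < δ) (hCδ : 0 < Cδ) :
    ∃ t₀ : ℝ, 0 < t₀ ∧ ∀ (Ω : Type*) [MeasurableSpace Ω] (P : Measure Ω) [IsProbabilityMeasure P]
      (Y : Ω → ℝ), Measurable Y → ∫ ω, Y ω ∂P = 0 → c ≤ ∫ ω, Y ω ^ 2 ∂P →
      ∫⁻ ω, ENNReal.ofReal (Real.exp (δ * Y ω ^ 2)) ∂P ≤ ENNReal.ofReal Cδ →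
      ∀ t : ℝ, |t| ≤ t₀ →
        ‖∫ ω, Complex.exp ((t * Y ω : ℝ) * Complex.I) ∂P‖ ≤ Real.exp (-(c / 4) * t ^ 2) := by
  set C3 : ℝ := (1 + 2 / δ ^ 2) * Cδ with hC3
  have hC30 : 0 < C3 := by positivity
  -- The second bound on `t` makes `1 - t² 𝔼 Y² / 2` nonnegative, the third makes the cubic error term
  -- at most half of the quadratic one.
  refine ⟨min (min 1 (δ / Cδ)) (c / (16 * C3)), by positivity, ?_⟩
  intro Ω _ P _ Y hY h0 hvar hsub t ht
  have ht1 : |t| ≤ 1 := ht.trans ((min_le_left _ _).trans (min_le_left _ _))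
  have ht2 : |t| ≤ δ / Cδ := ht.trans ((min_le_left _ _).trans (min_le_right _ _))
  have ht3 : |t| ≤ c / (16 * C3) := ht.trans (min_le_right _ _)
  set s2 := ∫ ω, Y ω ^ 2 ∂P with hs2
  have hs2le : s2 ≤ 1 / δ * Cδ :=
    integral_le_of_le_exp_mul_sq (by positivity) hCδ hY hsub (by fun_prop) fun ω => by
      rw [Real.norm_eq_abs, abs_of_nonneg (sq_nonneg _)]; exact sq_le_exp_mul_sq hδ _
  have hiY : Integrable Y P := integrable_of_le_exp_mul_sq hY hsub (by fun_prop)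
    fun ω => abs_le_exp_mul_sq hδ _
  have hiY2 : Integrable (fun ω => Y ω ^ 2) P := integrable_of_le_exp_mul_sq (a := 1 / δ) hY hsub
    (by fun_prop) fun ω => by
      rw [Real.norm_eq_abs, abs_of_nonneg (sq_nonneg _)]; exact sq_le_exp_mul_sq hδ _
  have hiY3 : Integrable (fun ω => |Y ω| ^ 3) P := integrable_of_le_exp_mul_sq hY hsub
    (by fun_prop) fun ω => by
      rw [Real.norm_eq_abs, abs_of_nonneg (by positivity)]; exact abs_cube_le_exp_mul_sq hδ _
  have hY3le : ∫ ω, |Y ω| ^ 3 ∂P ≤ C3 :=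
    integral_le_of_le_exp_mul_sq (by positivity) hCδ hY hsub (by fun_prop) fun ω => by
      rw [Real.norm_eq_abs, abs_of_nonneg (by positivity)]; exact abs_cube_le_exp_mul_sq hδ _
  have hie : Integrable (fun ω => Complex.exp ((t * Y ω : ℝ) * Complex.I)) P := by
    refine Integrable.of_bound (by fun_prop) 1 (ae_of_all _ fun ω => ?_)
    rw [Complex.norm_exp_ofReal_mul_I]
  have hip : Integrable (fun ω => (1 + (t * Y ω : ℝ) * Complex.I
      - ((t * Y ω : ℝ) : ℂ) ^ 2 / 2 : ℂ)) P := by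
    refine ((integrable_const _).add ((hiY.const_mul t).ofReal.mul_const _)).sub ?_
    have : Integrable (fun ω => (((t ^ 2 / 2) * Y ω ^ 2 : ℝ) : ℂ)) P := (hiY2.const_mul _).ofReal
    refine this.congr (ae_of_all _ fun ω => ?_)
    push_cast; ring
  have hint : ∫ ω, (1 + (t * Y ω : ℝ) * Complex.I - ((t * Y ω : ℝ) : ℂ) ^ 2 / 2 : ℂ) ∂P
      = ((1 - t ^ 2 * s2 / 2 : ℝ) : ℂ) := by
    have h2 : (fun ω => (1 + (t * Y ω : ℝ) * Complex.I - ((t * Y ω : ℝ) : ℂ) ^ 2 / 2 : ℂ))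
        = fun ω => ((1 : ℂ) + ((Y ω : ℝ) : ℂ) * (t * Complex.I))
          - ((Y ω ^ 2 : ℝ) : ℂ) * (t ^ 2 / 2) := by
      ext ω; push_cast; ring
    have i1 : Integrable (fun ω => ((Y ω : ℝ) : ℂ) * (t * Complex.I)) P := hiY.ofReal.mul_const _
    have i2 : Integrable (fun ω => ((Y ω ^ 2 : ℝ) : ℂ) * ((t : ℂ) ^ 2 / 2)) P :=
      hiY2.ofReal.mul_const _
    have i01 : Integrable (fun ω => (1 : ℂ) + ((Y ω : ℝ) : ℂ) * (t * Complex.I)) P :=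
      (integrable_const _).add i1
    rw [h2, integral_sub i01 i2, integral_add (integrable_const _) i1,
      integral_mul_const, integral_mul_const, integral_complex_ofReal, integral_complex_ofReal,
      h0, ← hs2]
    simp
    ring
  have hrem : ‖∫ ω, Complex.exp ((t * Y ω : ℝ) * Complex.I) ∂P - ((1 - t ^ 2 * s2 / 2 : ℝ) : ℂ)‖
      ≤ 4 * |t| ^ 3 * C3 := by
    rw [← hint, ← integral_sub hie hip]
    refine (norm_integral_le_of_norm_le (hiY3.const_mul (4 * |t| ^ 3))
      (ae_of_all _ fun ω => ?_)).trans ?_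
    · refine (norm_cexp_I_sub_taylor_le _).trans (le_of_eq ?_)
      rw [abs_mul]; ring
    · rw [integral_const_mul]; gcongr
  have hmain : ‖((1 - t ^ 2 * s2 / 2 : ℝ) : ℂ)‖ ≤ 1 - t ^ 2 * c / 2 := by
    rw [Complex.norm_real, Real.norm_eq_abs, abs_of_nonneg]
    · have : t ^ 2 * c ≤ t ^ 2 * s2 := by gcongr
      linarith
    · have h1 : t ^ 2 ≤ δ / Cδ := by
        rw [← sq_abs]; nlinarith [abs_nonneg t]
      have h2 : t ^ 2 * s2 ≤ δ / Cδ * (1 / δ * Cδ) := by gcongr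
      have h3 : δ / Cδ * (1 / δ * Cδ) = 1 := by field_simp
      linarith
  have hcub : 4 * |t| ^ 3 * C3 ≤ t ^ 2 * c / 4 := by
    have h1 : |t| * (16 * C3) ≤ c := (le_div_iff₀ (by positivity)).1 ht3
    have h2 : |t| ^ 3 = t ^ 2 * |t| := by rw [pow_succ, sq_abs]
    rw [h2]
    nlinarith [sq_nonneg t]
  calc ‖∫ ω, Complex.exp ((t * Y ω : ℝ) * Complex.I) ∂P‖
      ≤ ‖∫ ω, Complex.exp ((t * Y ω : ℝ) * Complex.I) ∂P - ((1 - t ^ 2 * s2 / 2 : ℝ) : ℂ)‖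
        + ‖((1 - t ^ 2 * s2 / 2 : ℝ) : ℂ)‖ := by
        have := norm_add_le (∫ ω, Complex.exp ((t * Y ω : ℝ) * Complex.I) ∂P
          - ((1 - t ^ 2 * s2 / 2 : ℝ) : ℂ)) ((1 - t ^ 2 * s2 / 2 : ℝ) : ℂ)
        rwa [sub_add_cancel] at this
    _ ≤ 4 * |t| ^ 3 * C3 + (1 - t ^ 2 * c / 2) := add_le_add hrem hmain
    _ ≤ -(c / 4) * t ^ 2 + 1 := by linarith
    _ ≤ _ := Real.add_one_le_exp _

theorem exp_le_one_add_add (x : ℝ) : Real.exp x ≤ 1 + x + x ^ 2 * Real.exp |x| := by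
  have h : ∀ y : ℝ, 0 ≤ y → 1 - y ≤ Real.exp (-y) := fun y _ => by
    linarith [Real.add_one_le_exp (-y)]
  rcases le_total 0 x with hx | hx
  · rw [abs_of_nonneg hx]
    -- `(1 - x) exp x ≤ 1` gives `exp x ≤ 1 + x exp x`; apply this twice.
    have h1 : Real.exp x ≤ 1 + x * Real.exp x := by
      have h2 := Real.exp_pos x
      have h3 : Real.exp x * Real.exp (-x) = 1 := by rw [← Real.exp_add]; simp
      nlinarith [h x hx]
    nlinarith
  · rw [abs_of_nonpos hx]
    have h1 := h (-x) (by linarith)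
    rw [neg_neg] at h1
    have h2 : 1 ≤ Real.exp (-x) := Real.one_le_exp (by linarith)
    have h3 : Real.exp x * Real.exp (-x) = 1 := by rw [← Real.exp_add]; simp
    have h4 : 1 - x ≤ Real.exp (-x) := by linarith [Real.add_one_le_exp (-x)]
    have h5 : 0 < Real.exp x := Real.exp_pos x
    have h6 : Real.exp x * (1 - x) ≤ 1 := by nlinarith
    have h7 : 0 ≤ x ^ 2 * (Real.exp (-x) - 1) := mul_nonneg (sq_nonneg x) (by linarith)
    have h8 : Real.exp x ≤ 1 + x * Real.exp x := by linarith
    have h9 : x * Real.exp x ≤ x * (1 + x) := by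
      have := Real.add_one_le_exp x
      nlinarith
    nlinarith

theorem hasSubgaussianMGF_of_exp_sq [IsProbabilityMeasure P] (hδ : 0 < δ) (hCδ : 0 < Cδ)
    (hY : Measurable Y)
    (h0 : ∫ ω, Y ω ∂P = 0)
    (hsub : ∫⁻ ω, ENNReal.ofReal (Real.exp (δ * Y ω ^ 2)) ∂P ≤ ENNReal.ofReal Cδ) :
    HasSubgaussianMGF Y (Real.toNNReal (2 * (2 / δ * Cδ + 1 / (2 * δ)))) P := by
  have hyoung : ∀ t y : ℝ, |t * y| ≤ t ^ 2 / (2 * δ) + δ * y ^ 2 / 2 := fun t y => by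
    rw [abs_mul, ← sq_abs t, ← sq_abs y]
    have h1 : 0 ≤ (|t| - δ * |y|) ^ 2 / (2 * δ) := by positivity
    have h2 : (|t| - δ * |y|) ^ 2 / (2 * δ)
        = |t| ^ 2 / (2 * δ) + δ * |y| ^ 2 / 2 - |t| * |y| := by field_simp; ring
    linarith
  have hint : ∀ t, Integrable (fun ω => Real.exp (t * Y ω)) P := fun t => by
    refine integrable_of_le_exp_mul_sq (a := Real.exp (t ^ 2 / (2 * δ))) hY hsub (by fun_prop)
      fun ω => ?_
    rw [Real.norm_eq_abs, Real.abs_exp, ← Real.exp_add]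
    have := (le_abs_self _).trans (hyoung t (Y ω))
    exact Real.exp_le_exp.2 (by nlinarith [mul_nonneg hδ.le (sq_nonneg (Y ω))])
  refine ⟨hint, fun t => ?_⟩
  have hiY : Integrable Y P := integrable_of_le_exp_mul_sq hY hsub (by fun_prop)
    fun ω => abs_le_exp_mul_sq hδ _
  set a := t ^ 2 * (2 / δ) * Real.exp (t ^ 2 / (2 * δ)) with ha
  have hpt : ∀ ω, Real.exp (t * Y ω) ≤ 1 + t * Y ω + a * Real.exp (δ * Y ω ^ 2) := fun ω => by
    refine (exp_le_one_add_add _).trans ?_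
    have h1 : Real.exp |t * Y ω| ≤ Real.exp (t ^ 2 / (2 * δ)) * Real.exp (δ / 2 * Y ω ^ 2) := by
      rw [← Real.exp_add]
      exact Real.exp_le_exp.2 ((hyoung t (Y ω)).trans (by linarith))
    have h2 := sq_le_exp_mul_sq (half_pos hδ) (Y ω)
    have h3 : Real.exp (δ * Y ω ^ 2)
        = Real.exp (δ / 2 * Y ω ^ 2) * Real.exp (δ / 2 * Y ω ^ 2) := by
      rw [← Real.exp_add]; ring_nf
    have h4 : 1 / (δ / 2) = 2 / δ := by field_simp
    rw [h4] at h2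
    have h5 : (t * Y ω) ^ 2 * Real.exp |t * Y ω|
        ≤ t ^ 2 * (2 / δ * Real.exp (δ / 2 * Y ω ^ 2))
          * (Real.exp (t ^ 2 / (2 * δ)) * Real.exp (δ / 2 * Y ω ^ 2)) := by
      rw [mul_pow]; gcongr
    rw [h3, ha]
    linarith
  have hmgf : mgf Y P t ≤ 1 + a * Cδ := by
    have i1 : Integrable (fun ω => 1 + t * Y ω) P := (integrable_const _).add (hiY.const_mul t)
    have i2 := (integrable_exp_mul_sq hY hsub).const_mul a
    have h1 : mgf Y P t ≤ ∫ ω, (1 + t * Y ω + a * Real.exp (δ * Y ω ^ 2)) ∂P :=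
      integral_mono (hint t) (i1.add i2) hpt
    rw [integral_add i1 i2, integral_add (integrable_const _) (hiY.const_mul t),
      integral_const_mul, integral_const_mul, h0] at h1
    simp only [integral_const, probReal_univ, smul_eq_mul, mul_one, mul_zero, add_zero] at h1
    have := mul_le_mul_of_nonneg_left (integral_exp_mul_sq_le hCδ hY hsub)
      (show 0 ≤ a by positivity)
    linarith
  refine hmgf.trans ?_
  rw [Real.coe_toNNReal _ (by positivity)]
  set b := t ^ 2 / (2 * δ) with hb
  have hb1 : 1 ≤ Real.exp b := Real.one_le_exp (by positivity)
  have h1 : 2 * (2 / δ * Cδ + 1 / (2 * δ)) * t ^ 2 / 2 = t ^ 2 * (2 / δ) * Cδ + b := by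
    rw [hb]; ring
  rw [h1, Real.exp_add, ha]
  have h2 := Real.add_one_le_exp (t ^ 2 * (2 / δ) * Cδ)
  have h3 : 0 ≤ t ^ 2 * (2 / δ) * Cδ := by positivity
  nlinarith

end SquareExponential

/-! ### Sums and products over unordered pairs -/

section UpperPairs

variable {N : ℕ}

@[to_additive]
theorem prod_prod_eq_prod_upper {M : Type*} [CommMonoid M] (f : Fin N → Fin N → M) :
    ∏ i, ∏ j, f i j = ∏ q : {q : Fin N × Fin N // q.1 ≤ q.2},
      (f q.1.1 q.1.2 * if q.1.1 < q.1.2 then f q.1.2 q.1.1 else 1) := by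
  have h1 : ∏ i, ∏ j, f i j = ∏ q : Fin N × Fin N, f q.1 q.2 :=
    (Fintype.prod_prod_type' f).symm
  have h2 : ∏ q : {q : Fin N × Fin N // q.1 ≤ q.2},
      (f q.1.1 q.1.2 * if q.1.1 < q.1.2 then f q.1.2 q.1.1 else 1)
      = ∏ q ∈ Finset.univ.filter (fun q : Fin N × Fin N => q.1 ≤ q.2),
        (f q.1 q.2 * if q.1 < q.2 then f q.2 q.1 else 1) :=
    (Finset.prod_subtype (p := fun q : Fin N × Fin N => q.1 ≤ q.2) _ (by simp)
      (fun q : Fin N × Fin N => f q.1 q.2 * if q.1 < q.2 then f q.2 q.1 else 1)).symm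
  rw [h1, h2, Finset.prod_mul_distrib,
    ← Finset.prod_filter_mul_prod_filter_not _ (fun q : Fin N × Fin N => q.1 ≤ q.2)]
  congr 1
  rw [← Finset.prod_filter, Finset.filter_filter]
  refine Finset.prod_bij' (fun q _ => q.swap) (fun q _ => q.swap) ?_ ?_ ?_ ?_ ?_
  · intro q hq
    simp only [Finset.mem_filter, Finset.mem_univ, true_and, not_le] at hq
    simp [hq, hq.le]
  · intro q hq
    simp only [Finset.mem_filter, Finset.mem_univ, true_and] at hq
    simp [hq.2]
  · simp
  · simp
  · simp

/-- A bilinear form of a symmetric matrix as a linear form in the independent entries. -/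
theorem sum_mul_mulVec_eq_sum_upper {H : Matrix (Fin N) (Fin N) ℝ} (hH : H.IsSymm)
    (a v : Fin N → ℝ) :
    ∑ i, a i * H.mulVec v i = ∑ q : {q : Fin N × Fin N // q.1 ≤ q.2},
      (a q.1.1 * v q.1.2 + if q.1.1 < q.1.2 then a q.1.2 * v q.1.1 else 0) * H q.1.1 q.1.2 := by
  have h : ∑ i, a i * H.mulVec v i = ∑ i, ∑ j, a i * v j * H i j := by
    refine Finset.sum_congr rfl fun i _ => ?_
    rw [Matrix.mulVec, dotProduct, Finset.mul_sum]
    exact Finset.sum_congr rfl fun j _ => by ring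
  rw [h, sum_sum_eq_sum_upper]
  refine Finset.sum_congr rfl fun q _ => ?_
  rw [hH.apply q.1.1 q.1.2]
  split_ifs <;> ring

end UpperPairs

/-! ### Characteristic functions of the rows -/

section Entries

variable {p W : ℕ} {c C δ Cδ : ℝ} {Ω : Type u} [MeasurableSpace Ω] {P : Measure Ω}
  {H : Ω → Matrix (Fin (2 * p * W)) (Fin (2 * p * W)) ℝ}

theorem IsBandEnsemble.lintegral_exp_sqrt_mul_sq_le (hH : IsBandEnsemble p W c C δ Cδ P H)
    (i j : Fin (2 * p * W)) :
    ∫⁻ ω, ENNReal.ofReal (Real.exp (δ * (√W * H ω i j) ^ 2)) ∂P ≤ ENNReal.ofReal Cδ := by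
  have := hH.subgaussian i j
  simpa only [mul_pow, Real.sq_sqrt (Nat.cast_nonneg (α := ℝ) W), mul_assoc] using this

theorem IsBandEnsemble.integral_sqrt_mul (hH : IsBandEnsemble p W c C δ Cδ P H)
    (i j : Fin (2 * p * W)) : ∫ ω, √W * H ω i j ∂P = 0 := by
  rw [integral_const_mul, hH.centered, mul_zero]

theorem IsBandEnsemble.le_integral_sqrt_mul_sq (hH : IsBandEnsemble p W c C δ Cδ P H) (hW : 1 ≤ W)
    {i j : Fin (2 * p * W)} (hij : periodicDist i j < 2 * W) :
    c ≤ ∫ ω, (√W * H ω i j) ^ 2 ∂P := by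
  have hW0 : (0 : ℝ) < W := by exact_mod_cast hW
  simp only [mul_pow, Real.sq_sqrt hW0.le]
  rw [integral_const_mul, mul_comm, ← div_le_iff₀ hW0]
  exact hH.le_var i j hij

theorem IsBandEnsemble.norm_integral_cexp_eq (hH : IsBandEnsemble p W c C δ Cδ P H)
    (a v : Fin (2 * p * W) → ℝ) :
    ∫ ω, Complex.exp ((∑ i, a i * (H ω).mulVec v i : ℝ) * Complex.I) ∂P
      = ∏ q : {q : Fin (2 * p * W) × Fin (2 * p * W) // q.1 ≤ q.2},
        ∫ ω, Complex.exp (((a q.1.1 * v q.1.2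
          + if q.1.1 < q.1.2 then a q.1.2 * v q.1.1 else 0) * H ω q.1.1 q.1.2 : ℝ)
            * Complex.I) ∂P := by
  have hmeas : ∀ q : {q : Fin (2 * p * W) × Fin (2 * p * W) // q.1 ≤ q.2},
      AEMeasurable (fun ω => H ω q.1.1 q.1.2) P := fun q => (hH.measurable _ _).aemeasurable
  have := hH.indep.integral_fun_prod_comp (𝕜 := ℂ) hmeas (f := fun q x =>
    Complex.exp (((a q.1.1 * v q.1.2
          + if q.1.1 < q.1.2 then a q.1.2 * v q.1.1 else 0) * x : ℝ) * Complex.I))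
    (fun q => Continuous.aestronglyMeasurable (by fun_prop))
  rw [← this]
  refine integral_congr_ae (ae_of_all _ fun ω => ?_)
  simp only
  rw [sum_mul_mulVec_eq_sum_upper (hH.symm ω), ← Complex.exp_sum, Complex.ofReal_sum,
    Finset.sum_mul]

/-- The conclusion of `exists_norm_integral_cexp_le`: the characteristic function of every centered
variable with variance at least `c` and `𝔼 exp (δ Y²) ≤ Cδ` is at most `exp (-(c / 4) t²)` on
`[-t₀, t₀]`. -/
def CharFunDecay (c δ Cδ t₀ : ℝ) : Prop :=
  ∀ (Ω : Type u) [MeasurableSpace Ω] (P : Measure Ω) [IsProbabilityMeasure P]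
      (Y : Ω → ℝ), Measurable Y → ∫ ω, Y ω ∂P = 0 → c ≤ ∫ ω, Y ω ^ 2 ∂P →
      ∫⁻ ω, ENNReal.ofReal (Real.exp (δ * Y ω ^ 2)) ∂P ≤ ENNReal.ofReal Cδ →
      ∀ t : ℝ, |t| ≤ t₀ →
        ‖∫ ω, Complex.exp ((t * Y ω : ℝ) * Complex.I) ∂P‖ ≤ Real.exp (-(c / 4) * t ^ 2)

theorem norm_integral_cexp_I_le_one [IsProbabilityMeasure P] (f : Ω → ℝ) :
    ‖∫ ω, Complex.exp ((f ω : ℝ) * Complex.I) ∂P‖ ≤ 1 := by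
  have h := norm_integral_le_of_norm_le (integrable_const (μ := P) (1 : ℝ))
    (f := fun ω => Complex.exp ((f ω : ℝ) * Complex.I))
    (ae_of_all _ fun ω => (Complex.norm_exp_ofReal_mul_I _).le)
  simpa using h

theorem IsBandEnsemble.norm_integral_cexp_entry_le [IsProbabilityMeasure P] {t₀ : ℝ}
    (ht₀ : CharFunDecay.{u} c δ Cδ t₀)
    (hH : IsBandEnsemble p W c C δ Cδ P H) (hW : 1 ≤ W) {i j : Fin (2 * p * W)}
    (hij : periodicDist i j < 2 * W) {t : ℝ} (ht : |t| ≤ t₀ * √W) :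
    ‖∫ ω, Complex.exp ((t * H ω i j : ℝ) * Complex.I) ∂P‖
      ≤ Real.exp (-(c / 4) * (t ^ 2 / W)) := by
  have hW0 : (0 : ℝ) < √W := Real.sqrt_pos.2 (by exact_mod_cast hW)
  have h := ht₀ Ω P (fun ω => √W * H ω i j) ((hH.measurable i j).const_mul _)
    (hH.integral_sqrt_mul i j) (hH.le_integral_sqrt_mul_sq hW hij)
    (hH.lintegral_exp_sqrt_mul_sq_le i j) (t / √W)
    (by rw [abs_div, abs_of_pos hW0]; exact (div_le_iff₀ hW0).2 ht)
  have h2 : ∀ ω, t / √W * (√W * H ω i j) = t * H ω i j := fun ω => by field_simp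
  simp only [h2] at h
  rwa [div_pow, Real.sq_sqrt (Nat.cast_nonneg _)] at h

/-- Joint characteristic function of the rows `i ∈ I` of `H v`: the entries `H i j` with `i ∈ I`,
`j ∈ S i` are independent, since no column `j ∈ S i` belongs to `I`. All other entries are
discarded, so that no conditioning is needed. -/
theorem IsBandEnsemble.norm_integral_cexp_le [IsProbabilityMeasure P] {t₀ : ℝ}
    (ht₀ : CharFunDecay.{u} c δ Cδ t₀)
    (hH : IsBandEnsemble p W c C δ Cδ P H) (hW : 1 ≤ W) (I : Finset (Fin (2 * p * W)))
    (S : Fin (2 * p * W) → Finset (Fin (2 * p * W)))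
    (hS : ∀ i ∈ I, ∀ j ∈ S i, j ∉ I ∧ periodicDist i j < 2 * W ∧ periodicDist j i < 2 * W)
    (a v : Fin (2 * p * W) → ℝ) :
    ‖∫ ω, Complex.exp ((∑ i, a i * (H ω).mulVec v i : ℝ) * Complex.I) ∂P‖
      ≤ ∏ i, ∏ j, if i ∈ I ∧ j ∈ S i ∧ |a i * v j| ≤ t₀ * √W ∧ a j = 0 then
          Real.exp (-(c / 4) * ((a i * v j) ^ 2 / W)) else 1 := by
  rw [hH.norm_integral_cexp_eq, norm_prod, prod_prod_eq_prod_upper]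
  refine Finset.prod_le_prod (fun _ _ => norm_nonneg _) fun q _ => ?_
  obtain ⟨⟨i, j⟩, hij⟩ := q
  simp only at hij ⊢
  by_cases h1 : i ∈ I ∧ j ∈ S i ∧ |a i * v j| ≤ t₀ * √W ∧ a j = 0
  · have h2 : ¬ (j ∈ I ∧ i ∈ S j ∧ |a j * v i| ≤ t₀ * √W ∧ a i = 0) := fun h =>
      (hS i h1.1 j h1.2.1).1 h.1
    rw [if_pos h1, if_neg h2, ite_self, mul_one, h1.2.2.2, zero_mul, ite_self, add_zero]
    exact hH.norm_integral_cexp_entry_le ht₀ hW (hS i h1.1 j h1.2.1).2.1 h1.2.2.1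
  · rw [if_neg h1, one_mul]
    by_cases h2 : i < j ∧ (j ∈ I ∧ i ∈ S j ∧ |a j * v i| ≤ t₀ * √W ∧ a i = 0)
    · rw [if_pos h2.1, if_pos h2.2, if_pos h2.1, h2.2.2.2.2, zero_mul, zero_add]
      exact hH.norm_integral_cexp_entry_le ht₀ hW (hS j h2.2.1 i h2.2.2.1).2.2 h2.2.2.2.1
    · have h3 : (if i < j then (if j ∈ I ∧ i ∈ S j ∧ |a j * v i| ≤ t₀ * √W ∧ a i = 0 then
          Real.exp (-(c / 4) * ((a j * v i) ^ 2 / W)) else 1) else 1) = (1 : ℝ) := by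
        split_ifs with h4 h5
        · exact absurd ⟨h4, h5⟩ h2
        · rfl
        · rfl
      rw [h3]
      exact norm_integral_cexp_I_le_one _

end Entries

/-! ### The small ball estimate -/

section SmallBall

/-- The bound for the characteristic function of one row, as a function of the Gaussian variable
that the small ball estimate integrates over. -/
noncomputable def decay (α β g : ℝ) : ℝ := if |g| ≤ β then Real.exp (-α * g ^ 2) else 1

/-- The Gaussian average of `decay`; it bounds the small ball probability of one row. -/
noncomputable def rowFactor (α β : ℝ) : ℝ := ∫ g, decay α β g ∂(gaussianReal 0 1)

theorem measurable_decay (α β : ℝ) : Measurable (decay α β) :=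
  Measurable.ite (measurableSet_le (by fun_prop) (by fun_prop)) (by fun_prop) (by fun_prop)

theorem decay_pos (α β g : ℝ) : 0 < decay α β g := by
  unfold decay; split_ifs <;> positivity

theorem decay_le_one {α : ℝ} (hα : 0 ≤ α) (β g : ℝ) : decay α β g ≤ 1 := by
  unfold decay
  split_ifs
  · exact Real.exp_le_one_iff.2 (by nlinarith [mul_nonneg hα (sq_nonneg g)])
  · exact le_rfl

theorem integrable_decay {α : ℝ} (hα : 0 ≤ α) (β : ℝ) :
    Integrable (decay α β) (gaussianReal 0 1) := by
  refine Integrable.of_bound (measurable_decay α β).aestronglyMeasurable 1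
    (ae_of_all _ fun g => ?_)
  rw [Real.norm_eq_abs, abs_of_pos (decay_pos _ _ _)]
  exact decay_le_one hα β g

theorem integral_cexp_mul_gaussianReal (x : ℝ) :
    ∫ g, Complex.exp ((g * x : ℝ) * Complex.I) ∂(gaussianReal 0 1)
      = (Real.exp (-(x ^ 2 / 2)) : ℂ) := by
  have h := charFun_gaussianReal (μ := 0) (v := 1) x
  rw [charFun_apply_real] at h
  rw [Complex.ofReal_exp]
  convert h using 1
  · refine integral_congr_ae (ae_of_all _ fun g => ?_)
    simp only
    push_cast
    ring_nf
  · congr 1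
    push_cast
    ring

variable {p W : ℕ} {c C δ Cδ : ℝ} {Ω : Type u} [MeasurableSpace Ω] {P : Measure Ω}
  {H : Ω → Matrix (Fin (2 * p * W)) (Fin (2 * p * W)) ℝ}

theorem IsBandEnsemble.measurable_mulVec (hH : IsBandEnsemble p W c C δ Cδ P H)
    (v : Fin (2 * p * W) → ℝ) (i : Fin (2 * p * W)) : Measurable fun ω => (H ω).mulVec v i := by
  have := hH.measurable
  simp only [Matrix.mulVec, dotProduct]
  fun_prop

/-- Gaussian smoothing: `𝔼 exp (- ∑ z_i² / 2)` for multiples `z_i` of the rows of `(H - e) v` is an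
average of joint characteristic functions, and factorizes over the rows `i ∈ I`. -/
theorem IsBandEnsemble.integral_exp_neg_le [IsProbabilityMeasure P] {t₀ : ℝ}
    (hc : 0 < c) (ht₀ : CharFunDecay.{u} c δ Cδ t₀)
    (hH : IsBandEnsemble p W c C δ Cδ P H) (hW : 1 ≤ W) (I : Finset (Fin (2 * p * W)))
    (S : Fin (2 * p * W) → Finset (Fin (2 * p * W)))
    (hS : ∀ i ∈ I, ∀ j ∈ S i, j ∉ I ∧ periodicDist i j < 2 * W ∧ periodicDist j i < 2 * W)
    (v : Fin (2 * p * W) → ℝ) (e : ℝ) {s b σ : ℝ} (hs : 0 < s) (hb : 0 < b)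
    (hvb : ∀ i ∈ I, ∀ j ∈ S i, |v j| ≤ b) (hvσ : ∀ i ∈ I, σ ^ 2 ≤ ∑ j ∈ S i, v j ^ 2) :
    ∫ ω, Real.exp (-(∑ i ∈ I, (√W / s * ((H ω).mulVec v i - e * v i)) ^ 2 / 2)) ∂P
      ≤ rowFactor (c / 4 * (σ ^ 2 / s ^ 2)) (t₀ * s / b) ^ I.card := by
  classical
  have hW0 : (0 : ℝ) < W := by exact_mod_cast hW
  have hW1 : (0 : ℝ) < √W := Real.sqrt_pos.2 hW0
  set α := c / 4 * (σ ^ 2 / s ^ 2) with hα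
  set β := t₀ * s / b with hβ
  have hα0 : 0 ≤ α := by positivity
  set κ : Fin (2 * p * W) → ℝ := fun i => if i ∈ I then √W / s else 0 with hκ
  set y : Ω → Fin (2 * p * W) → ℝ := fun ω i => (H ω).mulVec v i - e * v i with hy
  set γ : Measure (Fin (2 * p * W) → ℝ) := Measure.pi fun _ => gaussianReal 0 1 with hγ
  have hym : ∀ i, Measurable fun ω => y ω i := fun i =>
    (hH.measurable_mulVec v i).sub measurable_const
  set Φ : Ω → (Fin (2 * p * W) → ℝ) → ℂ := fun ω g =>
    Complex.exp ((∑ i, g i * (κ i * y ω i) : ℝ) * Complex.I) with hΦ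
  -- The Gaussian integral of `Φ`.
  have h1 : ∀ ω, ((Real.exp (-(∑ i ∈ I, (√W / s * y ω i) ^ 2 / 2)) : ℝ) : ℂ)
      = ∫ g, Φ ω g ∂γ := by
    intro ω
    have h2 : ∀ g, Φ ω g = ∏ i, Complex.exp ((g i * (κ i * y ω i) : ℝ) * Complex.I) := fun g => by
      simp only [hΦ]
      rw [← Complex.exp_sum, Complex.ofReal_sum, Finset.sum_mul]
    simp only [h2, hγ]
    rw [integral_fintype_prod_eq_prod
      (f := fun i x => Complex.exp ((x * (κ i * y ω i) : ℝ) * Complex.I))]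
    simp only [integral_cexp_mul_gaussianReal]
    rw [← Complex.ofReal_prod, ← Real.exp_sum, Finset.sum_neg_distrib]
    congr 3
    rw [← Finset.sum_subset (Finset.subset_univ I)]
    · exact Finset.sum_congr rfl fun i hi => by simp [hκ, hi]
    · intro i _ hi
      simp [hκ, hi]
  -- For fixed `g`, the expectation of `Φ` is a joint characteristic function.
  have h3 : ∀ g : Fin (2 * p * W) → ℝ, ‖∫ ω, Φ ω g ∂P‖
      ≤ ∏ i, if i ∈ I then decay α β (g i) else 1 := by
    intro g
    set a : Fin (2 * p * W) → ℝ := fun i => g i * κ i with ha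
    have h4 : ∀ ω, Φ ω g = Complex.exp ((∑ i, a i * (H ω).mulVec v i : ℝ) * Complex.I)
        * Complex.exp ((-∑ i, a i * (e * v i) : ℝ) * Complex.I) := fun ω => by
      rw [← Complex.exp_add, ← add_mul, ← Complex.ofReal_add, ← Finset.sum_neg_distrib,
        ← Finset.sum_add_distrib]
      simp only [hΦ, hy, ha]
      congr 3
      exact Finset.sum_congr rfl fun i _ => by ring
    simp only [h4]
    rw [integral_mul_const, norm_mul, Complex.norm_exp_ofReal_mul_I, mul_one]
    refine (hH.norm_integral_cexp_le ht₀ hW I S hS a v).trans ?_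
    refine Finset.prod_le_prod (fun i _ => Finset.prod_nonneg fun j _ => by
      split_ifs <;> positivity) fun i _ => ?_
    by_cases hi : i ∈ I
    · rw [if_pos hi]
      by_cases hg : |g i| ≤ β
      · rw [decay, if_pos hg]
        have hterm : ∀ j, (if i ∈ I ∧ j ∈ S i ∧ |a i * v j| ≤ t₀ * √W ∧ a j = 0 then
            Real.exp (-(c / 4) * ((a i * v j) ^ 2 / W)) else 1)
            = if j ∈ S i then Real.exp (-(c / 4) * (g i ^ 2 / s ^ 2 * v j ^ 2)) else 1 := by
          intro j
          by_cases hj : j ∈ S i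
          · have hj0 : a j = 0 := by simp [ha, hκ, (hS i hi j hj).1]
            have hai : a i = g i * (√W / s) := by simp [ha, hκ, hi]
            have hle : |a i * v j| ≤ t₀ * √W := by
              rw [hai, abs_mul, abs_mul, abs_of_pos (div_pos hW1 hs)]
              have hg' : |g i| * b ≤ t₀ * s := (le_div_iff₀ hb).1 hg
              calc |g i| * (√W / s) * |v j| ≤ |g i| * (√W / s) * b := by
                    gcongr; exact hvb i hi j hj
                _ = (|g i| * b) * (√W / s) := by ring
                _ ≤ (t₀ * s) * (√W / s) := by gcongr
                _ = t₀ * √W := by field_simp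
            rw [if_pos ⟨hi, hj, hle, hj0⟩, if_pos hj, hai]
            congr 2
            rw [mul_pow, mul_pow, div_pow, Real.sq_sqrt hW0.le]
            field_simp
          · rw [if_neg (fun h => hj h.2.1), if_neg hj]
        simp only [hterm]
        rw [Finset.prod_ite, Finset.prod_const_one, mul_one, ← Real.exp_sum,
          Finset.filter_mem_eq_inter, Finset.univ_inter, ← Finset.mul_sum, ← Finset.mul_sum]
        refine Real.exp_le_exp.2 ?_
        have h5 := mul_le_mul_of_nonneg_left (hvσ i hi)
          (show 0 ≤ c / 4 * (g i ^ 2 / s ^ 2) by positivity)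
        have h6 : c / 4 * (g i ^ 2 / s ^ 2) * σ ^ 2 = α * g i ^ 2 := by rw [hα]; ring
        linarith
      · rw [decay, if_neg hg]
        refine Finset.prod_le_one (fun j _ => by split_ifs <;> positivity) fun j _ => ?_
        split_ifs
        · refine Real.exp_le_one_iff.2 ?_
          have : 0 ≤ c / 4 * ((a i * v j) ^ 2 / W) := by positivity
          linarith
        · exact le_rfl
    · simp [hi]
  have hswap : ∫ ω, ∫ g, Φ ω g ∂γ ∂P = ∫ g, ∫ ω, Φ ω g ∂P ∂γ := by
    apply integral_integral_swap
    refine Integrable.of_bound (C := 1) ?_ (ae_of_all _ fun z => ?_)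
    · apply Measurable.aestronglyMeasurable
      have : ∀ i, Measurable fun z : Ω × (Fin (2 * p * W) → ℝ) => z.2 i * (κ i * y z.1 i) :=
        fun i =>
        ((measurable_pi_apply i).comp measurable_snd).mul
          (((hym i).comp measurable_fst).const_mul _)
      simp only [hΦ, Function.uncurry_def]
      fun_prop
    · exact (Complex.norm_exp_ofReal_mul_I _).le
  have h7 : ((∫ ω, Real.exp (-(∑ i ∈ I, (√W / s * y ω i) ^ 2 / 2)) ∂P : ℝ) : ℂ)
      = ∫ g, ∫ ω, Φ ω g ∂P ∂γ := by
    rw [← hswap, ← integral_complex_ofReal]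
    exact integral_congr_ae (ae_of_all _ h1)
  have hint : Integrable (fun g : Fin (2 * p * W) → ℝ =>
      ∏ i, if i ∈ I then decay α β (g i) else 1) γ := by
    refine Integrable.of_bound (C := 1) ?_ (ae_of_all _ fun g => ?_)
    · apply Measurable.aestronglyMeasurable
      refine Finset.measurable_fun_prod _ fun i _ => ?_
      by_cases hi : i ∈ I
      · simpa [hi, Function.comp_def] using (measurable_decay α β).comp (measurable_pi_apply i)
      · simp [hi]
    · rw [Real.norm_eq_abs, abs_of_nonneg]
      · exact Finset.prod_le_one (fun i _ => by
          split_ifs; exacts [(decay_pos _ _ _).le, one_pos.le])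
          fun i _ => by split_ifs; exacts [decay_le_one hα0 _ _, le_rfl]
      · exact Finset.prod_nonneg fun i _ => by split_ifs; exacts [(decay_pos _ _ _).le, one_pos.le]
  have h8 := norm_integral_le_of_norm_le hint (ae_of_all _ h3)
  rw [← h7, Complex.norm_real] at h8
  refine (le_abs_self _).trans (h8.trans (le_of_eq ?_))
  rw [hγ, integral_fintype_prod_eq_prod (f := fun i x => if i ∈ I then decay α β x else 1)]
  have h9 : ∀ i, ∫ x, (if i ∈ I then decay α β x else 1) ∂(gaussianReal 0 1)
      = if i ∈ I then rowFactor α β else 1 := fun i => by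
    by_cases hi : i ∈ I <;> simp [hi, rowFactor]
  simp only [h9]
  rw [Finset.prod_ite, Finset.prod_const_one, mul_one, Finset.prod_const,
    Finset.filter_mem_eq_inter, Finset.univ_inter]

/-- Small ball estimate for `(H - e) v`. -/
theorem IsBandEnsemble.measure_l2_le [IsProbabilityMeasure P] {t₀ : ℝ}
    (hc : 0 < c) (ht₀ : CharFunDecay.{u} c δ Cδ t₀)
    (hH : IsBandEnsemble p W c C δ Cδ P H) (hW : 1 ≤ W) (I : Finset (Fin (2 * p * W)))
    (S : Fin (2 * p * W) → Finset (Fin (2 * p * W)))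
    (hS : ∀ i ∈ I, ∀ j ∈ S i, j ∉ I ∧ periodicDist i j < 2 * W ∧ periodicDist j i < 2 * W)
    (v : Fin (2 * p * W) → ℝ) (e : ℝ) {s b σ r : ℝ} (hs : 0 < s) (hb : 0 < b) (hr : 0 ≤ r)
    (hvb : ∀ i ∈ I, ∀ j ∈ S i, |v j| ≤ b) (hvσ : ∀ i ∈ I, σ ^ 2 ≤ ∑ j ∈ S i, v j ^ 2) :
    P {ω | l2 ((H ω).mulVec v - e • v) ≤ r} ≤ ENNReal.ofReal (Real.exp (W * r ^ 2 / (2 * s ^ 2))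
      * rowFactor (c / 4 * (σ ^ 2 / s ^ 2)) (t₀ * s / b) ^ I.card) := by
  set f : Ω → ℝ := fun ω =>
    Real.exp (-(∑ i ∈ I, (√W / s * ((H ω).mulVec v i - e * v i)) ^ 2 / 2)) with hf
  have hle := hH.integral_exp_neg_le hc ht₀ hW I S hS v e hs hb hvb hvσ
  have hfm : Measurable f := by
    have := hH.measurable_mulVec v
    simp only [hf]; fun_prop
  have hfi : Integrable f P := by
    refine Integrable.of_bound hfm.aestronglyMeasurable 1 (ae_of_all _ fun ω => ?_)
    rw [Real.norm_eq_abs, Real.abs_exp]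
    exact Real.exp_le_one_iff.2 (neg_nonpos.2 (Finset.sum_nonneg fun i _ => by positivity))
  have hmarkov := mul_meas_ge_le_integral_of_nonneg (ae_of_all P fun ω => (Real.exp_pos
    (-(∑ i ∈ I, (√W / s * ((H ω).mulVec v i - e * v i)) ^ 2 / 2))).le) hfi
    (Real.exp (-(W * r ^ 2 / (2 * s ^ 2))))
  have hsub : {ω | l2 ((H ω).mulVec v - e • v) ≤ r}
      ⊆ {ω | Real.exp (-(W * r ^ 2 / (2 * s ^ 2))) ≤ f ω} := by
    intro ω hω
    refine Real.exp_le_exp.2 (neg_le_neg ?_)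
    have h1 : ∑ i, ((H ω).mulVec v i - e * v i) ^ 2 ≤ r ^ 2 := (l2_le_iff hr).1 hω
    have h2 : ∑ i ∈ I, ((H ω).mulVec v i - e * v i) ^ 2 ≤ r ^ 2 :=
      (Finset.sum_le_sum_of_subset_of_nonneg (Finset.subset_univ I)
        fun _ _ _ => sq_nonneg _).trans h1
    calc ∑ i ∈ I, (√W / s * ((H ω).mulVec v i - e * v i)) ^ 2 / 2
        = W / (2 * s ^ 2) * ∑ i ∈ I, ((H ω).mulVec v i - e * v i) ^ 2 := by
          rw [Finset.mul_sum]
          refine Finset.sum_congr rfl fun i _ => ?_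
          rw [mul_pow, div_pow, Real.sq_sqrt (Nat.cast_nonneg _)]
          field_simp
      _ ≤ W / (2 * s ^ 2) * r ^ 2 := by gcongr
      _ = _ := by ring
  refine (measure_mono hsub).trans ?_
  rw [ENNReal.le_ofReal_iff_toReal_le (measure_ne_top _ _) (by
    have : 0 ≤ rowFactor (c / 4 * (σ ^ 2 / s ^ 2)) (t₀ * s / b) :=
      integral_nonneg fun g => (decay_pos _ _ g).le
    positivity)]
  have h3 : (P {ω | Real.exp (-(W * r ^ 2 / (2 * s ^ 2))) ≤ f ω}).toReal
      * Real.exp (-(W * r ^ 2 / (2 * s ^ 2)))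
      ≤ rowFactor (c / 4 * (σ ^ 2 / s ^ 2)) (t₀ * s / b) ^ I.card := by
    rw [mul_comm]; exact hmarkov.trans hle
  rw [← le_div_iff₀ (Real.exp_pos _), Real.exp_neg, div_inv_eq_mul, ← Real.exp_neg] at h3
  exact h3.trans_eq (mul_comm _ _)

end SmallBall

/-! ### Bounds for the small ball probability of one row -/

section RowFactor

theorem rowFactor_nonneg (α β : ℝ) : 0 ≤ rowFactor α β :=
  integral_nonneg fun g => (decay_pos _ _ g).le

theorem rowFactor_le_one {α : ℝ} (hα : 0 ≤ α) (β : ℝ) : rowFactor α β ≤ 1 := by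
  have h := integral_mono (integrable_decay hα β) (integrable_const (1 : ℝ))
    fun g => decay_le_one hα β g
  simpa [rowFactor] using h

theorem rowFactor_lt_one {α β : ℝ} (hα : 0 < α) (hβ : 0 < β) : rowFactor α β < 1 := by
  have hint := (integrable_const (μ := gaussianReal 0 1) (1 : ℝ)).sub (integrable_decay hα.le β)
  have hpos : 0 < ∫ g, (1 - decay α β g) ∂(gaussianReal 0 1) := by
    rw [integral_pos_iff_support_of_nonneg (fun g => sub_nonneg.2 (decay_le_one hα.le β g)) hint]
    have hsub : Set.Ioo 0 β ⊆ Function.support fun g => 1 - decay α β g := by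
      intro g hg
      rw [Function.mem_support, decay, if_pos (by rw [abs_of_pos hg.1]; exact hg.2.le)]
      have : Real.exp (-α * g ^ 2) < 1 :=
        Real.exp_lt_one_iff.2 (by nlinarith [mul_pos hα (pow_pos hg.1 2)])
      exact (sub_pos.2 this).ne'
    refine lt_of_lt_of_le ?_ (measure_mono hsub)
    have hac := gaussianReal_absolutelyContinuous' 0 (one_ne_zero (α := NNReal))
    refine pos_iff_ne_zero.2 fun h => ?_
    have := hac h
    simp [hβ.not_ge] at this
  have h1 : ∫ g, (1 - decay α β g) ∂(gaussianReal 0 1) = 1 - rowFactor α β := by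
    rw [integral_sub (integrable_const _) (integrable_decay hα.le β)]
    simp [rowFactor]
  linarith

theorem integral_exp_neg_mul_sq_gaussianReal_le {α : ℝ} (hα : 0 < α) :
    ∫ g, Real.exp (-α * g ^ 2) ∂(gaussianReal 0 1) ≤ 1 / √(2 * α) := by
  rw [integral_gaussianReal_eq_integral_smul one_ne_zero]
  have h1 : ∀ x : ℝ, gaussianPDFReal 0 1 x • Real.exp (-α * x ^ 2)
      = (√(2 * Real.pi))⁻¹ * Real.exp (-(α + 1 / 2) * x ^ 2) := fun x => by
    rw [gaussianPDFReal, smul_eq_mul, mul_assoc, ← Real.exp_add]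
    simp only [NNReal.coe_one, mul_one, sub_zero]
    congr 2; ring
  simp only [h1]
  rw [integral_const_mul, integral_gaussian, ← Real.sqrt_inv, ← Real.sqrt_mul (by positivity),
    show 1 / √(2 * α) = √(2 * α)⁻¹ by rw [one_div, Real.sqrt_inv]]
  apply Real.sqrt_le_sqrt
  have h2 : (2 * Real.pi)⁻¹ * (Real.pi / (α + 1 / 2)) = (2 * α + 1)⁻¹ := by
    have := Real.pi_pos
    field_simp
  rw [h2]
  gcongr
  linarith

theorem rowFactor_le {α β : ℝ} (hα : 0 < α) (hβ : 0 < β) :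
    rowFactor α β ≤ 1 / √(2 * α) + 1 / β ^ 2 := by
  have hsq : ∫ g, g ^ 2 ∂(gaussianReal 0 1) = 1 := by
    have h := variance_id_gaussianReal (μ := 0) (v := 1)
    rw [variance_of_integral_eq_zero aemeasurable_id (by
      simp)] at h
    simpa using h
  have hi2 : Integrable (fun g : ℝ => 1 / β ^ 2 * g ^ 2) (gaussianReal 0 1) :=
    (memLp_id_gaussianReal 2).integrable_sq.const_mul _
  have hi1 : Integrable (fun g : ℝ => Real.exp (-α * g ^ 2)) (gaussianReal 0 1) := by
    refine Integrable.of_bound (by fun_prop) 1 (ae_of_all _ fun g => ?_)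
    rw [Real.norm_eq_abs, Real.abs_exp]
    exact Real.exp_le_one_iff.2 (by nlinarith [mul_nonneg hα.le (sq_nonneg g)])
  have h : rowFactor α β
      ≤ ∫ g, (Real.exp (-α * g ^ 2) + 1 / β ^ 2 * g ^ 2) ∂(gaussianReal 0 1) := by
    refine integral_mono (integrable_decay hα.le β) (hi1.add hi2) fun g => ?_
    change decay α β g ≤ Real.exp (-α * g ^ 2) + 1 / β ^ 2 * g ^ 2
    unfold decay
    split_ifs with hg
    · have : 0 ≤ 1 / β ^ 2 * g ^ 2 := by positivity
      linarith
    · push Not at hg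
      have h1 : 1 ≤ 1 / β ^ 2 * g ^ 2 := by
        rw [one_div, inv_mul_eq_div, one_le_div (by positivity), ← sq_abs g]
        gcongr
      linarith [Real.exp_pos (-α * g ^ 2)]
  rw [integral_add hi1 hi2, integral_const_mul, hsq, mul_one] at h
  exact h.trans (add_le_add_left (integral_exp_neg_mul_sq_gaussianReal_le hα) _)

end RowFactor

/-! ### Exponentially rare events -/

section ExpRare

/-- A property of matrices of size `2 p W` that holds with a probability exponentially small in `W`,
uniformly over the band ensembles with the given constants. -/
def ExpRare (p : ℕ) (c C δ Cδ : ℝ)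
    (bad : ∀ W : ℕ, Matrix (Fin (2 * p * W)) (Fin (2 * p * W)) ℝ → Prop) : Prop :=
  ∃ a : ℝ, 0 < a ∧ ∃ b : ℝ, 0 ≤ b ∧ ∃ W₀ : ℕ, ∀ W : ℕ, W₀ ≤ W →
    ∀ (Ω : Type u) [MeasurableSpace Ω] (P : Measure Ω) [IsProbabilityMeasure P]
      (H : Ω → Matrix (Fin (2 * p * W)) (Fin (2 * p * W)) ℝ), IsBandEnsemble p W c C δ Cδ P H →
      P {ω | bad W (H ω)} ≤ ENNReal.ofReal (b * Real.exp (-a * W))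

variable {p : ℕ} {c C δ Cδ : ℝ}
  {bad bad' : ∀ W : ℕ, Matrix (Fin (2 * p * W)) (Fin (2 * p * W)) ℝ → Prop}

theorem ExpRare.mono (h : ExpRare.{u} p c C δ Cδ bad) (W₁ : ℕ)
    (h' : ∀ W, W₁ ≤ W → ∀ M, bad' W M → bad W M) : ExpRare.{u} p c C δ Cδ bad' := by
  obtain ⟨a, ha, b, hb, W₀, hW⟩ := h
  refine ⟨a, ha, b, hb, max W₀ W₁, fun W hW' Ω _ P _ H hH => ?_⟩
  exact (measure_mono fun ω hω => h' W ((le_max_right _ _).trans hW') _ hω).trans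
    (hW W ((le_max_left _ _).trans hW') Ω P H hH)

theorem expRare_of_forall_not (W₁ : ℕ) (h : ∀ W, W₁ ≤ W → ∀ M, ¬ bad W M) :
    ExpRare.{u} p c C δ Cδ bad :=
  ⟨1, one_pos, 0, le_rfl, W₁, fun W hW Ω _ P _ H _ => by simp [h W hW]⟩

theorem ExpRare.or (h : ExpRare.{u} p c C δ Cδ bad) (h' : ExpRare.{u} p c C δ Cδ bad') :
    ExpRare.{u} p c C δ Cδ fun W M => bad W M ∨ bad' W M := by
  obtain ⟨a, ha, b, hb, W₀, hW⟩ := h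
  obtain ⟨a', ha', b', hb', W₀', hW'⟩ := h'
  refine ⟨min a a', lt_min ha ha', b + b', add_nonneg hb hb', max W₀ W₀',
    fun W hWW Ω _ P _ H hH => ?_⟩
  refine (measure_union_le {ω | bad W (H ω)} {ω | bad' W (H ω)}).trans ?_
  refine (add_le_add (hW W ((le_max_left _ _).trans hWW) Ω P H hH)
    (hW' W ((le_max_right _ _).trans hWW) Ω P H hH)).trans ?_
  rw [← ENNReal.ofReal_add (by positivity) (by positivity), add_mul]
  apply ENNReal.ofReal_le_ofReal
  gcongr
  · exact min_le_left _ _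
  · exact min_le_right _ _

theorem expRare_exists_finset {ι : Type*} (F : Finset ι)
    {bad : ι → ∀ W : ℕ, Matrix (Fin (2 * p * W)) (Fin (2 * p * W)) ℝ → Prop}
    (h : ∀ x ∈ F, ExpRare.{u} p c C δ Cδ (bad x)) :
    ExpRare.{u} p c C δ Cδ fun W M => ∃ x ∈ F, bad x W M := by
  classical
  induction F using Finset.induction_on with
  | empty => exact expRare_of_forall_not 0 fun W _ M h => by simp at h
  | insert x F _ ih =>
    refine ((h x (Finset.mem_insert_self x F)).or
      (ih fun y hy => h y (Finset.mem_insert_of_mem hy))).mono 0 fun W _ M hM => ?_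
    obtain ⟨y, hy, hyM⟩ := hM
    rcases Finset.mem_insert.1 hy with rfl | hy
    · exact Or.inl hyM
    · exact Or.inr ⟨y, hy, hyM⟩

/-- Union bound over a set of at most `k` events, each of probability at most `q`. -/
theorem measure_exists_mem_finset_le {Ω ι : Type*} [MeasurableSpace Ω] {P : Measure Ω}
    (F : Finset ι) {bad : ι → Ω → Prop} {k q r : ℝ} (hq : 0 ≤ q) (hk : (F.card : ℝ) ≤ k)
    (hr : k * q ≤ r) (h : ∀ x ∈ F, P {ω | bad x ω} ≤ ENNReal.ofReal q) :
    P {ω | ∃ x ∈ F, bad x ω} ≤ ENNReal.ofReal r := by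
  have h1 : {ω | ∃ x ∈ F, bad x ω} = ⋃ x ∈ F, {ω | bad x ω} := by ext ω; simp
  rw [h1]
  refine (measure_biUnion_finset_le F _).trans ((Finset.sum_le_card_nsmul F _ _ h).trans ?_)
  rw [← ENNReal.ofReal_nsmul, nsmul_eq_mul]
  exact ENNReal.ofReal_le_ofReal ((mul_le_mul_of_nonneg_right hk hq).trans hr)

end ExpRare

/-! ### The operator norm of a band matrix -/

section OperatorNorm

theorem dotProduct_le_l2_mul_l2 {ι : Type*} [Fintype ι] (x y : ι → ℝ) :
    x ⬝ᵥ y ≤ l2 x * l2 y := by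
  have h := real_inner_le_norm (WithLp.toLp 2 x) (WithLp.toLp 2 y)
  rw [EuclideanSpace.inner_eq_star_dotProduct, dotProduct_comm] at h
  simpa [l2] using h

theorem dotProduct_self_eq_l2_sq {ι : Type*} [Fintype ι] (x : ι → ℝ) : x ⬝ᵥ x = l2 x ^ 2 := by
  rw [l2_sq, dotProduct]; exact Finset.sum_congr rfl fun i _ => (sq (x i)).symm

/-- The operator norm is controlled by the bilinear form on a `1/4`-net of the unit ball. -/
theorem opNormLe_of_net {ι : Type*} [Fintype ι] [DecidableEq ι] {H : Matrix ι ι ℝ}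
    {𝒩 : Set (ι → ℝ)} (h𝒩 : ∀ x, l2 x ≤ 1 → ∃ y ∈ 𝒩, l2 y ≤ 1 ∧ l2 (x - y) ≤ 1 / 4) {m : ℝ}
    (hm : 0 ≤ m) (h : ∀ x ∈ 𝒩, ∀ y ∈ 𝒩, l2 x ≤ 1 → l2 y ≤ 1 → x ⬝ᵥ H.mulVec y ≤ m) :
    OpNormLe H (2 * m) := by
  set T := LinearMap.toContinuousLinearMap H.toEuclideanLin with hT
  have hle : ∀ x, l2 (H.mulVec x) ≤ ‖T‖ * l2 x := fun x => by
    have := T.le_opNorm (WithLp.toLp 2 x)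
    simpa [hT, l2, Matrix.toLpLin_apply] using this
  have hTm : ‖T‖ ≤ m + ‖T‖ / 2 := by
    refine ContinuousLinearMap.opNorm_le_of_unit_norm (by positivity) fun u hu => ?_
    set x := u.ofLp with hx
    have hx1 : l2 x = 1 := by simpa [l2, hx] using hu
    have hTu : ‖T u‖ = l2 (H.mulVec x) := by simp [hT, l2, Matrix.toLpLin_apply, hx]
    rw [hTu]
    rcases (l2_nonneg (H.mulVec x)).eq_or_lt with h0 | h0
    · rw [← h0]; positivity
    set z := (l2 (H.mulVec x))⁻¹ • H.mulVec x with hz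
    have hz1 : l2 z = 1 := by
      rw [hz, l2_smul, abs_of_pos (inv_pos.2 h0), inv_mul_cancel₀ h0.ne']
    have hzx : z ⬝ᵥ H.mulVec x = l2 (H.mulVec x) := by
      rw [hz, smul_dotProduct, dotProduct_self_eq_l2_sq, smul_eq_mul]; field_simp
    obtain ⟨x', hx'𝒩, hx'1, hx'⟩ := h𝒩 x hx1.le
    obtain ⟨z', hz'𝒩, hz'1, hz'⟩ := h𝒩 z hz1.le
    have hdec : z ⬝ᵥ H.mulVec x = z' ⬝ᵥ H.mulVec x' + (z - z') ⬝ᵥ H.mulVec x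
        + z' ⬝ᵥ H.mulVec (x - x') := by
      rw [Matrix.mulVec_sub, dotProduct_sub, sub_dotProduct]; ring
    have h1 : (z - z') ⬝ᵥ H.mulVec x ≤ 1 / 4 * ‖T‖ := by
      refine (dotProduct_le_l2_mul_l2 _ _).trans ?_
      have := hle x
      rw [hx1, mul_one] at this
      exact mul_le_mul hz' this (l2_nonneg _) (by norm_num)
    have h2 : z' ⬝ᵥ H.mulVec (x - x') ≤ 1 * (‖T‖ * (1 / 4)) := by
      refine (dotProduct_le_l2_mul_l2 _ _).trans ?_
      refine mul_le_mul hz'1 ((hle _).trans ?_) (l2_nonneg _) one_pos.le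
      gcongr
    have h3 := h z' hz'𝒩 x' hx'𝒩 hz'1 hx'1
    rw [← hzx, hdec]
    linarith
  intro x
  refine (hle x).trans (mul_le_mul_of_nonneg_right ?_ (l2_nonneg x))
  linarith

variable {p W : ℕ} {c C δ Cδ : ℝ}

/-- Hoeffding type bound for the bilinear form at fixed vectors. -/
theorem IsBandEnsemble.measure_le_dotProduct {Ω : Type*} [MeasurableSpace Ω] {P : Measure Ω}
    {H : Ω → Matrix (Fin (2 * p * W)) (Fin (2 * p * W)) ℝ} [IsProbabilityMeasure P]
    (hδ : 0 < δ) (hCδ : 0 < Cδ)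
    (hH : IsBandEnsemble p W c C δ Cδ P H) (hW : 1 ≤ W) {x y : Fin (2 * p * W) → ℝ}
    (hx : l2 x ≤ 1) (hy : l2 y ≤ 1) {m : ℝ} (hm : 0 ≤ m) :
    P {ω | m ≤ x ⬝ᵥ (H ω).mulVec y}
      ≤ ENNReal.ofReal (Real.exp (-(m ^ 2 * W / (8 * (2 / δ * Cδ + 1 / (2 * δ)))))) := by
  have hW0 : (0 : ℝ) < W := by exact_mod_cast hW
  have hW1 : (0 : ℝ) < √W := Real.sqrt_pos.2 hW0
  set B : ℝ := 2 * (2 / δ * Cδ + 1 / (2 * δ)) with hB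
  have hB0 : 0 < B := by positivity
  set θ : {q : Fin (2 * p * W) × Fin (2 * p * W) // q.1 ≤ q.2} → ℝ := fun q =>
    x q.1.1 * y q.1.2 + if q.1.1 < q.1.2 then x q.1.2 * y q.1.1 else 0 with hθ
  have hθsq : ∑ q, θ q ^ 2 ≤ 2 := by
    calc ∑ q, θ q ^ 2 ≤ ∑ q : {q : Fin (2 * p * W) × Fin (2 * p * W) // q.1 ≤ q.2},
          (2 * (x q.1.1 ^ 2 * y q.1.2 ^ 2) + if q.1.1 < q.1.2 then
            2 * (x q.1.2 ^ 2 * y q.1.1 ^ 2) else 0) := by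
          refine Finset.sum_le_sum fun q _ => ?_
          simp only [hθ]
          split_ifs
          · nlinarith [sq_nonneg (x q.1.1 * y q.1.2 - x q.1.2 * y q.1.1)]
          · nlinarith [sq_nonneg (x q.1.1 * y q.1.2)]
      _ = ∑ i, ∑ j, 2 * (x i ^ 2 * y j ^ 2) :=
          (sum_sum_eq_sum_upper fun i j => 2 * (x i ^ 2 * y j ^ 2)).symm
      _ = 2 * (l2 x ^ 2 * l2 y ^ 2) := by
          rw [l2_sq, l2_sq, Finset.sum_mul_sum, Finset.mul_sum]
          simp only [Finset.mul_sum]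
      _ ≤ 2 * (1 * 1) := by
          have h1 := pow_le_one₀ (n := 2) (l2_nonneg x) hx
          have h2 := pow_le_one₀ (n := 2) (l2_nonneg y) hy
          gcongr
      _ = 2 := by norm_num
  have hsub : ∀ q, HasSubgaussianMGF (fun ω => (θ q / √W) * (√W * H ω q.1.1 q.1.2))
      (((θ q / √W) ^ 2).toNNReal * B.toNNReal) P := fun q => by
    have h := (hasSubgaussianMGF_of_exp_sq hδ hCδ ((hH.measurable q.1.1 q.1.2).const_mul _)
      (hH.integral_sqrt_mul _ _) (hH.lintegral_exp_sqrt_mul_sq_le _ _)).const_mul (θ q / √W)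
    rw [Real.toNNReal_of_nonneg (sq_nonneg (θ q / √W))]
    exact h
  have hind : iIndepFun (fun (q : {q : Fin (2 * p * W) × Fin (2 * p * W) // q.1 ≤ q.2}) ω =>
      (θ q / √W) * (√W * H ω q.1.1 q.1.2)) P :=
    hH.indep.comp (fun q x => (θ q / √W) * (√W * x)) fun q => by fun_prop
  have hsum := HasSubgaussianMGF.sum_of_iIndepFun hind (s := Finset.univ) fun q _ => hsub q
  have hsum2 : HasSubgaussianMGF (fun ω => x ⬝ᵥ (H ω).mulVec y) (2 * B / W).toNNReal P := by
    have hfun : (fun ω => x ⬝ᵥ (H ω).mulVec y)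
        = fun ω => ∑ q : {q : Fin (2 * p * W) × Fin (2 * p * W) // q.1 ≤ q.2},
          (θ q / √W) * (√W * H ω q.1.1 q.1.2) := by
      ext ω
      rw [dotProduct, sum_mul_mulVec_eq_sum_upper (hH.symm ω)]
      refine Finset.sum_congr rfl fun q _ => ?_
      rw [← mul_assoc, div_mul_cancel₀ _ hW1.ne']
    rw [hfun]
    refine ⟨hsum.integrable_exp_mul, fun t => (hsum.mgf_le t).trans (Real.exp_le_exp.2 ?_)⟩
    gcongr
    rw [← NNReal.coe_le_coe, Real.coe_toNNReal _ (by positivity)]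
    rw [NNReal.coe_sum]
    simp only [NNReal.coe_mul, Real.coe_toNNReal _ (sq_nonneg _), Real.coe_toNNReal _ hB0.le]
    rw [← Finset.sum_mul]
    have h2 : ∑ q, (θ q / √W) ^ 2 = (∑ q, θ q ^ 2) / W := by
      simp only [div_pow, Real.sq_sqrt hW0.le, Finset.sum_div]
    have h3 : (∑ q, θ q ^ 2) / W * B ≤ 2 / W * B := by gcongr
    calc _ = (∑ q, θ q ^ 2) / W * B := by rw [← h2]
      _ ≤ 2 / W * B := h3
      _ = 2 * B / W := by ring
  have h := hsum2.measure_ge_le hm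
  rw [Real.coe_toNNReal _ (by positivity)] at h
  rw [ENNReal.le_ofReal_iff_toReal_le (measure_ne_top _ _) (by positivity)]
  refine h.trans (le_of_eq ?_)
  congr 1
  rw [hB]
  field_simp
  ring

/-- The operator norm of a band matrix is bounded, up to an exponentially small probability. -/
theorem exists_expRare_not_opNormLe (p : ℕ) (c C : ℝ) (hp : 0 < p) (hδ : 0 < δ) (hCδ : 0 < Cδ) :
    ∃ M : ℝ, 0 < M ∧ ExpRare.{u} p c C δ Cδ fun _ H => ¬ OpNormLe H M := by
  set B : ℝ := 8 * (2 / δ * Cδ + 1 / (2 * δ)) with hB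
  have hB0 : 0 < B := by positivity
  set l : ℝ := Real.log (2 * Real.exp 2 / (1 / 4)) with hl
  have hexpl : Real.exp l = 2 * Real.exp 2 / (1 / 4) := Real.exp_log (by positivity)
  have hl0 : 0 ≤ l := by
    apply Real.log_nonneg
    have := Real.one_le_exp (show (0 : ℝ) ≤ 2 by norm_num)
    rw [one_le_div (by norm_num)]; linarith
  set m : ℝ := √((1 + 4 * p * l) * B) with hm
  have hm0 : 0 < m := Real.sqrt_pos.2 (by positivity)
  have hm2 : m ^ 2 = (1 + 4 * p * l) * B := Real.sq_sqrt (by positivity)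
  refine ⟨2 * m, by positivity, 1, one_pos, 1, zero_le_one, 1, fun W hW Ω _ P _ H hH => ?_⟩
  have hW0 : (0 : ℝ) < W := by exact_mod_cast hW
  have hN : 1 ≤ 2 * p * W := Nat.mul_pos (by omega) hW
  obtain ⟨𝒩, hcard, hnet⟩ := exists_sparse_net (N := 2 * p * W) hN le_rfl
    (ε := 1 / 4) (by norm_num) (by norm_num)
  have hcard' : (𝒩.card : ℝ) ≤ Real.exp (2 * p * W * l) := by
    refine hcard.trans (le_of_eq ?_)
    have hN0 : ((2 * p * W : ℕ) : ℝ) ≠ 0 := by positivity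
    have h1 : 2 * Real.exp 2 * ((2 * p * W : ℕ) : ℝ) / (((2 * p * W : ℕ) : ℝ) * (1 / 4))
        = Real.exp l := by rw [hexpl]; field_simp
    rw [h1, ← Real.exp_nat_mul]; push_cast; rfl
  have hsub : {ω | ¬ OpNormLe (H ω) (2 * m)} ⊆ {ω | ∃ q ∈ 𝒩 ×ˢ 𝒩,
      l2 q.1 ≤ 1 ∧ l2 q.2 ≤ 1 ∧ m ≤ q.1 ⬝ᵥ (H ω).mulVec q.2} := by
    intro ω hω
    by_contra hcon
    refine hω (opNormLe_of_net (𝒩 := 𝒩) (fun x hx => ?_) hm0.le fun x hx y hy hx1 hy1 => ?_)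
    · obtain ⟨y, hy, hyx, -, hxy⟩ := hnet x hx ((Finset.card_le_univ _).trans (by simp))
      exact ⟨y, hy, (l2_le_of_abs_le hyx).trans hx, hxy⟩
    · by_contra hlt
      exact hcon ⟨(x, y), Finset.mem_product.2 ⟨hx, hy⟩, hx1, hy1, (not_le.1 hlt).le⟩
  refine (measure_mono hsub).trans ?_
  refine measure_exists_mem_finset_le (𝒩 ×ˢ 𝒩) (k := Real.exp (2 * p * W * l) ^ 2)
    (q := Real.exp (-(m ^ 2 * W / B))) (by positivity) ?_ ?_ fun q _ => ?_
  · rw [Finset.card_product, sq]; push_cast; gcongr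
  · rw [← Real.exp_nat_mul, ← Real.exp_add, one_mul, hm2]
    refine Real.exp_le_exp.2 (le_of_eq ?_)
    field_simp
    push_cast
    ring
  · by_cases h1 : l2 q.1 ≤ 1 ∧ l2 q.2 ≤ 1
    · refine (measure_mono fun ω hω => ?_).trans
        (hH.measure_le_dotProduct hδ hCδ hW h1.1 h1.2 hm0.le)
      exact hω.2.2
    · have : {ω | l2 q.1 ≤ 1 ∧ l2 q.2 ≤ 1 ∧ m ≤ q.1 ⬝ᵥ (H ω).mulVec q.2} = ∅ :=
        Set.eq_empty_of_forall_notMem fun ω hω => h1 ⟨hω.1, hω.2.1⟩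
      rw [this]; simp

end OperatorNorm

/-! ### Rich blocks -/

section Blocks

variable {N : ℕ}

/-- The coordinates in the `b`-th block `{b W, …, (b + 1) W - 1}`. -/
def blockIdx (N W b : ℕ) : Finset (Fin N) := Finset.univ.filter fun j => (j : ℕ) / W = b

/-- The coordinates of the `b`-th block at which `v` is not smaller than `ε / √N`. -/
noncomputable def largeIdx (W : ℕ) (ε : ℝ) (v : Fin N → ℝ) (b : ℕ) : Finset (Fin N) :=
  (blockIdx N W b).filter fun j => ε / √N ≤ |v j|

/-- The blocks, out of `n`, in which more than `2 h` coordinates of `v` are at least `ε / √N`. -/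
noncomputable def richBlocks (n W h : ℕ) (ε : ℝ) (v : Fin N → ℝ) : Finset ℕ :=
  (Finset.range n).filter fun b => 2 * h < (largeIdx W ε v b).card

theorem mem_blockIdx {W b : ℕ} {j : Fin N} : j ∈ blockIdx N W b ↔ (j : ℕ) / W = b := by
  simp [blockIdx]

theorem mem_largeIdx {W b : ℕ} {ε : ℝ} {v : Fin N → ℝ} {j : Fin N} :
    j ∈ largeIdx W ε v b ↔ (j : ℕ) / W = b ∧ ε / √N ≤ |v j| := by
  simp [largeIdx, mem_blockIdx]

theorem card_blockIdx_le (W b : ℕ) (hW : 0 < W) : (blockIdx N W b).card ≤ W := by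
  have h : ((blockIdx N W b).image fun j : Fin N => (j : ℕ))
      ⊆ Finset.Ico (b * W) ((b + 1) * W) := by
    intro i hi
    obtain ⟨j, hj, rfl⟩ := Finset.mem_image.1 hi
    rw [mem_blockIdx, Nat.div_eq_iff hW] at hj
    rw [Finset.mem_Ico, add_mul, one_mul]
    omega
  have h2 := Finset.card_le_card h
  rw [Finset.card_image_of_injective _ Fin.val_injective, Nat.card_Ico, add_mul, one_mul] at h2
  omega

theorem card_blockIdx {n W b : ℕ} (hW : 0 < W) (hb : b < n) :
    (blockIdx (n * W) W b).card = W := by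
  refine le_antisymm (card_blockIdx_le W b hW) ?_
  have hlt : ∀ i < W, b * W + i < n * W := fun i hi => by
    have : (b + 1) * W ≤ n * W := Nat.mul_le_mul_right W hb
    rw [add_mul, one_mul] at this
    omega
  have h := Finset.card_le_card_of_injOn (s := (Finset.univ : Finset (Fin W)))
    (t := blockIdx (n * W) W b) (fun i => ⟨b * W + i, hlt i i.2⟩) (fun i _ => by
      have : (b * W + (i : ℕ)) / W = b := by
        rw [Nat.div_eq_iff hW]; omega
      simpa [mem_blockIdx] using this) (fun i _ j _ hij => by
      simp only [Fin.mk.injEq] at hij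
      exact Fin.ext (by omega))
  simpa using h

theorem div_lt_of_fin {n W : ℕ} (j : Fin (n * W)) : (j : ℕ) / W < n :=
  Nat.div_lt_of_lt_mul (j.2.trans_eq (mul_comm n W))

theorem periodicDist_lt {n W : ℕ} (hW : 0 < W) {i j : Fin n}
    (h : (i : ℕ) / W = (j : ℕ) / W ∨ (i : ℕ) / W + 1 = (j : ℕ) / W) :
    periodicDist i j < 2 * W ∧ periodicDist j i < 2 * W := by
  have hi1 := Nat.div_mul_le_self (i : ℕ) W
  have hj1 := Nat.div_mul_le_self (j : ℕ) W
  have hi2 := Nat.lt_div_mul_add (a := i) hW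
  have hj2 := Nat.lt_div_mul_add (a := j) hW
  have h3 : ((i : ℤ) - (j : ℤ)).natAbs < 2 * W ∧ ((j : ℤ) - (i : ℤ)).natAbs < 2 * W := by
    rcases h with h | h
    · rw [h] at hi1 hi2; omega
    · rw [← h, add_mul, one_mul] at hj1 hj2; omega
  exact ⟨(min_le_left _ _).trans_lt h3.1, (min_le_left _ _).trans_lt h3.2⟩

theorem richBlocks_mono {n W h : ℕ} {ε ε' : ℝ} (hε : ε' ≤ ε) (v : Fin N → ℝ) :
    richBlocks n W h ε v ⊆ richBlocks n W h ε' v := by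
  intro b hb
  rw [richBlocks, Finset.mem_filter] at hb ⊢
  refine ⟨hb.1, hb.2.trans_le (Finset.card_le_card fun j hj => ?_)⟩
  rw [mem_largeIdx] at hj ⊢
  exact ⟨hj.1, le_trans (by gcongr) hj.2⟩

theorem zero_notMem_richBlocks {n W h : ℕ} (hW : 0 < W) {ε : ℝ} (hε : 0 < ε) {v : Fin N → ℝ}
    (hv : ∀ i : Fin N, (i : ℕ) < W → v i = 0) : 0 ∉ richBlocks n W h ε v := by
  intro hb
  have h2 : largeIdx W ε v 0 = ∅ := by
    refine Finset.eq_empty_of_forall_notMem fun j hj => ?_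
    rw [mem_largeIdx] at hj
    have hj0 := hv j ((Nat.div_eq_zero_iff.1 hj.1).resolve_left hW.ne')
    rw [hj0, abs_zero] at hj
    have : (0 : ℝ) < √N := Real.sqrt_pos.2 (by exact_mod_cast (Nat.zero_le _).trans_lt j.2)
    have : 0 < ε / √N := by positivity
    linarith [hj.2]
  have := (Finset.mem_filter.1 hb).2
  rw [h2] at this
  simp at this

/-- `v` with the small coordinates outside the rich blocks set to zero. -/
noncomputable def sparsify (n W h : ℕ) (ε : ℝ) (v : Fin N → ℝ) : Fin N → ℝ := fun j =>
  if (j : ℕ) / W ∈ richBlocks n W h ε v ∨ ε / √N ≤ |v j| then v j else 0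

theorem abs_sparsify_le (n W h : ℕ) (ε : ℝ) (v : Fin N → ℝ) (j : Fin N) :
    |sparsify n W h ε v j| ≤ |v j| := by
  unfold sparsify; split_ifs
  · exact le_rfl
  · simp

theorem l2_sub_sparsify_le (n W h : ℕ) {ε : ℝ} (hε : 0 ≤ ε) (v : Fin N → ℝ) :
    l2 (v - sparsify n W h ε v) ≤ ε := by
  rw [l2_le_iff hε]
  rcases Nat.eq_zero_or_pos N with rfl | hN
  · simp [sq_nonneg]
  have hN0 : (0 : ℝ) < N := by exact_mod_cast hN
  calc ∑ j, ((v - sparsify n W h ε v) j) ^ 2 ≤ ∑ _j : Fin N, (ε / √N) ^ 2 := by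
        refine Finset.sum_le_sum fun j _ => ?_
        rw [Pi.sub_apply, sparsify]
        split_ifs with hj
        · simp; positivity
        · push Not at hj
          rw [sub_zero, ← sq_abs]
          exact pow_le_pow_left₀ (abs_nonneg _) hj.2.le 2
    _ = ε ^ 2 := by
        rw [Finset.sum_const, Finset.card_univ, Fintype.card_fin, nsmul_eq_mul, div_pow,
          Real.sq_sqrt hN0.le]
        field_simp

theorem card_support_sparsify_le {n W h : ℕ} (hW : 0 < W) (ε : ℝ) (v : Fin (n * W) → ℝ) :
    (Finset.univ.filter fun j => sparsify n W h ε v j ≠ 0).card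
      ≤ (richBlocks n W h ε v).card * W + n * (2 * h) := by
  set R := richBlocks n W h ε v with hR
  have hsub : (Finset.univ.filter fun j => sparsify n W h ε v j ≠ 0)
      ⊆ R.biUnion (blockIdx (n * W) W) ∪ (Finset.range n \ R).biUnion (largeIdx W ε v) := by
    intro j hj
    have hj2 : (j : ℕ) / W ∈ R ∨ ε / √((n * W : ℕ) : ℝ) ≤ |v j| := by
      by_contra hcon
      exact (Finset.mem_filter.1 hj).2 (if_neg hcon)
    by_cases hb : (j : ℕ) / W ∈ R
    · exact Finset.mem_union_left _ (Finset.mem_biUnion.2 ⟨_, hb, mem_blockIdx.2 rfl⟩)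
    · refine Finset.mem_union_right _ (Finset.mem_biUnion.2 ⟨(j : ℕ) / W, ?_,
        mem_largeIdx.2 ⟨rfl, hj2.resolve_left hb⟩⟩)
      exact Finset.mem_sdiff.2 ⟨Finset.mem_range.2 (div_lt_of_fin j), hb⟩
  refine (Finset.card_le_card hsub).trans ((Finset.card_union_le _ _).trans (add_le_add ?_ ?_))
  · exact Finset.card_biUnion_le_card_mul _ _ _ fun b _ => card_blockIdx_le W b hW
  · refine (Finset.card_biUnion_le_card_mul _ _ (2 * h) fun b hb => ?_).trans ?_
    · obtain ⟨hb1, hb2⟩ := Finset.mem_sdiff.1 hb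
      by_contra hcon
      exact hb2 (Finset.mem_filter.2 ⟨hb1, not_le.1 hcon⟩)
    · refine Nat.mul_le_mul_right _ ((Finset.card_le_card Finset.sdiff_subset).trans ?_)
      simp

/-- Chebyshev's inequality for the coordinates of a vector. -/
theorem card_lt_abs_mul_sq_le {x : ℝ} (hx : 0 ≤ x) (v : Fin N → ℝ) :
    ((Finset.univ.filter fun j => x < |v j|).card : ℝ) * x ^ 2 ≤ l2 v ^ 2 := by
  rw [l2_sq, ← nsmul_eq_mul]
  refine (Finset.card_nsmul_le_sum _ (fun j => v j ^ 2) _ fun j hj => ?_).trans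
    (Finset.sum_le_sum_of_subset_of_nonneg (Finset.filter_subset _ _) fun _ _ _ => sq_nonneg _)
  rw [← sq_abs (v j)]
  exact pow_le_pow_left₀ hx (Finset.mem_filter.1 hj).2.le 2

/-- If `v` vanishes on the first block and has `r ≥ 1` rich blocks, then these blocks together with
the block before the first of them provide a set `I` of `(r + 1) W` rows, up to `r h` exceptions,
and a set `S` of columns such that the coordinates of `y ≈ v` in the part of `S` seen by each of these
rows are of order `1 / √N` and carry a positive proportion of the length of `v`. Rows of a block are
paired with the columns of the same block if it is rich, and of the next block otherwise; removing
the columns `S` from the rows keeps the entries involved independent. -/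
theorem exists_rows {n W L h : ℕ} (hL : 0 < L) (hWL : L ≤ W) (hh : h = W / L) {ε : ℝ} (hε : 0 < ε)
    {v y : Fin (n * W) → ℝ} (hv1 : l2 v = 1) (hv0 : ∀ i : Fin (n * W), (i : ℕ) < W → v i = 0)
    (hne : (richBlocks n W h ε v).Nonempty) (hyv : ∀ j, |y j| ≤ |v j|)
    (hy : ∀ j : Fin (n * W), (j : ℕ) / W ∈ richBlocks n W h ε v →
      |v j - y j| ≤ ε / (2 * √((n * W : ℕ) : ℝ))) :
    ∃ I S : Finset (Fin (n * W)),
      ((richBlocks n W h ε v).card + 1) * W ≤ I.card + (richBlocks n W h ε v).card * h ∧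
      (∀ i ∈ I, i ∉ S) ∧ (∀ j ∈ S, |y j| ≤ √(2 * n * L) / √((n * W : ℕ) : ℝ)) ∧
      ∀ i ∈ I, ε ^ 2 / (8 * n * L) ≤ ∑ j ∈ S.filter fun j : Fin (n * W) =>
        (i : ℕ) / W = (j : ℕ) / W ∨ (i : ℕ) / W + 1 = (j : ℕ) / W, y j ^ 2 := by
  classical
  set R := richBlocks n W h ε v with hR
  have hW : 0 < W := hL.trans_le hWL
  have hRn : ∀ b ∈ R, b < n := fun b hb => Finset.mem_range.1 (Finset.mem_filter.1 hb).1
  have hn : 0 < n := by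
    obtain ⟨b, hb⟩ := hne
    exact (Nat.zero_le b).trans_lt (hRn b hb)
  have hn0 : (0 : ℝ) < n := by exact_mod_cast hn
  have hW0 : (0 : ℝ) < W := by exact_mod_cast hW
  have hL0 : (0 : ℝ) < L := by exact_mod_cast hL
  have hN0 : (0 : ℝ) < ((n * W : ℕ) : ℝ) := by push_cast; positivity
  have hWh : (W : ℝ) ≤ 2 * L * h := by
    have h1 : W < L * (W / L) + L := by
      have := Nat.lt_div_mul_add (a := W) hL
      rwa [mul_comm] at this
    have h2 : 1 ≤ W / L := (Nat.one_le_div_iff hL).2 hWL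
    rw [← hh] at h1 h2
    have h3 : W ≤ 2 * L * h := by nlinarith
    exact_mod_cast h3
  -- At most `h` coordinates exceed `√(2 n L / N)`.
  set x := √(2 * n * L) / √((n * W : ℕ) : ℝ) with hx
  have hx2 : x ^ 2 = 2 * L / W := by
    rw [hx, div_pow, Real.sq_sqrt (by positivity), Real.sq_sqrt hN0.le]
    push_cast; field_simp
  have hbig : (Finset.univ.filter fun j => x < |v j|).card ≤ h := by
    have h1 := card_lt_abs_mul_sq_le (x := x) (by positivity) v
    rw [hv1, hx2, one_pow, mul_div_assoc', div_le_one hW0] at h1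
    have h2 : ((Finset.univ.filter fun j => x < |v j|).card : ℝ) * (2 * L) ≤ h * (2 * L) := by
      linarith
    exact_mod_cast le_of_mul_le_mul_right h2 (by positivity)
  have hsel : ∀ b ∈ R, ∃ t ⊆ (largeIdx W ε v b).filter (fun j => |v j| ≤ x), t.card = h := by
    intro b hb
    apply Finset.exists_subset_card_eq
    have h1 := (Finset.mem_filter.1 hb).2
    have h2 : largeIdx W ε v b ⊆ (largeIdx W ε v b).filter (fun j => |v j| ≤ x)
        ∪ Finset.univ.filter (fun j => x < |v j|) := by
      intro j hj
      rcases le_or_gt |v j| x with hjx | hjx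
      · exact Finset.mem_union_left _ (Finset.mem_filter.2 ⟨hj, hjx⟩)
      · exact Finset.mem_union_right _ (by simp [hjx])
    have h3 := (Finset.card_le_card h2).trans (Finset.card_union_le _ _)
    omega
  choose! t htsub htcard using hsel
  have ht : ∀ b ∈ R, ∀ j ∈ t b, (j : ℕ) / W = b ∧ ε / √((n * W : ℕ) : ℝ) ≤ |v j| ∧ |v j| ≤ x := by
    intro b hb j hj
    obtain ⟨h1, h2⟩ := Finset.mem_filter.1 (htsub b hb hj)
    exact ⟨(mem_largeIdx.1 h1).1, (mem_largeIdx.1 h1).2, h2⟩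
  set S := R.biUnion t with hS
  -- The block before the first rich block is poor.
  set b₀ := R.min' hne with hb₀
  have hb₀R : b₀ ∈ R := R.min'_mem hne
  have hb₀1 : 1 ≤ b₀ := Nat.one_le_iff_ne_zero.2 fun h0 =>
    zero_notMem_richBlocks hW hε hv0 (h0 ▸ hb₀R)
  have hb₀n := hRn b₀ hb₀R
  have hprev : b₀ - 1 ∉ R := fun hmem => by
    have := R.min'_le _ hmem
    omega
  set T := insert (b₀ - 1) R with hT
  have hTcard : T.card = R.card + 1 := Finset.card_insert_of_notMem hprev
  refine ⟨T.biUnion (blockIdx (n * W) W) \ S, S, ?_, fun i hi => (Finset.mem_sdiff.1 hi).2, ?_, ?_⟩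
  · have h1 : (T.biUnion (blockIdx (n * W) W)).card = T.card * W := by
      rw [Finset.card_biUnion, Finset.sum_congr rfl fun b hb => card_blockIdx hW ?_,
        Finset.sum_const, smul_eq_mul]
      · rcases Finset.mem_insert.1 hb with rfl | hb
        · omega
        · exact hRn b hb
      · intro b _ b' _ hbb'
        refine Finset.disjoint_left.2 fun j hj hj' => hbb' ?_
        rw [← mem_blockIdx.1 hj, mem_blockIdx.1 hj']
    have h2 : S.card ≤ R.card * h :=
      Finset.card_biUnion_le_card_mul _ _ _ fun b hb => (htcard b hb).le
    have h3 := Finset.le_card_sdiff S (T.biUnion (blockIdx (n * W) W))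
    rw [h1, hTcard] at h3
    omega
  · intro j hj
    obtain ⟨b, hb, hjb⟩ := Finset.mem_biUnion.1 hj
    exact (hyv j).trans (ht b hb j hjb).2.2
  · intro i hi
    obtain ⟨b', hb', hib'⟩ := Finset.mem_biUnion.1 (Finset.mem_sdiff.1 hi).1
    rw [mem_blockIdx] at hib'
    obtain ⟨b, hb, hbb⟩ : ∃ b ∈ R, b' = b ∨ b' + 1 = b := by
      rcases Finset.mem_insert.1 hb' with h1 | h1
      · exact ⟨b₀, hb₀R, Or.inr (by omega)⟩
      · exact ⟨b', h1, Or.inl rfl⟩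
    have hsub : t b ⊆ S.filter fun j : Fin (n * W) =>
        (i : ℕ) / W = (j : ℕ) / W ∨ (i : ℕ) / W + 1 = (j : ℕ) / W := by
      intro j hj
      refine Finset.mem_filter.2 ⟨Finset.mem_biUnion.2 ⟨b, hb, hj⟩, ?_⟩
      rw [(ht b hb j hj).1, hib']
      exact hbb
    refine le_trans ?_ (Finset.sum_le_sum_of_subset_of_nonneg hsub fun _ _ _ => sq_nonneg _)
    have hterm : ∀ j ∈ t b, (ε / (2 * √((n * W : ℕ) : ℝ))) ^ 2 ≤ y j ^ 2 := by
      intro j hj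
      obtain ⟨hj1, hj2, -⟩ := ht b hb j hj
      rw [← sq_abs (y j)]
      refine pow_le_pow_left₀ (by positivity) ?_ 2
      have h1 := hy j (by rw [hj1]; exact hb)
      have h2 : |v j| ≤ |y j| + |v j - y j| := by
        have := abs_add_le (y j) (v j - y j)
        rwa [add_sub_cancel] at this
      have h3 : ε / √((n * W : ℕ) : ℝ)
          = ε / (2 * √((n * W : ℕ) : ℝ)) + ε / (2 * √((n * W : ℕ) : ℝ)) := by
        field_simp; norm_num
      linarith
    refine le_trans ?_ (Finset.card_nsmul_le_sum _ _ _ hterm)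
    rw [htcard b hb, nsmul_eq_mul, div_pow, mul_pow, Real.sq_sqrt hN0.le]
    push_cast
    rw [mul_div_assoc', div_le_div_iff₀ (by positivity) (by positivity)]
    have h1 : ε ^ 2 * n * W ≤ ε ^ 2 * n * (2 * L * h) := by gcongr
    linarith

end Blocks

/-! ### Approximation of eigenpairs -/

section Approximation

/-- Replacing `(v, e)` by a nearby pair `(y, e')`. -/
theorem l2_mulVec_sub_le {ι : Type*} [Fintype ι] {H : Matrix ι ι ℝ} {M K κ η η' e e' : ℝ}
    {v y : ι → ℝ} (hM0 : 0 ≤ M) (hM : OpNormLe H M) (he : |e| ≤ K)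
    (hv : l2 (H.mulVec v - e • v) ≤ κ) (hvy : l2 (v - y) ≤ η) (hy : l2 y ≤ 1)
    (hee' : |e - e'| ≤ η') : l2 (H.mulVec y - e' • y) ≤ κ + (M + K) * η + η' := by
  have hdec : H.mulVec y - e' • y = (H.mulVec v - e • v) - (H.mulVec (v - y) - e • (v - y))
      + (e - e') • y := by
    rw [Matrix.mulVec_sub, smul_sub, sub_smul]; abel
  have hη : 0 ≤ η := (l2_nonneg _).trans hvy
  have hη' : 0 ≤ η' := (abs_nonneg _).trans hee'
  rw [hdec]
  refine (l2_add_le _ _).trans (add_le_add ((l2_sub_le _ _).trans (add_le_add hv ?_)) ?_)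
  · refine (l2_sub_le _ _).trans ?_
    rw [l2_smul, add_mul]
    exact add_le_add ((hM _).trans (by gcongr))
      (mul_le_mul he hvy (l2_nonneg _) ((abs_nonneg _).trans he))
  · rw [l2_smul, ← mul_one η']
    exact mul_le_mul hee' hy (l2_nonneg _) hη'

theorem exists_finset_abs_sub_le (K : ℝ) {η : ℝ} (hη : 0 < η) :
    ∃ G : Finset ℝ, ∀ e, |e| ≤ K → ∃ e' ∈ G, |e - e'| ≤ η := by
  obtain ⟨t, -, ht, hcov⟩ := (isCompact_Icc (a := -K) (b := K)).finite_cover_balls hη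
  refine ⟨ht.toFinset, fun e he => ?_⟩
  obtain ⟨e', he', hee'⟩ := Set.mem_iUnion₂.1 (hcov (abs_le.1 he))
  exact ⟨e', ht.mem_toFinset.2 he', (Metric.mem_ball.1 hee').le⟩

end Approximation

/-! ### Vectors without rich blocks -/

section Sparse

variable {p W : ℕ} {c C δ Cδ : ℝ}

/-- Small ball probability at a vector with few nonzero coordinates: some block carries a positive
proportion of the vector, and the rows of that block outside the support are independent. -/
theorem IsBandEnsemble.measure_l2_le_of_sparse {Ω : Type u} [MeasurableSpace Ω] {P : Measure Ω}
    {H : Ω → Matrix (Fin (2 * p * W)) (Fin (2 * p * W)) ℝ} [IsProbabilityMeasure P] {t₀ : ℝ}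
    (hp : 0 < p) (hc : 0 < c) (ht₀ : CharFunDecay.{u} c δ Cδ t₀)
    (hH : IsBandEnsemble p W c C δ Cδ P H) (hW : 1 ≤ W) {y : Fin (2 * p * W) → ℝ} {m : ℕ}
    (hy1 : l2 y ≤ 1) (hy2 : 1 / 2 ≤ l2 y) (hm : (Finset.univ.filter fun j => y j ≠ 0).card ≤ m)
    (e : ℝ) {r : ℝ} (hr : 0 ≤ r) :
    P {ω | l2 ((H ω).mulVec y - e • y) ≤ r} ≤ ENNReal.ofReal (Real.exp (W * r ^ 2 / 2)
      * rowFactor (c / 4 * (1 / (8 * p))) t₀ ^ (W - m)) := by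
  have hp0 : (0 : ℝ) < p := by exact_mod_cast hp
  obtain ⟨b, hb, hby⟩ : ∃ b ∈ Finset.range (2 * p),
      1 / (8 * p : ℝ) ≤ ∑ j ∈ blockIdx (2 * p * W) W b, y j ^ 2 := by
    by_contra hcon
    push Not at hcon
    have h1 : ∑ j, y j ^ 2 = ∑ b ∈ Finset.range (2 * p), ∑ j ∈ blockIdx (2 * p * W) W b, y j ^ 2 :=
      (Finset.sum_fiberwise_of_maps_to (fun j _ => Finset.mem_range.2 (div_lt_of_fin j))
        fun j => y j ^ 2).symm
    have h2 : ∑ j, y j ^ 2 < ∑ _b ∈ Finset.range (2 * p), 1 / (8 * p : ℝ) := by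
      rw [h1]
      exact Finset.sum_lt_sum_of_nonempty (by simp; omega) hcon
    rw [← l2_sq, Finset.sum_const, Finset.card_range, nsmul_eq_mul] at h2
    have h3 : ((2 * p : ℕ) : ℝ) * (1 / (8 * p : ℝ)) = 1 / 4 := by push_cast; field_simp; norm_num
    nlinarith
  set σ : ℝ := √(1 / (8 * p)) with hσ
  have hσ2 : σ ^ 2 = 1 / (8 * p) := Real.sq_sqrt (by positivity)
  set I := (blockIdx (2 * p * W) W b).filter fun j => y j = 0 with hI
  set S := (blockIdx (2 * p * W) W b).filter fun j => y j ≠ 0 with hS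
  have h := hH.measure_l2_le hc ht₀ hW I (fun _ => S) (fun i hi j hj => ?_) y e (s := 1) (b := 1)
    (σ := σ) (r := r) one_pos one_pos hr (fun i _ j _ => (abs_le_l2 y j).trans hy1)
    (fun i _ => ?_)
  · refine h.trans (ENNReal.ofReal_le_ofReal ?_)
    rw [hσ2]
    simp only [one_pow, mul_one, div_one]
    gcongr ?_ * ?_
    refine pow_le_pow_of_le_one (rowFactor_nonneg _ _) (rowFactor_le_one (by positivity) _) ?_
    have h1 : I.card + S.card = W := by
      rw [hI, hS, Finset.card_filter_add_card_filter_not,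
        card_blockIdx (by omega) (Finset.mem_range.1 hb)]
    have h2 : S.card ≤ m := (Finset.card_le_card
      (Finset.filter_subset_filter _ (Finset.subset_univ _))).trans hm
    omega
  · obtain ⟨hj1, hj2⟩ := Finset.mem_filter.1 hj
    refine ⟨fun hjI => hj2 (Finset.mem_filter.1 hjI).2, periodicDist_lt (by omega) (Or.inl ?_)⟩
    rw [mem_blockIdx.1 (Finset.mem_filter.1 hi).1, mem_blockIdx.1 hj1]
  · rw [hσ2, hS, Finset.sum_filter_of_ne]
    · exact hby
    · intro j _ hj h0
      rw [h0] at hj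
      simp at hj

theorem exists_nat_log_le {q a : ℝ} (ha : 0 < a) (hq : 0 < q) (n : ℕ) :
    ∃ L : ℕ, n ≤ L ∧ 1 ≤ L ∧ 1 ≤ q * L ∧ n * Real.log (q * L) ≤ a * L := by
  have h1 := Real.tendsto_pow_log_div_mul_add_atTop 1 0 1 one_ne_zero
  have h2 : Tendsto (fun L : ℕ => q * (L : ℝ)) atTop atTop :=
    tendsto_natCast_atTop_atTop.const_mul_atTop hq
  have h3 := (h1.comp h2).eventually (gt_mem_nhds (show 0 < a / (q * (n + 1)) by positivity))
  obtain ⟨L, hL1, hL2, hL3, hL4⟩ := (h3.and ((eventually_ge_atTop n).and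
    ((eventually_ge_atTop 1).and (h2.eventually (eventually_ge_atTop 1))))).exists
  refine ⟨L, hL2, hL3, hL4, ?_⟩
  have hL0 : (0 : ℝ) < L := by exact_mod_cast hL3
  simp only [Function.comp_apply, pow_one, one_mul, add_zero] at hL1
  rw [div_lt_div_iff₀ (by positivity) (by positivity)] at hL1
  have hlog : 0 ≤ Real.log (q * L) := Real.log_nonneg hL4
  have h5 : (Real.log (q * L) * (n + 1)) * q < (a * L) * q := by linarith
  have h6 := lt_of_mul_lt_mul_right h5 hq.le
  linarith

/-- Vectors without rich blocks are approximated by vectors with few nonzero coordinates, and these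
are not approximate eigenvectors. -/
theorem exists_expRare_no_rich (hp : 0 < p) (hc : 0 < c) (hδ : 0 < δ) (hCδ : 0 < Cδ) (C : ℝ)
    {M K : ℝ} (hM : 0 ≤ M) (hK : 0 ≤ K) :
    ∃ ε : ℝ, 0 < ε ∧ ∃ L : ℕ, 12 * p ≤ L ∧ ExpRare.{u} p c C δ Cδ fun W H => OpNormLe H M ∧
      ∃ e, |e| ≤ K ∧ ∃ v, l2 v = 1 ∧ richBlocks (2 * p) W (W / L) ε v = ∅ ∧
        l2 (H.mulVec v - e • v) ≤ ε := by
  obtain ⟨t₀, ht₀, hchar⟩ := exists_norm_integral_cexp_le.{u} hc hδ hCδ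
  have hp0 : (0 : ℝ) < p := by exact_mod_cast hp
  set ρ := rowFactor (c / 4 * (1 / (8 * p))) t₀ with hρ
  have hρ1 : ρ < 1 := rowFactor_lt_one (by positivity) ht₀
  -- The maximum with `1 / 2` keeps the logarithm away from its junk value at `0`.
  set a := -Real.log (max ρ (1 / 2)) with ha
  have ha0 : 0 < a := neg_pos.2 (Real.log_neg (by positivity) (max_lt hρ1 (by norm_num)))
  have hρa : ρ ≤ Real.exp (-a) := by
    rw [ha, neg_neg, Real.exp_log (by positivity)]; exact le_max_left _ _
  set A := 2 + 2 * (M + K) with hA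
  have hA0 : 0 < A := by positivity
  set ε := min (1 / 4) (√a / (2 * A)) with hε
  have hε0 : 0 < ε := lt_min (by norm_num) (by positivity)
  have hε4 : ε ≤ 1 / 4 := min_le_left _ _
  have hr2 : (A * ε) ^ 2 ≤ a / 4 := by
    have h1 : A * ε ≤ √a / 2 := by
      calc A * ε ≤ A * (√a / (2 * A)) := by gcongr; exact min_le_right _ _
        _ = √a / 2 := by field_simp
    calc (A * ε) ^ 2 ≤ (√a / 2) ^ 2 := by gcongr
      _ = a / 4 := by rw [div_pow, Real.sq_sqrt ha0.le]; norm_num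
  -- `L` is so large that the net of vectors with `m = 4 p W / L` nonzero coordinates, of
  -- cardinality `(const * L / ε) ^ m`, is beaten by the small ball probability.
  obtain ⟨L, hL12, hL1, hqL, hlog⟩ := exists_nat_log_le (q := 2 * Real.exp 2 / ε) (a := a / 8)
    (by positivity) (by positivity) (12 * p)
  have hL0 : (0 : ℝ) < L := by exact_mod_cast hL1
  set X := 2 * Real.exp 2 / ε * L with hX
  refine ⟨ε, hε0, L, hL12, ?_⟩
  obtain ⟨G, hG⟩ := exists_finset_abs_sub_le K hε0
  refine (expRare_exists_finset G (bad := fun e' W H => OpNormLe H M ∧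
    ∃ e, |e| ≤ K ∧ |e - e'| ≤ ε ∧ ∃ v, l2 v = 1 ∧ richBlocks (2 * p) W (W / L) ε v = ∅ ∧
        l2 (H.mulVec v - e • v) ≤ ε) fun e' _ => ?_).mono 0 ?_
  swap
  · rintro W - H ⟨hHM, e, he, v, hv⟩
    obtain ⟨e', he', hee'⟩ := hG e he
    exact ⟨e', he', hHM, e, he, hee', v, hv⟩
  refine ⟨a / 4, by positivity, 1, zero_le_one, L, fun W hLW Ω _ P _ H hH => ?_⟩
  have hW : 1 ≤ W := hL1.trans hLW
  have hW0 : (0 : ℝ) < W := by exact_mod_cast hW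
  set h := W / L with hh
  have hh1 : 1 ≤ h := (Nat.one_le_div_iff hL1).2 hLW
  have hhL : L * h ≤ W := Nat.mul_div_le W L
  have hWh : W ≤ 2 * L * h := by
    have h1 : W < L * h + L := by
      have := Nat.lt_div_mul_add (a := W) hL1
      rwa [mul_comm] at this
    nlinarith
  have h12 : 12 * p * h ≤ W := (Nat.mul_le_mul_right h hL12).trans hhL
  set m := 2 * p * (2 * h) with hm
  have hm1 : 1 ≤ m := Nat.mul_pos (by omega) (by omega)
  have hm12 : 3 * m ≤ W := by rw [hm]; linarith
  have hmN : m ≤ 2 * p * W := by nlinarith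
  obtain ⟨𝒩, hcard, hnet⟩ := exists_sparse_net hm1 hmN hε0 (by linarith)
  have hcard' : (𝒩.card : ℝ) ≤ Real.exp (a / 8 * W) := by
    refine hcard.trans ?_
    have h1 : 2 * Real.exp 2 * ((2 * p * W : ℕ) : ℝ) / (m * ε) ≤ X := by
      have h2 : ((2 * p * W : ℕ) : ℝ) ≤ L * m := by
        have : 2 * p * W ≤ L * m := by rw [hm]; nlinarith
        exact_mod_cast this
      have hm0 : (0 : ℝ) < m := by exact_mod_cast hm1
      rw [hX, div_mul_eq_mul_div, div_le_div_iff₀ (by positivity) hε0]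
      have := mul_le_mul_of_nonneg_left h2 (show 0 ≤ 2 * Real.exp 2 * ε by positivity)
      linarith
    refine (pow_le_pow_left₀ (by positivity) h1 m).trans ?_
    have hX0 : 0 < X := by positivity
    rw [← Real.exp_log hX0, ← Real.exp_nat_mul]
    refine Real.exp_le_exp.2 ?_
    have h3 : (m : ℝ) * L ≤ (12 * p : ℕ) * W := by
      have : m * L ≤ 12 * p * W := by rw [hm]; nlinarith
      exact_mod_cast this
    have hlogX : 0 ≤ Real.log X := Real.log_nonneg hqL
    have h4 : ((m : ℝ) * Real.log X) * L ≤ (a / 8 * W) * L := by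
      calc ((m : ℝ) * Real.log X) * L = (m * L) * Real.log X := by ring
        _ ≤ ((12 * p : ℕ) * W) * Real.log X := by gcongr
        _ = ((12 * p : ℕ) * Real.log X) * W := by ring
        _ ≤ (a / 8 * L) * W := by gcongr
        _ = _ := by ring
    exact le_of_mul_le_mul_right h4 hL0
  set F := 𝒩.filter fun y => l2 y ≤ 1 ∧ 1 / 2 ≤ l2 y ∧
    (Finset.univ.filter fun j => y j ≠ 0).card ≤ m with hF
  have hsub : {ω | OpNormLe (H ω) M ∧ ∃ e, |e| ≤ K ∧ |e - e'| ≤ ε ∧ ∃ v, l2 v = 1 ∧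
      richBlocks (2 * p) W h ε v = ∅ ∧ l2 ((H ω).mulVec v - e • v) ≤ ε}
      ⊆ {ω | ∃ y ∈ F, l2 ((H ω).mulVec y - e' • y) ≤ A * ε} := by
    rintro ω ⟨hHM, e, he, hee', v, hv1, hvR, hv⟩
    set v' := sparsify (2 * p) W h ε v with hv'
    have hv'1 : l2 v' ≤ 1 := hv1 ▸ l2_le_of_abs_le (abs_sparsify_le _ _ _ _ _)
    have hv'm : (Finset.univ.filter fun j => v' j ≠ 0).card ≤ m := by
      have := card_support_sparsify_le (n := 2 * p) (h := h) (by omega : 0 < W) ε v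
      rwa [hvR, Finset.card_empty, zero_mul, zero_add] at this
    obtain ⟨y, hy, hyv, -, hvy⟩ := hnet v' hv'1 hv'm
    have hy1 : l2 y ≤ 1 := (l2_le_of_abs_le hyv).trans hv'1
    have hvy2 : l2 (v - y) ≤ 2 * ε := by
      have h1 := l2_add_le (v - v') (v' - y)
      rw [sub_add_sub_cancel] at h1
      have h2 := l2_sub_sparsify_le (2 * p) W h hε0.le v
      linarith
    refine ⟨y, Finset.mem_filter.2 ⟨hy, hy1, ?_, ?_⟩, ?_⟩
    · have h1 := l2_add_le (v - y) y
      rw [sub_add_cancel, hv1] at h1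
      linarith
    · refine (Finset.card_le_card fun j hj => ?_).trans hv'm
      simp only [Finset.mem_filter, Finset.mem_univ, true_and] at hj ⊢
      intro h0
      have := hyv j
      rw [h0, abs_zero] at this
      exact hj (abs_nonpos_iff.1 this)
    · refine (l2_mulVec_sub_le hM hHM he hv hvy2 hy1 hee').trans (le_of_eq ?_)
      rw [hA]; ring
  refine (measure_mono hsub).trans ?_
  refine measure_exists_mem_finset_le F (k := Real.exp (a / 8 * W))
    (q := Real.exp (W * (A * ε) ^ 2 / 2) * ρ ^ (W - m)) ?_ ?_ ?_ fun y hy => ?_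
  · have := rowFactor_nonneg (c / 4 * (1 / (8 * p))) t₀
    positivity
  · exact (Nat.cast_le.2 (Finset.card_filter_le _ _)).trans hcard'
  · have h1 : ρ ^ (W - m) ≤ Real.exp (-a * (W / 2)) := by
      refine (pow_le_pow_left₀ (rowFactor_nonneg _ _) hρa _).trans ?_
      rw [← Real.exp_nat_mul]
      refine Real.exp_le_exp.2 ?_
      have h2 : (W : ℝ) / 2 ≤ ((W - m : ℕ) : ℝ) := by
        rw [div_le_iff₀ two_pos]
        exact_mod_cast (by omega : W ≤ (W - m) * 2)
      have := mul_le_mul_of_nonneg_right h2 ha0.le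
      linarith
    have h3 : Real.exp (W * (A * ε) ^ 2 / 2) ≤ Real.exp (W * (a / 4) / 2) := by gcongr
    calc Real.exp (a / 8 * W) * (Real.exp (W * (A * ε) ^ 2 / 2) * ρ ^ (W - m))
        ≤ Real.exp (a / 8 * W) * (Real.exp (W * (a / 4) / 2) * Real.exp (-a * (W / 2))) := by
          have := rowFactor_nonneg (c / 4 * (1 / (8 * p))) t₀
          gcongr
      _ = 1 * Real.exp (-(a / 4) * W) := by
          rw [← Real.exp_add, ← Real.exp_add, one_mul]; congr 1; ring
  · obtain ⟨-, hy1, hy2, hy3⟩ := Finset.mem_filter.1 hy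
    exact hH.measure_l2_le_of_sparse hp hc hchar hW hy1 hy2 hy3 e' (by positivity)

end Sparse

/-! ### Vectors with rich blocks -/

section Rich

/-- The numerical balance between the size of the net, `(A / ε) ^ m`, and the small ball
probability, at most `(A ε) ^ (m + d)` up to a factor `exp (W / 2)`. -/
theorem net_mul_smallBall_le {p W m d n : ℕ} {A ε ρ : ℝ} (hA : 1 ≤ A) (hε : 0 < ε)
    (hAε : A * ε ≤ (Real.exp (-2) / A ^ (4 * p)) ^ 2) (hρ0 : 0 ≤ ρ) (hρ : ρ ≤ A * ε)
    (hm : m ≤ 2 * p * W) (hd : W ≤ 2 * d) (hn : m + d ≤ n) :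
    (A / ε) ^ m * (Real.exp (W / 2) * ρ ^ n) ≤ Real.exp (-W) := by
  have hA0 : 0 < A := by linarith
  set q := Real.exp (-2) / A ^ (4 * p) with hq
  have hq0 : 0 < q := by positivity
  have hq1 : q ≤ 1 := by
    rw [hq, div_le_one (by positivity)]
    exact (Real.exp_le_one_iff.2 (by norm_num)).trans (one_le_pow₀ hA)
  have hAε1 : A * ε ≤ 1 := hAε.trans (pow_le_one₀ hq0.le hq1)
  have hAε0 : 0 < A * ε := by positivity
  have h1 : ρ ^ n ≤ (A * ε) ^ m * q ^ W := by
    calc ρ ^ n ≤ (A * ε) ^ n := pow_le_pow_left₀ hρ0 hρ n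
      _ ≤ (A * ε) ^ (m + d) := pow_le_pow_of_le_one hAε0.le hAε1 hn
      _ = (A * ε) ^ m * (A * ε) ^ d := pow_add _ _ _
      _ ≤ (A * ε) ^ m * (q ^ 2) ^ d := by gcongr
      _ = (A * ε) ^ m * q ^ (2 * d) := by rw [pow_mul]
      _ ≤ (A * ε) ^ m * q ^ W :=
        mul_le_mul_of_nonneg_left (pow_le_pow_of_le_one hq0.le hq1 hd) (by positivity)
  have h2 : (A / ε) ^ m * (A * ε) ^ m ≤ (A ^ (4 * p)) ^ W := by
    rw [← mul_pow]
    have h3 : A / ε * (A * ε) = A ^ 2 := by field_simp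
    rw [h3]
    calc (A ^ 2) ^ m ≤ (A ^ 2) ^ (2 * p * W) := pow_le_pow_right₀ (one_le_pow₀ hA) hm
      _ = _ := by rw [← pow_mul, ← pow_mul]; congr 1; ring
  have h4 : (A ^ (4 * p)) ^ W * q ^ W = Real.exp (-2 * W) := by
    rw [← mul_pow, hq, mul_div_cancel₀ _ (by positivity), ← Real.exp_nat_mul]; ring_nf
  calc (A / ε) ^ m * (Real.exp (W / 2) * ρ ^ n)
      ≤ (A / ε) ^ m * (Real.exp (W / 2) * ((A * ε) ^ m * q ^ W)) := by gcongr
    _ = Real.exp (W / 2) * (((A / ε) ^ m * (A * ε) ^ m) * q ^ W) := by ring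
    _ ≤ Real.exp (W / 2) * ((A ^ (4 * p)) ^ W * q ^ W) := by gcongr
    _ = Real.exp (W / 2 + -2 * W) := by rw [h4, Real.exp_add]
    _ ≤ Real.exp (-W) := Real.exp_le_exp.2 (by
        have : (0 : ℝ) ≤ W := Nat.cast_nonneg W
        linarith)

theorem sparsify_of_mem_richBlocks {N n W h : ℕ} {ε : ℝ} {v : Fin N → ℝ} {j : Fin N}
    (hj : (j : ℕ) / W ∈ richBlocks n W h ε v) : sparsify n W h ε v j = v j :=
  if_pos (Or.inl hj)

theorem div_sqrt_le_div_sqrt {p W m : ℕ} {ε ε' : ℝ} (hp : 0 < p) (hW : 1 ≤ W) (hWm : W ≤ m)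
    (hε' : 0 < ε') (h : ε' ≤ ε / (4 * p)) : ε' / √m ≤ ε / (2 * √((2 * p * W : ℕ) : ℝ)) := by
  have hp0 : (1 : ℝ) ≤ p := by exact_mod_cast hp
  have hm0 : (0 : ℝ) < m := by exact_mod_cast hW.trans hWm
  have h3 : (W : ℝ) ≤ m := by exact_mod_cast hWm
  have h2 : √((2 * p * W : ℕ) : ℝ) ≤ 2 * p * √m := by
    rw [Real.sqrt_le_iff]
    refine ⟨by positivity, ?_⟩
    rw [mul_pow, Real.sq_sqrt hm0.le]
    push_cast
    calc 2 * (p : ℝ) * W ≤ 2 * p * (2 * p * m) := by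
          gcongr
          nlinarith
      _ = (2 * p) ^ 2 * m := by ring
  have hsN : 0 < √((2 * p * W : ℕ) : ℝ) := Real.sqrt_pos.2 (by
    exact_mod_cast Nat.mul_pos (Nat.mul_pos two_pos hp) hW)
  have hsm : 0 < √(m : ℝ) := Real.sqrt_pos.2 hm0
  rw [div_le_div_iff₀ hsm (by positivity)]
  have h4 : ε' * (4 * p) ≤ ε := (le_div_iff₀ (by positivity)).1 h
  calc ε' * (2 * √((2 * p * W : ℕ) : ℝ)) ≤ ε' * (2 * (2 * p * √m)) := by gcongr
    _ = (ε' * (4 * p)) * √m := by ring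
    _ ≤ ε * √m := by gcongr

variable {p : ℕ} {c δ Cδ : ℝ}

set_option maxHeartbeats 1000000 in
/-- Vectors whose rich blocks are the same at the scales `ε` and `ε'`, where `ε'` is much smaller
than `ε`, are not approximate eigenvectors: with `r` rich blocks, the net has about `r W` degrees of
freedom while about `(r + 1) W` rows have a small ball estimate. -/
theorem exists_expRare_rich_eq (hp : 0 < p) (hc : 0 < c) (hδ : 0 < δ) (hCδ : 0 < Cδ) (C : ℝ)
    {M K : ℝ} (hM : 0 ≤ M) (hK : 0 ≤ K) {L : ℕ} (hL12 : 12 * p ≤ L) {ε : ℝ} (hε : 0 < ε) :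
    ∃ ε' : ℝ, 0 < ε' ∧ ε' ≤ ε ∧ ExpRare.{u} p c C δ Cδ fun W H => OpNormLe H M ∧
      ∃ e, |e| ≤ K ∧ ∃ v, l2 v = 1 ∧ (∀ i : Fin (2 * p * W), (i : ℕ) < W → v i = 0) ∧
        (richBlocks (2 * p) W (W / L) ε v).Nonempty ∧
        richBlocks (2 * p) W (W / L) ε v = richBlocks (2 * p) W (W / L) ε' v ∧
        l2 (H.mulVec v - e • v) ≤ ε' := by
  obtain ⟨t₀, ht₀, hchar⟩ := exists_norm_integral_cexp_le.{u} hc hδ hCδ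
  have hp0 : (0 : ℝ) < p := by exact_mod_cast hp
  have hp1 : (1 : ℝ) ≤ p := by exact_mod_cast hp
  have hL1 : 1 ≤ L := by omega
  have hL0 : (0 : ℝ) < L := by exact_mod_cast hL1
  set A₁ := 2 + 2 * (M + K) with hA₁
  have hA₁0 : 0 < A₁ := by positivity
  -- `σ` is the length seen by each row; `A ε'` will bound the small ball probability of a row,
  -- while the net has at most `(A / ε') ^ m` elements.
  set σ := √(ε ^ 2 / (8 * (2 * p : ℕ) * L)) with hσ
  have hσ0 : 0 < σ := Real.sqrt_pos.2 (by positivity)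
  have hσ2 : σ ^ 2 = ε ^ 2 / (8 * (2 * p : ℕ) * L) := Real.sq_sqrt (by positivity)
  set A := 1 + 4 * p * Real.exp 2 + (A₁ / (σ * √(c / 2)) + 1) with hA
  have hA1 : 1 ≤ A := by
    have : 0 ≤ 4 * p * Real.exp 2 := by positivity
    have : 0 ≤ A₁ / (σ * √(c / 2)) := by positivity
    linarith
  have hA0 : 0 < A := by linarith
  set q := (Real.exp (-2) / A ^ (4 * p)) ^ 2 with hq
  have hq0 : 0 < q := by positivity
  set ε' := min (min 1 (ε / (4 * p))) (q / A) with hε'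
  have hε'0 : 0 < ε' := by positivity
  have hε'1 : ε' ≤ 1 := (min_le_left _ _).trans (min_le_left _ _)
  have hε'p : ε' ≤ ε / (4 * p) := (min_le_left _ _).trans (min_le_right _ _)
  have hAε' : A * ε' ≤ q := by
    calc A * ε' ≤ A * (q / A) := by gcongr; exact min_le_right _ _
      _ = q := by field_simp
  have hε'ε : ε' ≤ ε := by
    refine hε'p.trans (div_le_self hε.le ?_); linarith
  refine ⟨ε', hε'0, hε'ε, ?_⟩
  set s := A₁ * ε' with hs
  have hs0 : 0 < s := by positivity
  -- The probability is estimated separately for each approximate value of `e` and each number `r`.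
  obtain ⟨G, hG⟩ := exists_finset_abs_sub_le K hε'0
  refine (expRare_exists_finset (G ×ˢ Finset.Ico 1 (2 * p)) (bad := fun er W H => OpNormLe H M ∧
    ∃ e, |e| ≤ K ∧ |e - er.1| ≤ ε' ∧ ∃ v, l2 v = 1 ∧
      (∀ i : Fin (2 * p * W), (i : ℕ) < W → v i = 0) ∧
      (richBlocks (2 * p) W (W / L) ε v).card = er.2 ∧
      richBlocks (2 * p) W (W / L) ε v = richBlocks (2 * p) W (W / L) ε' v ∧
      l2 (H.mulVec v - e • v) ≤ ε') ?_).mono 1 ?_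
  swap
  · rintro W hW H ⟨hHM, e, he, v, hv1, hv0, hne, hv⟩
    obtain ⟨e', he', hee'⟩ := hG e he
    refine ⟨(e', (richBlocks (2 * p) W (W / L) ε v).card), Finset.mem_product.2 ⟨he',
      Finset.mem_Ico.2 ⟨hne.card_pos, ?_⟩⟩, hHM, e, he, hee', v, hv1, hv0, rfl, hv⟩
    have h1 : richBlocks (2 * p) W (W / L) ε v ⊂ Finset.range (2 * p) :=
      (Finset.ssubset_iff_of_subset (Finset.filter_subset _ _)).2
        ⟨0, Finset.mem_range.2 (by omega), zero_notMem_richBlocks hW hε hv0⟩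
    simpa using Finset.card_lt_card h1
  rintro ⟨e', r⟩ her
  obtain ⟨hr1, hr2⟩ := Finset.mem_Ico.1 (Finset.mem_product.1 her).2
  simp only at hr1 hr2 ⊢
  -- For `W` large the Gaussian tail in the small ball estimate is negligible.
  obtain ⟨W₁, hW₁⟩ := exists_nat_ge (2 * L / (t₀ ^ 2 * s ^ 2 * ε'))
  refine ⟨1, one_pos, 1, zero_le_one, max L W₁, fun W hWW Ω _ P _ H hH => ?_⟩
  have hLW : L ≤ W := (le_max_left _ _).trans hWW
  have hW : 1 ≤ W := hL1.trans hLW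
  have hW0 : (0 : ℝ) < W := by exact_mod_cast hW
  set h := W / L with hh
  have hhL : L * h ≤ W := Nat.mul_div_le W L
  have h12 : 12 * p * h ≤ W := (Nat.mul_le_mul_right h hL12).trans hhL
  set m := r * W + 2 * p * (2 * h) with hm
  have hWm : W ≤ m := by nlinarith
  have hrW : (r + 1) * W ≤ 2 * p * W := Nat.mul_le_mul_right W hr2
  have hmN : m ≤ 2 * p * W := by
    have : r * W + W ≤ 2 * p * W := by linarith
    have : 2 * p * (2 * h) ≤ W := by linarith
    omega
  have hN0 : (0 : ℝ) < ((2 * p * W : ℕ) : ℝ) := by positivity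
  obtain ⟨𝒩, hcard, hnet⟩ := exists_sparse_net (hW.trans hWm) hmN hε'0 hε'1
  have hm0 : (0 : ℝ) < m := by exact_mod_cast hW.trans hWm
  have hcard' : (𝒩.card : ℝ) ≤ (A / ε') ^ m := by
    refine hcard.trans (pow_le_pow_left₀ (by positivity) ?_ m)
    have h1 : ((2 * p * W : ℕ) : ℝ) ≤ 2 * p * m := by
      have : 2 * p * W ≤ 2 * p * m := Nat.mul_le_mul_left _ hWm
      exact_mod_cast this
    have h2 : 2 * Real.exp 2 * (2 * p) ≤ A := by
      have : 0 ≤ A₁ / (σ * √(c / 2)) := by positivity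
      rw [hA]; linarith
    rw [div_le_div_iff₀ (by positivity) hε'0]
    calc 2 * Real.exp 2 * ((2 * p * W : ℕ) : ℝ) * ε'
        ≤ 2 * Real.exp 2 * (2 * p * m) * ε' := by gcongr
      _ = (2 * Real.exp 2 * (2 * p)) * (m * ε') := by ring
      _ ≤ A * (m * ε') := by gcongr
  set x := √(2 * (2 * p : ℕ) * L) / √((2 * p * W : ℕ) : ℝ) with hx
  have hx0 : 0 < x := div_pos (Real.sqrt_pos.2 (by positivity)) (Real.sqrt_pos.2 hN0)
  set ρ := rowFactor (c / 4 * (σ ^ 2 / s ^ 2)) (t₀ * s / x) with hρ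
  have hρA : ρ ≤ A * ε' := by
    have h1 := rowFactor_le (α := c / 4 * (σ ^ 2 / s ^ 2)) (β := t₀ * s / x) (by positivity)
      (by positivity)
    have h2 : 1 / √(2 * (c / 4 * (σ ^ 2 / s ^ 2))) = A₁ / (σ * √(c / 2)) * ε' := by
      have h3 : 2 * (c / 4 * (σ ^ 2 / s ^ 2)) = (σ / s) ^ 2 * (c / 2) := by
        field_simp; norm_num
      rw [h3, Real.sqrt_mul (by positivity), Real.sqrt_sq (by positivity), hs]
      field_simp
    have h4 : 1 / (t₀ * s / x) ^ 2 ≤ ε' := by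
      have h5 : x ^ 2 = 2 * L / W := by
        rw [hx, div_pow, Real.sq_sqrt (by positivity), Real.sq_sqrt hN0.le]
        push_cast; field_simp
      have h6 : 1 / (t₀ * s / x) ^ 2 = 2 * L / W / (t₀ ^ 2 * s ^ 2) := by
        rw [← h5]; field_simp
      have h7 : 2 * L / (t₀ ^ 2 * s ^ 2 * ε') ≤ W :=
        hW₁.trans (by exact_mod_cast (le_max_right _ _).trans hWW)
      rw [div_le_iff₀ (by positivity)] at h7
      rw [h6, div_div, div_le_iff₀ (by positivity)]
      linarith
    have h8 : 0 ≤ (1 + 4 * p * Real.exp 2) * ε' := by positivity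
    rw [h2] at h1
    rw [hA]; linarith
  set F := 𝒩.filter fun y => ∃ I S : Finset (Fin (2 * p * W)), (r + 1) * W ≤ I.card + r * h ∧
      (∀ i ∈ I, i ∉ S) ∧ (∀ j ∈ S, |y j| ≤ x) ∧
      ∀ i ∈ I, σ ^ 2 ≤ ∑ j ∈ S.filter fun j : Fin (2 * p * W) =>
        (i : ℕ) / W = (j : ℕ) / W ∨ (i : ℕ) / W + 1 = (j : ℕ) / W, y j ^ 2 with hF
  have hηη := div_sqrt_le_div_sqrt hp hW hWm hε'0 hε'p
  have hsub : {ω | OpNormLe (H ω) M ∧ ∃ e, |e| ≤ K ∧ |e - e'| ≤ ε' ∧ ∃ v, l2 v = 1 ∧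
      (∀ i : Fin (2 * p * W), (i : ℕ) < W → v i = 0) ∧ (richBlocks (2 * p) W h ε v).card = r ∧
      richBlocks (2 * p) W h ε v = richBlocks (2 * p) W h ε' v ∧
      l2 ((H ω).mulVec v - e • v) ≤ ε'}
      ⊆ {ω | ∃ y ∈ F, l2 ((H ω).mulVec y - e' • y) ≤ s} := by
    rintro ω ⟨hHM, e, he, hee', v, hv1, hv0, hvr, hvR, hv⟩
    set v' := sparsify (2 * p) W h ε' v with hv'
    have hv'v : ∀ j, |v' j| ≤ |v j| := abs_sparsify_le _ _ _ _ _
    have hv'1 : l2 v' ≤ 1 := hv1 ▸ l2_le_of_abs_le hv'v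
    have hv'm : (Finset.univ.filter fun j => v' j ≠ 0).card ≤ m := by
      have := card_support_sparsify_le (n := 2 * p) (h := h) (by omega : 0 < W) ε' v
      rwa [← hvR, hvr] at this
    obtain ⟨y, hy, hyv, hvyj, hvy⟩ := hnet v' hv'1 hv'm
    have hy1 : l2 y ≤ 1 := (l2_le_of_abs_le hyv).trans hv'1
    have hvy2 : l2 (v - y) ≤ 2 * ε' := by
      have h1 := l2_add_le (v - v') (v' - y)
      rw [sub_add_sub_cancel] at h1
      have h2 := l2_sub_sparsify_le (2 * p) W h hε'0.le v
      linarith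
    have hrow := exists_rows (n := 2 * p) hL1 hLW hh hε hv1 hv0
      (Finset.card_pos.1 (by omega)) (fun j => (hyv j).trans (hv'v j)) fun j hj => by
        rw [hvR] at hj
        rw [← sparsify_of_mem_richBlocks hj]
        exact (hvyj j).trans hηη
    rw [hvr] at hrow
    refine ⟨y, Finset.mem_filter.2 ⟨hy, ?_⟩, ?_⟩
    · rw [hσ2]; exact hrow
    · refine (l2_mulVec_sub_le hM hHM he hv hvy2 hy1 hee').trans (le_of_eq ?_)
      rw [hs, hA₁]; ring
  refine (measure_mono hsub).trans ?_
  -- The number of rows exceeds the number `m` of degrees of freedom by at least `d ≥ W / 2`.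
  set d := W - (r + 4 * p) * h with hd
  have hrh : (r + 4 * p) * h * 2 ≤ W := by nlinarith
  have hd2 : W ≤ 2 * d := by omega
  have hρ0 : 0 ≤ ρ := rowFactor_nonneg _ _
  refine measure_exists_mem_finset_le F (k := (A / ε') ^ m)
    (q := Real.exp (W / 2) * ρ ^ (m + d)) (by positivity) ?_ ?_ fun y hy => ?_
  · exact (Nat.cast_le.2 (Finset.card_filter_le _ _)).trans hcard'
  · rw [one_mul, neg_one_mul]
    exact net_mul_smallBall_le hA1 hε'0 hAε' hρ0 hρA hmN hd2 le_rfl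
  · obtain ⟨-, I, S, hI, hIS, hSx, hIσ⟩ := Finset.mem_filter.1 hy
    have hb := hH.measure_l2_le hc hchar hW I (fun i => S.filter fun j : Fin (2 * p * W) =>
        (i : ℕ) / W = (j : ℕ) / W ∨ (i : ℕ) / W + 1 = (j : ℕ) / W)
      (fun i hi j hj => ⟨fun hjI => hIS j hjI (Finset.mem_filter.1 hj).1,
        periodicDist_lt (by omega) (Finset.mem_filter.1 hj).2⟩) y e' (s := s) (b := x) (σ := σ)
      (r := s) hs0 hx0 hs0.le (fun i _ j hj => hSx j (Finset.mem_filter.1 hj).1) hIσ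
    refine hb.trans (ENNReal.ofReal_le_ofReal ?_)
    have h1 : (W : ℝ) * s ^ 2 / (2 * s ^ 2) = W / 2 := by field_simp
    rw [h1]
    gcongr ?_ * ?_
    refine pow_le_pow_of_le_one hρ0 (rowFactor_le_one (by positivity) _) ?_
    have h2 : (r + 4 * p) * h = r * h + 2 * p * (2 * h) := by ring
    have h3 : (r + 1) * W = r * W + W := by ring
    omega

end Rich

/-! ### The lower bound off the first block -/

section LowerBound

variable {p : ℕ} {c δ Cδ : ℝ}

/-- Approximate eigenvectors that vanish on the first block and have rich blocks are rare. Passing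
to a much smaller scale either leaves the rich blocks unchanged or produces a new one; since there are
fewer than `2 p` of them, the second case occurs only finitely often. The induction is on the number
`k` of blocks that are possibly not rich. -/
theorem exists_expRare_rich (hp : 0 < p) (hc : 0 < c) (hδ : 0 < δ) (hCδ : 0 < Cδ) (C : ℝ)
    {M K : ℝ} (hM : 0 ≤ M) (hK : 0 ≤ K) {L : ℕ} (hL12 : 12 * p ≤ L) (k : ℕ) :
    ∀ ε : ℝ, 0 < ε → ∃ κ : ℝ, 0 < κ ∧ ExpRare.{u} p c C δ Cδ fun W H => OpNormLe H M ∧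
      ∃ e, |e| ≤ K ∧ ∃ v, l2 v = 1 ∧ (∀ i : Fin (2 * p * W), (i : ℕ) < W → v i = 0) ∧
        (richBlocks (2 * p) W (W / L) ε v).Nonempty ∧
        2 * p ≤ (richBlocks (2 * p) W (W / L) ε v).card + k ∧
        l2 (H.mulVec v - e • v) ≤ κ := by
  induction k with
  | zero =>
    intro ε hε
    refine ⟨1, one_pos, expRare_of_forall_not 1 fun W hW H hbad => ?_⟩
    obtain ⟨-, e, -, v, -, hv0, -, hcard, -⟩ := hbad
    have h1 : richBlocks (2 * p) W (W / L) ε v ⊂ Finset.range (2 * p) :=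
      (Finset.ssubset_iff_of_subset (Finset.filter_subset _ _)).2
        ⟨0, Finset.mem_range.2 (by omega), zero_notMem_richBlocks hW hε hv0⟩
    have h2 := Finset.card_lt_card h1
    rw [Finset.card_range] at h2
    omega
  | succ k ih =>
    intro ε hε
    obtain ⟨ε', hε', hε'ε, hrare⟩ := exists_expRare_rich_eq.{u} hp hc hδ hCδ C hM hK hL12 hε
    obtain ⟨κ', hκ', hrare'⟩ := ih ε' hε'
    refine ⟨min ε' κ', lt_min hε' hκ', (hrare.or hrare').mono 0 ?_⟩
    rintro W - H ⟨hHM, e, he, v, hv1, hv0, hne, hcard, hv⟩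
    have hsub := richBlocks_mono (n := 2 * p) (W := W) (h := W / L) hε'ε v
    by_cases hk : 2 * p ≤ (richBlocks (2 * p) W (W / L) ε' v).card + k
    · exact Or.inr ⟨hHM, e, he, v, hv1, hv0, hne.mono hsub, hk, hv.trans (min_le_right _ _)⟩
    · exact Or.inl ⟨hHM, e, he, v, hv1, hv0, hne,
        Finset.eq_of_subset_of_card_le hsub (by omega), hv.trans (min_le_left _ _)⟩

/-- With overwhelming probability `H` has bounded operator norm and `H - e` is bounded below, for
all real `e` simultaneously, on the vectors vanishing on the first block. -/
theorem exists_expRare_not_bounded_below (hp : 0 < p) (hc : 0 < c) (hδ : 0 < δ) (hCδ : 0 < Cδ)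
    (C : ℝ) : ∃ M : ℝ, 0 < M ∧ ∃ κ : ℝ, 0 < κ ∧ κ ≤ 2 ∧ ExpRare.{u} p c C δ Cδ fun W H =>
      ¬ (OpNormLe H M ∧ ∀ (e : ℝ) (v : Fin (2 * p * W) → ℝ),
        (∀ i : Fin (2 * p * W), (i : ℕ) < W → v i = 0) →
          κ * l2 v ≤ l2 (H.mulVec v - e • v)) := by
  obtain ⟨M, hM, hrareM⟩ := exists_expRare_not_opNormLe.{u} p c C hp hδ hCδ
  obtain ⟨ε, hε, L, hL, hrare₀⟩ :=
    exists_expRare_no_rich.{u} hp hc hδ hCδ C hM.le (show 0 ≤ M + 2 by linarith)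
  obtain ⟨κ, hκ, hrare₁⟩ :=
    exists_expRare_rich.{u} hp hc hδ hCδ C hM.le (show 0 ≤ M + 2 by linarith) hL (2 * p) ε hε
  refine ⟨M, hM, min (min ε κ) 2, by positivity, min_le_right _ _,
    (hrareM.or (hrare₀.or hrare₁)).mono 0 ?_⟩
  intro W _ H hbad
  by_contra hcon
  rw [not_or, not_or, not_not] at hcon
  obtain ⟨hHM, h₀, h₁⟩ := hcon
  refine hbad ⟨hHM, fun e v hv0 => ?_⟩
  have hv := l2_nonneg v
  rcases lt_or_ge (M + 2) |e| with he | he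
  · -- `e` is far from the spectrum of `H`.
    have h2 := l2_sub_le (H.mulVec v) (H.mulVec v - e • v)
    rw [sub_sub_cancel, l2_smul] at h2
    have h3 := hHM v
    have h4 : min (min ε κ) 2 * l2 v ≤ 2 * l2 v := by gcongr; exact min_le_right _ _
    nlinarith
  · rcases hv.eq_or_lt with h0 | h0
    · rw [← h0, mul_zero]; exact l2_nonneg _
    · by_contra hlt
      rw [not_le] at hlt
      set w := (l2 v)⁻¹ • v with hw
      have hw1 : l2 w = 1 := by
        rw [hw, l2_smul, abs_of_pos (inv_pos.2 h0), inv_mul_cancel₀ h0.ne']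
      have hw0 : ∀ i : Fin (2 * p * W), (i : ℕ) < W → w i = 0 := fun i hi => by
        rw [hw, Pi.smul_apply, hv0 i hi, smul_zero]
      have hwe : l2 (H.mulVec w - e • w) ≤ min ε κ := by
        have h2 : H.mulVec w - e • w = (l2 v)⁻¹ • (H.mulVec v - e • v) := by
          rw [hw, Matrix.mulVec_smul, smul_sub, smul_comm]
        rw [h2, l2_smul, abs_of_pos (inv_pos.2 h0), inv_mul_le_iff₀ h0, mul_comm (l2 v)]
        exact hlt.le.trans (mul_le_mul_of_nonneg_right (min_le_left _ _) hv)
      rcases Finset.eq_empty_or_nonempty (richBlocks (2 * p) W (W / L) ε w) with hR | hR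
      · exact h₀ ⟨hHM, e, he, w, hw1, hR, hwe.trans (min_le_left _ _)⟩
      · exact h₁ ⟨hHM, e, he, w, hw1, hw0, hR, Nat.le_add_left _ _, hwe.trans (min_le_right _ _)⟩

theorem eventually_mul_exp_le_rpow {p : ℕ} (hp : 0 < p) {a : ℝ} (b : ℝ) (ha : 0 < a)
    (D : ℝ) : ∀ᶠ W : ℕ in atTop, b * Real.exp (-a * W) ≤ ((2 * p * W : ℕ) : ℝ) ^ (-D) := by
  have h1 := ((tendsto_rpow_mul_exp_neg_mul_atTop_nhds_zero D a ha).const_mul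
    (b * ((2 * p : ℕ) : ℝ) ^ D)).comp tendsto_natCast_atTop_atTop
  rw [mul_zero] at h1
  filter_upwards [h1.eventually (ge_mem_nhds one_pos), eventually_ge_atTop 1] with W hW hW1
  have hp0 : (0 : ℝ) < ((2 * p : ℕ) : ℝ) := by exact_mod_cast Nat.mul_pos two_pos hp
  have hN : (0 : ℝ) < ((2 * p * W : ℕ) : ℝ) := by
    exact_mod_cast Nat.mul_pos (Nat.mul_pos two_pos hp) hW1
  rw [Real.rpow_neg hN.le, ← one_div, le_div_iff₀ (by positivity)]
  rw [Nat.cast_mul (2 * p) W, Real.mul_rpow hp0.le (Nat.cast_nonneg W)]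
  simp only [Function.comp_apply] at hW
  linarith

theorem eventually_rpow_neg_le {p : ℕ} (hp : 0 < p) {ζ κ : ℝ} (hζ : 0 < ζ) (hκ : 0 < κ) :
    ∀ᶠ W : ℕ in atTop, ((2 * p * W : ℕ) : ℝ) ^ (-ζ) ≤ κ := by
  have h1 : Tendsto (fun W : ℕ => 2 * p * W) atTop atTop :=
    tendsto_id.const_mul_atTop' (Nat.mul_pos two_pos hp)
  exact (((tendsto_rpow_neg_atTop hζ).comp tendsto_natCast_atTop_atTop).comp h1).eventually
    (ge_mem_nhds hκ)

end LowerBound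

end BandMatrix

theorem lemma4p3 (p : ℕ) (hp : 0 < p) (c C δ Cδ : ℝ) (hc : 0 < c) (hC : 0 < C) (hδ : 0 < δ)
    (hCδ : 0 < Cδ) (K : ℝ) (hK : 0 < K) :
    ∃ C_K : ℝ, 0 < C_K ∧ ∀ ζ : ℝ, 0 < ζ → ∀ D : ℝ, 0 < D → ∃ N₀ : ℕ, ∀ W : ℕ, N₀ ≤ 2 * p * W →
      ∀ (Ω : Type*) [MeasurableSpace Ω] (P : Measure Ω) [IsProbabilityMeasure P]
        (H : Ω → Matrix (Fin (2 * p * W)) (Fin (2 * p * W)) ℝ)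
        (hH : BandMatrix.IsBandEnsemble p W c C δ Cδ P H),
        P {ω | ∃ g : Fin (2 * p * W) → ℝ, ‖g‖ ≤ ((2 * p * W : ℕ) : ℝ) ^ (-ζ) ∧
            ∃ k ∈ Finset.Icc 1 (2 * p * W), ∃ e ∈ BandMatrix.curveDom W (hH.symm ω) g k,
              |BandMatrix.curve W (hH.symm ω) g k e| ≤ K ∧
              ENNReal.ofReal C_K < BandMatrix.absSlope (BandMatrix.curve W (hH.symm ω) g k) e}
          ≤ ENNReal.ofReal (((2 * p * W : ℕ) : ℝ) ^ (-D)) := by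
  obtain ⟨M, hM, κ, hκ, hκ2, a, ha, b, -, W₀, hrare⟩ :=
    BandMatrix.exists_expRare_not_bounded_below hp hc hδ hCδ C
  refine ⟨(2 * (K + M + 1) / κ) ^ 2, by positivity, fun ζ hζ D _ => ?_⟩
  obtain ⟨W₁, hW₁⟩ := eventually_atTop.1 ((BandMatrix.eventually_rpow_neg_le hp hζ
    (half_pos hκ)).and (BandMatrix.eventually_mul_exp_le_rpow hp b ha D))
  refine ⟨2 * p * max W₀ W₁, fun W hW Ω _ P _ H hH => ?_⟩
  have hWW : max W₀ W₁ ≤ W := Nat.le_of_mul_le_mul_left hW (by omega)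
  obtain ⟨hζκ, hD⟩ := hW₁ W ((le_max_right _ _).trans hWW)
  refine le_trans (measure_mono ?_) ((hrare W ((le_max_left _ _).trans hWW) Ω P H hH).trans
    (ENNReal.ofReal_le_ofReal hD))
  rintro ω ⟨g, hg, k, -, e, he, hek, hslope⟩ ⟨hHM, hlow⟩
  exact hslope.not_ge (BandMatrix.absSlope_curve_le_of_bounded_below (hH.symm ω) hκ hκ2 hHM hlow
    (hg.trans hζκ) he hek)
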